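/- All posets are strict partial orders on non-empty sets. Let $\mathcal P$ be the (countable) set of isomorphism classes of finite posets. For finite posets $Q,P$ let $t(Q,P)$ be the proportion of all maps $Q\to P$ that satisfy $x<_Qy\Rightarrow\varphi(x)<_P\varphi(y)$, and let $t_{\mathrm{ind}}(Q,P)$ be the proportion of all injective maps $Q\to P$ that satisfy $x<_Qy\Leftrightarrow\varphi(x)<_P\varphi(y)$ (and $t_{\mathrm{ind}}(Q,P)=0$ if $|Q|>|P|$). Identify $P\in\mathcal P$ with the point $\bigl((t(Q,P))_{Q\in\mathcal P},|P|^{-1}\bigr)$ of $[0,1]^{\mathcal P}\times[0,1]$, let $\overline{\mathcal P}$ be the closure of $\mathcal P$ in this product (the space of poset limits), and let $\mathcal P_\infty=\overline{\mathcal P}\setminus\mathcal P$ be the set of proper poset limits. The functionals $t(Q,\cdot)$ and $t_{\mathrm{ind}}(Q,\cdot)$ extend continuously to $\overline{\mathcal P}$. An ordered probability space is a probability space $(S,\mathcal F,\mu)$ with a partial order $\prec$ such that $\{(x,y):x\prec y\}$ is measurable in $S\times S$. A kernel on it is a measurable $W:S\times S\to[0,1]$ such that $W(x,y)>0\Rightarrow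 x\prec y$, and $W(x,y),W(y,z)>0\Rightarrow W(x,z)=1$. The random poset $P(\infty,W)$ on $\mathbb N$ is defined by $i<j\iff\xi_{ij}<W(X_i,X_j)$, where the $X_i$ are i.i.d. with law $\mu$ and the $\xi_{ij}$ are i.i.d. uniform on $(0,1)$ and independent of the $X_i$. The kernel $W$ represents $\Pi\in\mathcal P_\infty$ if $t(Q,\Pi)=\int_{S^{|Q|}}\prod_{i<_Qj}W(x_i,x_j)\,d\mu(x_1)\cdots d\mu(x_{|Q|})$ for every finite poset $Q$. Every $\Pi\in\mathcal P_\infty$ is represented by some kernel, and the law of $P(\infty,W)$ is the same for all kernels $W$ that represent $\Pi$; $P(\infty,\Pi)$ denotes a random poset with this law. If $\Pi$ is random, $P(\infty,\Pi)$ has the corresponding mixture of these laws. A random poset $R$ on $\mathbb N$ is exchangeable if its law is invariant under all permutations of $\mathbb N$. For a finite labelled poset $Q$ with ground set $A\subset\mathbb N$, $R\supset Q$ means that $x<_Qy\Rightarrow x<_Ry$ for $x,y\in A$. The restriction $R|_{[n]}$ of $R$ to $[n]=\{1,\dots,n\}$ is regarded as an element of $\mathcal P\subset\overline{\mathcal P}$.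 **Theorem.** (i) There is a one-to-one correspondence between the distributions of random elements $\Pi$ of $\mathcal P_\infty$ and the distributions of exchangeable random posets $R$ on $\mathbb N$, given by $R\overset{d}{=}P(\infty,\Pi)$. For random $\Pi\in\mathcal P_\infty$ and exchangeable $R$ this relation is equivalent to $$\mathbb E\,t(Q,\Pi)=\mathbb P(R\supset Q)\quad\text{for every finite labelled poset $Q$ with ground set $A\subset\mathbb N$,}$$ and also equivalent to $$\mathbb E\,t_{\mathrm{ind}}(Q,\Pi)=\mathbb P(R|_A=Q)\quad\text{for every finite labelled poset $Q$ with ground set $A\subset\mathbb N$.}$$ If it holds, then $R|_{[n]}\to\Pi$ in distribution in $\overline{\mathcal P}$ as $n\to\infty$. (ii) There is a one-to-one correspondence between the proper poset limits $\Pi\in\mathcal P_\infty$ and the extreme points of the set of distributions of exchangeable random posets $R$ on $\mathbb N$, given by $R\overset{d}{=}P(\infty,\Pi)$. For $\Pi\in\mathcal P_\infty$ and exchangeable $R$ this relation is equivalent to $$t(Q,\Pi)=\mathbb P(R\supset Q)\quad\text{for every finite labelled poset $Q$ with ground set $A\subset\mathbb N$,}$$ and also equivalent to $$t_{\mathrm{ind}}(Q,\Pi)=\mathbb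 P(R|_A=Q)\quad\text{for every finite labelled poset $Q$ with ground set $A\subset\mathbb N$.}$$ If it holds, then $R|_{[n]}\to\Pi$ almost surely in $\overline{\mathcal P}$ as $n\to\infty$. -/

import Mathlib

open MeasureTheory Filter Topology

universe u

noncomputable section

namespace PosetLimits

/-! ### Labelled posets -/

/-- The (strict) partial orders on the ground set `V`, given by their indicators
`1[x < y]`. For `V = ℕ` this carries the product `σ`-field of `{0,1}^(ℕ × ℕ)`. -/
abbrev PosetOn (V : Type*) : Type _ :=
  {r : V → V → Bool //
    (∀ x, r x x = false) ∧ ∀ x y z, r x y = true → r y z = true → r x z = true}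

namespace PosetOn

variable {V U V' U' : Type*}

/-- The strict order relation of a labelled poset. -/
def lt (P : PosetOn V) (x y : V) : Prop := P.1 x y = true

/-- The poset on `U` pulled back along a map `U → V`. -/
def comap (P : PosetOn V) (f : U → V) : PosetOn U :=
  ⟨fun x y => P.1 (f x) (f y),
    fun x => P.2.1 (f x), fun x y z => P.2.2 (f x) (f y) (f z)⟩

/-- Isomorphism of labelled posets. -/
def Iso (P : PosetOn V) (Q : PosetOn U) : Prop :=
  ∃ e : V ≃ U, ∀ x y, P.lt x y ↔ Q.lt (e x) (e y)

/-- `t(Q,P)`: the proportion of all maps `Q → P` that are poset homomorphisms. -/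
def homDensity (Q : PosetOn V) (P : PosetOn U) : ℝ :=
  (Nat.card {f : V → U // ∀ x y, Q.lt x y → P.lt (f x) (f y)} : ℝ) / Nat.card (V → U)

/-- `t_ind(Q,P)`: the proportion of all injective maps `Q → P` that are isomorphisms onto an
induced subposet of `P`; it is `0` if there are no injective maps. -/
def indDensity (Q : PosetOn V) (P : PosetOn U) : ℝ :=
  (Nat.card {f : V ↪ U // ∀ x y, Q.lt x y ↔ P.lt (f x) (f y)} : ℝ) / Nat.card (V ↪ U)

theorem homDensity_mem [Finite V] [Finite U] (Q : PosetOn V) (P : PosetOn U) :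
    homDensity Q P ∈ unitInterval := by
  refine ⟨div_nonneg (Nat.cast_nonneg _) (Nat.cast_nonneg _), ?_⟩
  refine div_le_one_of_le₀ ?_ (Nat.cast_nonneg _)
  exact_mod_cast Nat.card_le_card_of_injective _
    (Subtype.val_injective (p := fun f : V → U => ∀ x y, Q.lt x y → P.lt (f x) (f y)))

theorem homDensity_congr {Q : PosetOn V} {Q' : PosetOn V'} {P : PosetOn U} {P' : PosetOn U'}
    (hQ : Q.Iso Q') (hP : P.Iso P') : homDensity Q P = homDensity Q' P' := by
  obtain ⟨e, he⟩ := hQ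
  obtain ⟨g, hg⟩ := hP
  unfold homDensity
  rw [Nat.card_congr (e.arrowCongr g)]
  congr 2
  refine Nat.card_congr ((e.arrowCongr g).subtypeEquiv fun f => ?_)
  rw [← e.forall_congr_right]
  refine forall_congr' fun x => ?_
  rw [← e.forall_congr_right]
  refine forall_congr' fun y => ?_
  simp [← he, ← hg]

theorem indDensity_congr {Q : PosetOn V} {Q' : PosetOn V'} {P : PosetOn U} {P' : PosetOn U'}
    (hQ : Q.Iso Q') (hP : P.Iso P') : indDensity Q P = indDensity Q' P' := by
  obtain ⟨e, he⟩ := hQ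
  obtain ⟨g, hg⟩ := hP
  unfold indDensity
  rw [Nat.card_congr (e.embeddingCongr g)]
  congr 2
  refine Nat.card_congr ((e.embeddingCongr g).subtypeEquiv fun f => ?_)
  rw [← e.forall_congr_right]
  refine forall_congr' fun x => ?_
  rw [← e.forall_congr_right]
  refine forall_congr' fun y => ?_
  simp [← he, ← hg]

end PosetOn

/-! ### Unlabelled finite posets -/

/-- Labelled finite non-empty posets on the standard ground sets. -/
abbrev FinPosetL : Type := Σ n : ℕ, PosetOn (Fin (n + 1))

/-- Isomorphism of labelled finite posets. -/
instance finPosetSetoid : Setoid FinPosetL where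
  r P Q := P.2.Iso Q.2
  iseqv :=
    { refl := fun _ => ⟨Equiv.refl _, fun _ _ => Iff.rfl⟩
      symm := fun ⟨e, he⟩ => ⟨e.symm, fun x y => by simp [he]⟩
      trans := fun ⟨e, he⟩ ⟨g, hg⟩ => ⟨e.trans g, fun x y => by simp [he, hg]⟩ }

/-- The countable set of unlabelled finite (non-empty) posets. -/
def FinPoset : Type := Quotient finPosetSetoid

instance : Countable FinPoset := by
  unfold FinPoset
  infer_instance

/-- The isomorphism class of a poset on a finite non-empty ground set. -/
def PosetOn.unlabelled {V : Type*} [Fintype V] [Nonempty V] (Q : PosetOn V) : FinPoset :=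
  Quotient.mk finPosetSetoid
    ⟨Fintype.card V - 1,
      Q.comap (Fintype.equivFinOfCardEq
        (Nat.sub_add_cancel (Fintype.card_pos (α := V))).symm).symm⟩

namespace FinPoset

/-- `t(Q,P)` for unlabelled finite posets. -/
def t (Q P : FinPoset) : unitInterval :=
  Quotient.liftOn₂ Q P (fun Q P => ⟨Q.2.homDensity P.2, Q.2.homDensity_mem P.2⟩)
    fun _ _ _ _ hQ hP => Subtype.ext (PosetOn.homDensity_congr hQ hP)

/-- `t_ind(Q,P)` for unlabelled finite posets. -/
def tInd (Q P : FinPoset) : ℝ :=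
  Quotient.liftOn₂ Q P (fun Q P => Q.2.indDensity P.2)
    fun _ _ _ _ hQ hP => PosetOn.indDensity_congr hQ hP

/-- The number `|P|` of points of `P`. -/
def size (P : FinPoset) : ℕ :=
  Quotient.liftOn P (fun P => P.1 + 1) fun P Q h => by
    obtain ⟨e, -⟩ := h
    simpa using Fintype.card_congr e

/-- `|P|⁻¹` as an element of `[0,1]`. -/
def invSize (P : FinPoset) : unitInterval :=
  ⟨(P.size : ℝ)⁻¹, inv_nonneg.2 (Nat.cast_nonneg _), Nat.cast_inv_le_one _⟩

/-- The embedding `P ↦ ((t(Q,P))_Q, |P|⁻¹)` of the unlabelled finite posets into a countable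
power of `[0,1]`. -/
def tauPlus (P : FinPoset) : (FinPoset → unitInterval) × unitInterval :=
  (fun Q => t Q P, invSize P)

end FinPoset

/-! ### Poset limits -/

/-- The compact metric space of poset limits: the closure of the set of finite posets. -/
abbrev PosetLimit : Type := closure (Set.range FinPoset.tauPlus)

/-- A finite poset as a point of the space of poset limits. -/
def FinPoset.toLimit (P : FinPoset) : PosetLimit :=
  ⟨FinPoset.tauPlus P, subset_closure (Set.mem_range_self P)⟩

/-- The proper poset limits: the poset limits that are not finite posets. -/
abbrev ProperPosetLimit : Type := {Γ : PosetLimit // Γ ∉ Set.range FinPoset.toLimit}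

/-- `t(Q,Γ)` for a poset limit `Γ`: the extension of `t(Q,·)` by continuity, a coordinate. -/
def PosetLimit.t (Q : FinPoset) (Γ : PosetLimit) : ℝ := (Γ.1.1 Q : ℝ)

/-- `t_ind(Q,Γ)` for a poset limit `Γ`: the extension of `t_ind(Q,·)` by continuity, i.e. the
limit of `t_ind(Q,P)` as the finite poset `P` tends to `Γ`. -/
def PosetLimit.tInd (Q : FinPoset) (Γ : PosetLimit) : ℝ :=
  limUnder (comap FinPoset.toLimit (𝓝 Γ)) (FinPoset.tInd Q)

/-! ### Kernels on ordered probability spaces -/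

/-- A probability space with a (strict) partial order that is measurable as a subset of the
product. -/
structure OrderedProbabilitySpace where
  carrier : Type u
  [measurableSpace : MeasurableSpace carrier]
  μ : Measure carrier
  [isProbabilityMeasure : IsProbabilityMeasure μ]
  lt : carrier → carrier → Prop
  lt_irrefl : ∀ x, ¬ lt x x
  lt_trans : ∀ x y z, lt x y → lt y z → lt x z
  measurableSet_lt : MeasurableSet {p : carrier × carrier | lt p.1 p.2}

attribute [instance] OrderedProbabilitySpace.measurableSpace
attribute [instance] OrderedProbabilitySpace.isProbabilityMeasure

/-- A kernel on an ordered probability space. -/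
structure PosetKernel (S : OrderedProbabilitySpace.{u}) where
  W : S.carrier → S.carrier → unitInterval
  measurable_W : Measurable fun p : S.carrier × S.carrier => W p.1 p.2
  lt_of_pos : ∀ x y, 0 < W x y → S.lt x y
  eq_one_of_pos : ∀ x y z, 0 < W x y → 0 < W y z → W x z = 1

/-- The uniform distribution on `(0,1)`. -/
def uniform01 : Measure (Set.Ioo (0 : ℝ) 1) := Measure.comap Subtype.val volume

instance : IsProbabilityMeasure uniform01 := by
  constructor
  rw [uniform01, comap_subtype_coe_apply measurableSet_Ioo, Set.image_univ, Subtype.range_coe]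
  simp

namespace PosetKernel

variable {S : OrderedProbabilitySpace.{u}}

/-- The infinite poset made from points `X i` and thresholds `ξ (i, j)`:
`i < j` if and only if `ξ (i, j) < W (X i) (X j)`. -/
def sample (K : PosetKernel S) (ω : (ℕ → S.carrier) × (ℕ × ℕ → Set.Ioo (0 : ℝ) 1)) :
    PosetOn ℕ := by
  classical
  have pos : ∀ i j, (ω.2 (i, j) : ℝ) < K.W (ω.1 i) (ω.1 j) → 0 < K.W (ω.1 i) (ω.1 j) :=
    fun i j h => by exact_mod_cast (ω.2 (i, j)).2.1.trans h
  exact ⟨fun i j => decide ((ω.2 (i, j) : ℝ) < K.W (ω.1 i) (ω.1 j)),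
    fun i => decide_eq_false fun h => S.lt_irrefl _ (K.lt_of_pos _ _ (pos i i h)),
    fun i j k hij hjk => by
      have h := K.eq_one_of_pos _ _ _ (pos i j (of_decide_eq_true hij))
        (pos j k (of_decide_eq_true hjk))
      refine decide_eq_true ?_
      rw [h]
      exact (ω.2 (i, k)).2.2⟩

/-- The distribution of the random infinite poset `P(∞,W)`: the points `X i` are i.i.d. with
distribution `μ` and the thresholds `ξ (i, j)` are i.i.d. uniform and independent of them. -/
def law (K : PosetKernel S) : Measure (PosetOn ℕ) :=
  ((Measure.infinitePi fun _ : ℕ => S.μ).prod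
    (Measure.infinitePi fun _ : ℕ × ℕ => uniform01)).map K.sample

open Classical in
/-- `Γ = Γ_W`, i.e. the kernel `W` represents the proper poset limit `Γ`:
`t(Q,Γ) = ∫ ∏_{i <_Q j} W(x_i,x_j) dμ(x_1) ⋯ dμ(x_|Q|)` for every finite poset `Q`. -/
def Represents (K : PosetKernel S) (Γ : ProperPosetLimit) : Prop :=
  ∀ (n : ℕ) (Q : PosetOn (Fin (n + 1))),
    PosetLimit.t Q.unlabelled Γ.1 =
      ∫ x : Fin (n + 1) → S.carrier,
        ∏ i, ∏ j, (if Q.lt i j then (K.W (x i) (x j) : ℝ) else 1)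
        ∂(Measure.pi fun _ => S.μ)

end PosetKernel

open Classical in
/-- The distribution of the random infinite poset `P(∞,Γ)`, for a non-random proper poset limit
`Γ`: the distribution of `P(∞,W)` for any kernel `W` that represents `Γ`. -/
def pInftyLaw (Γ : ProperPosetLimit) : Measure (PosetOn ℕ) :=
  if h : ∃ (S : OrderedProbabilitySpace.{0}) (K : PosetKernel S), K.Represents Γ then
    h.choose_spec.choose.law
  else 0

/-- The distribution of `P(∞,Γ)` for a random proper poset limit `Γ` with distribution `m`
(independent of the other variables of the construction): the mixture over `m`. -/
def pInftyMixture (m : Measure ProperPosetLimit) : Measure (PosetOn ℕ) := m.bind pInftyLaw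

/-! ### Exchangeable random infinite posets -/

/-- Invariance of the distribution of a random infinite poset under all permutations. -/
def Exchangeable (ν : Measure (PosetOn ℕ)) : Prop :=
  ∀ σ : Equiv.Perm ℕ, ν.map (fun R => R.comap σ) = ν

/-- The convex set of the distributions of exchangeable random infinite posets. -/
def exchangeableLaws : Set (Measure (PosetOn ℕ)) :=
  {ν | IsProbabilityMeasure ν ∧ Exchangeable ν}

/-- The event `R ⊃ Q`, for a labelled poset `Q` with ground set `A`. -/
def containsEvent {A : Finset ℕ} (Q : PosetOn A) : Set (PosetOn ℕ) :=
  {R | ∀ x y : A, Q.lt x y → R.lt x y}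

/-- The event `R|_A = Q`, for a labelled poset `Q` with ground set `A`. -/
def restrictEvent {A : Finset ℕ} (Q : PosetOn A) : Set (PosetOn ℕ) :=
  {R | R.comap (fun x : A => (x : ℕ)) = Q}

/-- The restriction of an infinite poset to its first `n + 1` points, regarded as an unlabelled
finite poset and thus as a point of the space of poset limits. -/
def initialSegment (n : ℕ) (R : PosetOn ℕ) : PosetLimit :=
  (R.comap (fun i : Fin (n + 1) => (i : ℕ))).unlabelled.toLimit

end PosetLimits

end

open PosetLimits

/-!
A poset limit `Γ` prescribes the probabilities of all events `R ⊃ Q`, and these determine a law on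
infinite posets. For a finite poset it is the law of a sample with replacement, so by compactness
it exists for every `Γ`. It is exchangeable and, since `t(Q₁ + Q₂, Γ) = t(Q₁, Γ) t(Q₂, Γ)`, also
dissociated.

To represent a proper limit by a kernel, split `ℕ` into a base copy and a second copy of `ℕ`. The
position of a point of the second copy relative to the base, its type, is i.i.d. given the base, and
the entries within the second copy are conditionally independent given the types. Dissociation
makes almost every fixed base as good as a random one, so that the conditional probability of
`x < y` given the two types is a kernel on the space of types. It satisfies the transitivity
conditions only almost everywhere; restricting it to density points makes them exact.

The second moment of `t(Q, R|ₙ)` is controlled by `t(Q + Q, Γ) = t(Q, Γ)²` up to `O(1/n)`. This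
gives almost sure convergence along the squares, and monotonicity of the number of homomorphisms
fills the gaps. Consequently a mixture determines its mixing measure. Conversely, any cluster point
of the laws of `R|ₙ` is a mixing measure for a given exchangeable `R`, and the extreme points are
the mixtures over Dirac measures.
-/

noncomputable section

namespace PosetLimits

open ProbabilityTheory

open scoped ENNReal

/-! ### Events in spaces of labelled posets -/

section events

variable {V U : Type*}

/-- The event that a random poset on `U` contains all pairs of `D`. -/
def pairsEvent (D : Finset (U × U)) : Set (PosetOn U) := {R | ∀ p ∈ D, R.lt p.1 p.2}

/-- The event that `ι` is a homomorphism from `Q` to a random poset on `U`. -/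
def embEvent (Q : PosetOn V) (ι : V → U) : Set (PosetOn U) :=
  {R | ∀ x y, Q.lt x y → R.lt (ι x) (ι y)}

theorem containsEvent_eq_embEvent {A : Finset ℕ} (Q : PosetOn A) :
    containsEvent Q = embEvent Q fun x : A => (x : ℕ) := rfl

theorem PosetOn.continuous_apply (i j : U) : Continuous fun R : PosetOn U => R.1 i j :=
  (_root_.continuous_apply j).comp ((_root_.continuous_apply i).comp continuous_subtype_val)

theorem PosetOn.measurable_apply (i j : U) : Measurable fun R : PosetOn U => R.1 i j :=
  (measurable_pi_apply j).comp ((measurable_pi_apply i).comp measurable_subtype_coe)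

theorem PosetOn.measurable_comap (f : V → U) : Measurable fun R : PosetOn U => R.comap f :=
  Measurable.subtype_mk <| measurable_pi_lambda _ fun i => measurable_pi_lambda _ fun j =>
    PosetOn.measurable_apply (f i) (f j)

theorem isClopen_lt (i j : U) : IsClopen {R : PosetOn U | R.lt i j} :=
  (isClopen_discrete {true}).preimage (PosetOn.continuous_apply i j)

theorem isClopen_pairsEvent (D : Finset (U × U)) : IsClopen (pairsEvent D) := by
  simp only [pairsEvent, Set.ofPred_forall]
  exact D.finite_toSet.isClopen_biInter fun p _ => isClopen_lt _ _

theorem isClopen_embEvent [Finite V] (Q : PosetOn V) (ι : V → U) : IsClopen (embEvent Q ι) := by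
  simp only [embEvent, Set.ofPred_forall]
  exact isClopen_iInter_of_finite fun x => isClopen_iInter_of_finite fun y =>
    isClopen_iInter_of_finite fun _ => isClopen_lt _ _

instance : CompactSpace (PosetOn U) := by
  have eval : ∀ i j b, IsClopen {r : U → U → Bool | r i j = b} := fun i j b =>
    (isClopen_discrete {b}).preimage (by fun_prop : Continuous fun r : U → U → Bool => r i j)
  suffices hc : IsClosed {r : U → U → Bool |
      (∀ x, r x x = false) ∧ ∀ x y z, r x y = true → r y z = true → r x z = true} from
    isCompact_iff_compactSpace.1 hc.isCompact
  simp only [Set.ofPred_and, Set.ofPred_forall]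
  refine IsClosed.inter (isClosed_iInter fun x => (eval x x false).1) ?_
  exact isClosed_iInter fun x => isClosed_iInter fun y => isClosed_iInter fun z =>
    isClosed_imp (eval x y true).2 (isClosed_imp (eval y z true).2 (eval x z true).1)

theorem isPiSystem_pairsEvent : IsPiSystem (Set.range (pairsEvent (U := U))) := by
  classical
  rintro _ ⟨D, rfl⟩ _ ⟨D', rfl⟩ -
  refine ⟨D ∪ D', Set.ext fun R => ?_⟩
  simp only [pairsEvent, Set.mem_ofPred_eq, Set.mem_inter_iff, Finset.forall_mem_union]

theorem measurableSet_pairsEvent [Countable U] (D : Finset (U × U)) :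
    MeasurableSet (pairsEvent D) :=
  (isClopen_pairsEvent D).2.measurableSet

theorem measurableSet_embEvent [Finite V] [Countable U] (Q : PosetOn V) (ι : V → U) :
    MeasurableSet (embEvent Q ι) :=
  (isClopen_embEvent Q ι).2.measurableSet

theorem generateFrom_pairsEvent [Countable U] :
    (inferInstance : MeasurableSpace (PosetOn U)) =
      MeasurableSpace.generateFrom (Set.range pairsEvent) := by
  refine le_antisymm ?_ (MeasurableSpace.generateFrom_le ?_)
  · have : @Measurable (PosetOn U) (U → U → Bool)
        (MeasurableSpace.generateFrom (Set.range pairsEvent)) _ Subtype.val := by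
      refine @measurable_pi_lambda _ _ _ (_) _ _ fun i =>
        @measurable_pi_lambda _ _ _ (_) _ _ fun j => ?_
      refine @measurable_to_bool _ (_) _ ?_
      refine MeasurableSpace.measurableSet_generateFrom ⟨{(i, j)}, ?_⟩
      ext R
      simp [pairsEvent, PosetOn.lt]
    exact this.comap_le
  · rintro _ ⟨D, rfl⟩
    exact measurableSet_pairsEvent D

open Classical in
theorem pairsEvent_eq_empty_or_embEvent [Nonempty U] (D : Finset (U × U)) :
    pairsEvent D = ∅ ∨ ∃ (A : Finset U) (_ : Nonempty A) (Q : PosetOn A),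
      pairsEvent D = embEvent Q (Subtype.val : A → U) := by
  rcases (pairsEvent D).eq_empty_or_nonempty with h | ⟨R₀, h₀⟩
  · exact .inl h
  let u₀ := Classical.arbitrary U
  let A := insert u₀ (D.image Prod.fst ∪ D.image Prod.snd)
  -- `Q` is the intersection of all posets that contain the pairs of `D`.
  let Q : PosetOn A := ⟨fun x y => decide (∀ R ∈ pairsEvent D, R.lt x y),
    fun x => decide_eq_false fun h => by
      have := h R₀ h₀
      simp [PosetOn.lt, R₀.2.1 x] at this,
    fun x y z hxy hyz => decide_eq_true fun R hR =>
      R.2.2 _ _ _ (of_decide_eq_true hxy R hR) (of_decide_eq_true hyz R hR)⟩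
  refine .inr ⟨A, ⟨u₀, Finset.mem_insert_self _ _⟩, Q, Set.Subset.antisymm
    (fun R hR x y hxy => of_decide_eq_true hxy R hR) fun R hR p hp => ?_⟩
  have hfst : p.1 ∈ A := Finset.mem_insert_of_mem
    (Finset.mem_union_left _ (Finset.mem_image_of_mem _ hp))
  have hsnd : p.2 ∈ A := Finset.mem_insert_of_mem
    (Finset.mem_union_right _ (Finset.mem_image_of_mem _ hp))
  exact hR ⟨p.1, hfst⟩ ⟨p.2, hsnd⟩ (decide_eq_true fun R' hR' => hR' p hp)

theorem measure_ext_of_containsEvent {ν ν' : Measure (PosetOn ℕ)} [IsProbabilityMeasure ν]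
    [IsProbabilityMeasure ν']
    (h : ∀ (A : Finset ℕ) [Nonempty A] (Q : PosetOn A),
      ν.real (containsEvent Q) = ν'.real (containsEvent Q)) : ν = ν' := by
  refine ext_of_generate_finite _ generateFrom_pairsEvent isPiSystem_pairsEvent ?_ (by simp)
  rintro _ ⟨D, rfl⟩
  rcases pairsEvent_eq_empty_or_embEvent D with hempty | ⟨A, hA, Q, hQ⟩
  · simp [hempty]
  · rw [hQ]
    exact (measureReal_eq_measureReal_iff ..).1 (h A Q)

end events

/-! ### Homomorphism densities -/

section densities

variable {V V' U U' : Type*}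

theorem PosetOn.iso_comap (Q : PosetOn V) (e : V' ≃ V) : (Q.comap e).Iso Q :=
  ⟨e, fun _ _ => Iff.rfl⟩

theorem PosetOn.Iso.symm {Q : PosetOn V} {P : PosetOn U} (h : Q.Iso P) : P.Iso Q := by
  obtain ⟨e, he⟩ := h
  exact ⟨e.symm, fun x y => by simp [he]⟩

theorem PosetOn.Iso.trans {Q : PosetOn V} {P : PosetOn U} {P' : PosetOn U'}
    (h : Q.Iso P) (h' : P.Iso P') : Q.Iso P' := by
  obtain ⟨e, he⟩ := h
  obtain ⟨g, hg⟩ := h'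
  exact ⟨e.trans g, fun x y => by simp [he, hg]⟩

theorem PosetOn.unlabelled_eq_of_iso [Fintype V] [Nonempty V] [Fintype U] [Nonempty U]
    {Q : PosetOn V} {P : PosetOn U} (h : Q.Iso P) : Q.unlabelled = P.unlabelled :=
  Quotient.sound (s := finPosetSetoid)
    (((Q.iso_comap _).trans h).trans (P.iso_comap _).symm)

theorem FinPoset.exists_rep (P : FinPoset) :
    ∃ (n : ℕ) (p : PosetOn (Fin (n + 1))), p.unlabelled = P := by
  induction P using Quotient.inductionOn with
  | h P => exact ⟨P.1, P.2, Quotient.sound (s := finPosetSetoid) (P.2.iso_comap _)⟩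

/-- The disjoint union of two posets. -/
def PosetOn.sum (Q : PosetOn V) (Q' : PosetOn V') : PosetOn (V ⊕ V') :=
  ⟨fun a b => match a, b with
    | .inl x, .inl y => Q.1 x y
    | .inr x, .inr y => Q'.1 x y
    | _, _ => false,
    by rintro (x | x); exacts [Q.2.1 x, Q'.2.1 x],
    by
      rintro (x | x) (y | y) (z | z) h h' <;>
        first | exact Q.2.2 x y z h h' | exact Q'.2.2 x y z h h' | cases h | cases h'⟩

theorem PosetOn.sum_hom_iff {Q : PosetOn V} {Q' : PosetOn V'} {P : PosetOn U}
    {f : V ⊕ V' → U} :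
    (∀ x y, (Q.sum Q').lt x y → P.lt (f x) (f y)) ↔
      (∀ x y, Q.lt x y → P.lt (f (.inl x)) (f (.inl y))) ∧
        ∀ x y, Q'.lt x y → P.lt (f (.inr x)) (f (.inr y)) := by
  simp [Sum.forall, PosetOn.lt, PosetOn.sum]

theorem PosetOn.homDensity_sum [Finite V] [Finite V'] (Q : PosetOn V)
    (Q' : PosetOn V') (P : PosetOn U) :
    (Q.sum Q').homDensity P = Q.homDensity P * Q'.homDensity P := by
  have hom_card : Nat.card {f : V ⊕ V' → U // ∀ x y, (Q.sum Q').lt x y → P.lt (f x) (f y)} =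
      Nat.card {f : V → U // ∀ x y, Q.lt x y → P.lt (f x) (f y)} *
        Nat.card {f : V' → U // ∀ x y, Q'.lt x y → P.lt (f x) (f y)} := by
    rw [← Nat.card_prod]
    exact Nat.card_congr (((Equiv.sumArrowEquivProdArrow V V' U).subtypeEquiv fun _ =>
      PosetOn.sum_hom_iff).trans (Equiv.subtypeProdEquivProd ..))
  unfold homDensity
  rw [hom_card, Nat.card_congr (Equiv.sumArrowEquivProdArrow V V' U), Nat.card_prod,
    Nat.cast_mul, Nat.cast_mul, div_mul_div_comm]

theorem PosetLimit.t_toLimit (Q P : FinPoset) : PosetLimit.t Q P.toLimit = FinPoset.t Q P := rfl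

theorem PosetLimit.continuous_t (Q : FinPoset) : Continuous (PosetLimit.t Q) := by
  unfold PosetLimit.t
  fun_prop

theorem PosetLimit.t_mem (Q : FinPoset) (Γ : PosetLimit) : PosetLimit.t Q Γ ∈ unitInterval :=
  (Γ.1.1 Q).2

theorem denseRange_toLimit : DenseRange FinPoset.toLimit := fun Γ => by
  rw [closure_subtype, ← Set.range_comp]
  exact Γ.2

variable [Fintype V] [Nonempty V] [Fintype V'] [Nonempty V'] [Fintype U] [Nonempty U]

theorem FinPoset.t_unlabelled (Q : PosetOn V) (P : PosetOn U) :
    (FinPoset.t Q.unlabelled P.unlabelled : ℝ) = Q.homDensity P :=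
  PosetOn.homDensity_congr (Q.iso_comap _) (P.iso_comap _)

theorem FinPoset.tInd_unlabelled (Q : PosetOn V) (P : PosetOn U) :
    FinPoset.tInd Q.unlabelled P.unlabelled = Q.indDensity P :=
  PosetOn.indDensity_congr (Q.iso_comap _) (P.iso_comap _)

theorem FinPoset.size_unlabelled (P : PosetOn U) : P.unlabelled.size = Fintype.card U :=
  Nat.sub_add_cancel (Fintype.card_pos (α := U))

theorem PosetLimit.t_sum (Q : PosetOn V) (Q' : PosetOn V') (Γ : PosetLimit) :
    PosetLimit.t (Q.sum Q').unlabelled Γ =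
      PosetLimit.t Q.unlabelled Γ * PosetLimit.t Q'.unlabelled Γ := by
  induction Γ using denseRange_toLimit.induction_on with
  | hp => exact isClosed_eq (continuous_t _) ((continuous_t _).mul (continuous_t _))
  | ih P =>
    obtain ⟨n, p, rfl⟩ := P.exists_rep
    simp only [PosetLimit.t_toLimit, FinPoset.t_unlabelled, PosetOn.homDensity_sum]

end densities

/-! ### The law of the infinite poset of a poset limit -/

/-- The events `R ⊃ Q` have the probabilities prescribed by the poset limit `Γ`. -/
def HasDensities (ν : Measure (PosetOn ℕ)) (Γ : PosetLimit) : Prop :=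
  ∀ (A : Finset ℕ) [Nonempty A] (Q : PosetOn A),
    ν.real (containsEvent Q) = PosetLimit.t Q.unlabelled Γ

theorem HasDensities.real_embEvent {ν : Measure (PosetOn ℕ)} {Γ : PosetLimit} (h : HasDensities ν Γ)
    {V : Type*} [Fintype V] [Nonempty V] (Q : PosetOn V) {ι : V → ℕ}
    (hι : Function.Injective ι) : ν.real (embEvent Q ι) = PosetLimit.t Q.unlabelled Γ := by
  classical
  let A : Finset ℕ := Finset.univ.map ⟨ι, hι⟩
  let e : V ≃ A := Equiv.ofBijective (fun x => ⟨ι x, by simp [A]⟩)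
    ⟨fun x y hxy => hι (by simpa using hxy), fun ⟨y, hy⟩ => by
      obtain ⟨x, -, rfl⟩ := Finset.mem_map.1 hy
      exact ⟨x, rfl⟩⟩
  have : Nonempty A := e.nonempty_congr.1 inferInstance
  rw [← PosetOn.unlabelled_eq_of_iso (Q.iso_comap e.symm), ← h A (Q.comap e.symm)]
  have comap_lt (x y : V) : (Q.comap e.symm).lt (e x) (e y) = Q.lt x y := by
    simp [PosetOn.lt, PosetOn.comap]
  exact congrArg ν.real (Set.ext fun R => e.forall_congr fun {x} => e.forall_congr fun {y} => by
    rw [comap_lt]; rfl)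

section sampling

variable {U : Type*} [MeasurableSpace U] [DiscreteMeasurableSpace U] [Finite U]

/-- The law of the infinite poset sampled with replacement from a finite poset. -/
def sampleLaw (p : PosetOn U) : Measure (PosetOn ℕ) :=
  (Measure.infinitePi fun _ : ℕ => uniformOn (Set.univ : Set U)).map p.comap

theorem measurable_comap_left (p : PosetOn U) : Measurable fun f : ℕ → U => p.comap f :=
  Measurable.subtype_mk <| measurable_pi_lambda _ fun i => measurable_pi_lambda _ fun j =>
    (measurable_of_countable fun q : U × U => p.1 q.1 q.2).comp
      (f := fun f : ℕ → U => (f i, f j)) (by fun_prop)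

theorem uniformOn_univ_real (s : Set U) :
    (uniformOn (Set.univ : Set U)).real s = (Nat.card s : ℝ) / Nat.card U := by
  classical
  cases nonempty_fintype U
  rw [measureReal_def, uniformOn_univ, Measure.count_apply s.toFinite.measurableSet,
    ENNReal.toReal_div, Nat.card_eq_fintype_card (α := U), ENNReal.toReal_natCast,
    ← s.toFinite.cast_ncard_eq, Set.ncard_eq_toFinset_card']
  simp

variable [Nonempty U]

instance : IsProbabilityMeasure (uniformOn (Set.univ : Set U)) :=
  isProbabilityMeasure_uniformOn Set.finite_univ Set.univ_nonempty

instance (p : PosetOn U) : IsProbabilityMeasure (sampleLaw p) :=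
  Measure.isProbabilityMeasure_map (measurable_comap_left p).aemeasurable

theorem sampleLaw_real_restrict (p : PosetOn U) (A : Finset ℕ) {s : Set (PosetOn A)}
    (hs : MeasurableSet {R : PosetOn ℕ | R.comap (fun x : A => (x : ℕ)) ∈ s}) :
    (sampleLaw p).real {R | R.comap (fun x : A => (x : ℕ)) ∈ s} =
      (Nat.card {f : A → U // p.comap f ∈ s} : ℝ) / Nat.card (A → U) := by
  have h := uniformOn_univ_real {f : A → U | p.comap f ∈ s}
  rw [← Set.pi_univ Set.univ, uniformOn_pi,
    ← Measure.infinitePi_map_restrict (μ := fun _ : ℕ => uniformOn (Set.univ : Set U)),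
    map_measureReal_apply (Finset.measurable_restrict A) (Set.toFinite _).measurableSet] at h
  rw [sampleLaw, map_measureReal_apply (measurable_comap_left p) hs]
  exact h

theorem hasDensities_sampleLaw [Fintype U] (p : PosetOn U) :
    HasDensities (sampleLaw p) p.unlabelled.toLimit := fun A _ Q => by
  rw [PosetLimit.t_toLimit, FinPoset.t_unlabelled]
  exact sampleLaw_real_restrict p A (s := {P | ∀ x y, Q.lt x y → P.lt x y})
    (measurableSet_embEvent Q fun x : A => (x : ℕ))

end sampling

theorem continuous_probabilityMeasure_real {X : Type*} [TopologicalSpace X] [CompactSpace X]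
    [MeasurableSpace X] [OpensMeasurableSpace X] {s : Set X} (hs : IsClopen s) :
    Continuous fun ν : ProbabilityMeasure X => (ν : Measure X).real s :=
  (ProbabilityMeasure.continuous_integral_continuousMap
    (⟨s.indicator 1, hs.continuous_indicator continuous_one⟩ : C(X, ℝ))).congr fun _ =>
      integral_indicator_one hs.2.measurableSet

theorem continuous_of_isClosed_graph {X Y : Type*} [TopologicalSpace X] [TopologicalSpace Y]
    [CompactSpace Y] {f : X → Y} (hf : IsClosed {q : X × Y | q.2 = f q.1}) : Continuous f := by
  refine continuous_iff_isClosed.2 fun s hs => ?_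
  convert isClosedMap_fst_of_compactSpace _ (hf.inter (hs.preimage continuous_snd)) using 1
  ext x
  simp

theorem isClosed_hasDensities :
    IsClosed {q : PosetLimit × ProbabilityMeasure (PosetOn ℕ) | HasDensities q.2 q.1} := by
  simp only [HasDensities, Set.ofPred_forall]
  refine isClosed_iInter fun A => isClosed_iInter fun _ => isClosed_iInter fun Q => ?_
  exact isClosed_eq ((continuous_probabilityMeasure_real (isClopen_embEvent Q _)).comp
    continuous_snd) ((PosetLimit.continuous_t _).comp continuous_fst)

theorem exists_hasDensities (Γ : PosetLimit) :
    ∃ ν : ProbabilityMeasure (PosetOn ℕ), HasDensities ν Γ := by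
  have closure_subset : closure (Set.range FinPoset.toLimit) ⊆ Prod.fst ''
      {q : PosetLimit × ProbabilityMeasure (PosetOn ℕ) | HasDensities q.2 q.1} := by
    refine closure_minimal ?_ (isClosedMap_fst_of_compactSpace _ isClosed_hasDensities)
    rintro _ ⟨P, rfl⟩
    obtain ⟨n, p, rfl⟩ := P.exists_rep
    exact ⟨(_, ⟨sampleLaw p, inferInstance⟩), hasDensities_sampleLaw p, rfl⟩
  obtain ⟨⟨_, ν⟩, hν, rfl⟩ := closure_subset (denseRange_toLimit Γ)
  exact ⟨ν, hν⟩

/-- The law of the random infinite poset with the densities of `Γ`, a priori a weak limit of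
laws sampled from finite posets; it is shown to be `P(∞,Γ)` when `Γ` is proper. -/
def limitLaw (Γ : PosetLimit) : ProbabilityMeasure (PosetOn ℕ) := (exists_hasDensities Γ).choose

theorem hasDensities_limitLaw (Γ : PosetLimit) : HasDensities (limitLaw Γ) Γ :=
  (exists_hasDensities Γ).choose_spec

theorem HasDensities.eq_limitLaw {ν : Measure (PosetOn ℕ)} [IsProbabilityMeasure ν]
    {Γ : PosetLimit} (h : HasDensities ν Γ) : ν = limitLaw Γ :=
  measure_ext_of_containsEvent fun A _ Q => by rw [h A Q, hasDensities_limitLaw Γ A Q]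

theorem continuous_limitLaw : Continuous limitLaw := by
  have graph_eq : {q | q.2 = limitLaw q.1} =
      {q : PosetLimit × ProbabilityMeasure (PosetOn ℕ) | HasDensities q.2 q.1} := by
    ext ⟨Γ, ν⟩
    exact ⟨fun (h : ν = limitLaw Γ) => h ▸ hasDensities_limitLaw Γ,
      fun (h : HasDensities ν Γ) => Subtype.ext h.eq_limitLaw⟩
  exact continuous_of_isClosed_graph (graph_eq ▸ isClosed_hasDensities)

theorem measurable_limitLaw :
    Measurable fun Γ : PosetLimit => (limitLaw Γ : Measure (PosetOn ℕ)) := by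
  refine Measurable.measure_of_isPiSystem_of_isProbabilityMeasure generateFrom_pairsEvent
    isPiSystem_pairsEvent ?_
  rintro _ ⟨D, rfl⟩
  rcases pairsEvent_eq_empty_or_embEvent D with hempty | ⟨A, hA, Q, hQ⟩
  · simp [hempty]
  · have apply_eq (Γ : PosetLimit) : (limitLaw Γ : Measure (PosetOn ℕ)) (pairsEvent D) =
        ENNReal.ofReal (PosetLimit.t Q.unlabelled Γ) := by
      rw [← hasDensities_limitLaw Γ A Q, ofReal_measureReal, hQ, containsEvent_eq_embEvent]
    simp only [apply_eq]
    exact ENNReal.measurable_ofReal.comp (PosetLimit.continuous_t _).measurable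

theorem HasDensities.map_comap {ν : Measure (PosetOn ℕ)} [IsProbabilityMeasure ν] {Γ : PosetLimit}
    (h : HasDensities ν Γ) {τ : ℕ → ℕ} (hτ : Function.Injective τ) :
    ν.map (fun R => R.comap τ) = ν := by
  have hm := PosetOn.measurable_comap (U := ℕ) τ
  have := Measure.isProbabilityMeasure_map (μ := ν) hm.aemeasurable
  refine measure_ext_of_containsEvent fun A _ Q => ?_
  rw [h A Q, containsEvent_eq_embEvent, map_measureReal_apply hm (measurableSet_embEvent Q _)]
  exact h.real_embEvent Q (hτ.comp Subtype.val_injective)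

theorem HasDensities.exchangeable {ν : Measure (PosetOn ℕ)} [IsProbabilityMeasure ν]
    {Γ : PosetLimit} (h : HasDensities ν Γ) : Exchangeable ν :=
  fun σ => h.map_comap σ.injective

/-! ### Conditional probabilities and measure-preserving maps -/

section condProb

variable {Ω Y Z : Type*} [MeasurableSpace Ω] [MeasurableSpace Y] [MeasurableSpace Z]
  {P : Measure Ω}

theorem exists_condProb [IsFiniteMeasure P] (A : Set Ω) {z : Ω → Z}
    (hz : Measurable z) :
    ∃ v : Z → ℝ≥0∞, Measurable v ∧ (∀ x, v x ≤ 1) ∧ ∀ h : Z → ℝ≥0∞, Measurable h →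
      ∫⁻ ω in A, h (z ω) ∂P = ∫⁻ ω, v (z ω) * h (z ω) ∂P := by
  let d := ((P.restrict A).map z).rnDeriv (P.map z)
  have hle : (P.restrict A).map z ≤ P.map z := Measure.map_mono Measure.restrict_le_self hz
  have hd : Measurable d := Measure.measurable_rnDeriv _ _
  refine ⟨fun x => min (d x) 1, hd.min measurable_const, fun x => min_le_right _ _,
    fun h hh => ?_⟩
  have hdh : Measurable fun x => min (d x) 1 * h x := (hd.min measurable_const).mul hh
  calc ∫⁻ ω in A, h (z ω) ∂P
      = ∫⁻ x, d x * h x ∂P.map z := by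
        rw [← lintegral_map hh hz,
          ← lintegral_rnDeriv_mul hle.absolutelyContinuous hh.aemeasurable]
    _ = ∫⁻ x, min (d x) 1 * h x ∂P.map z := by
        refine lintegral_congr_ae ?_
        filter_upwards [Measure.rnDeriv_le_one_of_le hle] with x hx
        rw [min_eq_left (show d x ≤ 1 from hx)]
    _ = ∫⁻ ω, min (d (z ω)) 1 * h (z ω) ∂P := lintegral_map hdh hz

theorem lintegral_mul_indicator {A : Set Ω} (hA : MeasurableSet A) (f g : Ω → ℝ≥0∞) :
    ∫⁻ ω, f ω * A.indicator g ω ∂P = ∫⁻ ω in A, f ω * g ω ∂P := by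
  simp only [← lintegral_indicator hA, Set.indicator_mul_right]

theorem tsub_add_tsub_mul_self_add (a b : ℝ≥0∞) :
    (a - b + (b - a)) * (a - b + (b - a)) + 2 * (a * b) = a * a + b * b := by
  wlog hab : a ≤ b generalizing a b
  · rw [add_comm (a - b), mul_comm a, this b a (le_of_not_ge hab), add_comm]
  obtain ⟨c, rfl⟩ := exists_add_of_le hab
  rcases eq_or_ne a ∞ with rfl | ha
  · simp
  · rw [tsub_eq_zero_of_le hab, ENNReal.add_sub_cancel_left ha]
    ring

theorem ae_eq_of_lintegral_mul_eq {a b : Ω → ℝ≥0∞} (ha : Measurable a) (hb : Measurable b)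
    (hab : ∫⁻ ω, a ω * b ω ∂P = ∫⁻ ω, a ω * a ω ∂P)
    (hbb : ∫⁻ ω, b ω * b ω ∂P = ∫⁻ ω, a ω * a ω ∂P) (htop : ∫⁻ ω, a ω * a ω ∂P ≠ ∞) :
    a =ᵐ[P] b := by
  let d : Ω → ℝ≥0∞ := fun ω => a ω - b ω + (b ω - a ω)
  have hd : Measurable d := (ha.sub hb).add (hb.sub ha)
  have integral_sq_add : ∫⁻ ω, d ω * d ω ∂P + 2 * ∫⁻ ω, a ω * a ω ∂P =
      2 * ∫⁻ ω, a ω * a ω ∂P := by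
    calc ∫⁻ ω, d ω * d ω ∂P + 2 * ∫⁻ ω, a ω * a ω ∂P
        = ∫⁻ ω, d ω * d ω + 2 * (a ω * b ω) ∂P := by
          rw [lintegral_add_left (f := fun ω => d ω * d ω) (hd.mul hd),
            lintegral_const_mul _ (f := fun ω => a ω * b ω) (ha.mul hb), hab]
      _ = ∫⁻ ω, a ω * a ω + b ω * b ω ∂P := by simp only [d, tsub_add_tsub_mul_self_add]
      _ = 2 * ∫⁻ ω, a ω * a ω ∂P := by
          rw [lintegral_add_left (f := fun ω => a ω * a ω) (ha.mul ha), hbb, two_mul]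
  have integral_sq : ∫⁻ ω, d ω * d ω ∂P = 0 := by
    have hne : 2 * ∫⁻ ω, a ω * a ω ∂P ≠ ∞ := ENNReal.mul_ne_top ENNReal.ofNat_ne_top htop
    exact (ENNReal.add_left_inj hne).1 (by rw [integral_sq_add, zero_add])
  filter_upwards [(lintegral_eq_zero_iff (hd.mul hd)).1 integral_sq] with ω hω
  have hω : a ω - b ω = 0 ∧ b ω - a ω = 0 := by simpa [d] using hω
  exact le_antisymm (tsub_eq_zero_iff_le.1 hω.1) (tsub_eq_zero_iff_le.1 hω.2)

/-- Let `θ` preserve `P` and the event `A`. If `z ∘ θ` is a function `g` of `y`, which is itself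
a function `φ` of `z`, then the conditional probability of `A` given `z` is a function of `y`:
if `v z` is that probability then `v (g y)` has the same second moment and, by invariance of
`A`, the same inner product with `v z`. -/
theorem exists_condProb_of_measurePreserving [IsProbabilityMeasure P] {θ : Ω → Ω}
    (hθ : MeasurePreserving θ P P) {A : Set Ω} (hA : MeasurableSet A)
    (hθA : θ ⁻¹' A = A) {z : Ω → Z} (hz : Measurable z) {y : Ω → Y}
    {φ : Z → Y} (hφ : Measurable φ) (hyz : ∀ ω, φ (z ω) = y ω)
    {g : Y → Z} (hg : Measurable g) (hzθ : ∀ ω, z (θ ω) = g (y ω)) :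
    ∃ w : Y → ℝ≥0∞, Measurable w ∧ (∀ y, w y ≤ 1) ∧ ∀ h : Z → ℝ≥0∞, Measurable h →
      ∫⁻ ω in A, h (z ω) ∂P = ∫⁻ ω, w (y ω) * h (z ω) ∂P := by
  obtain ⟨v, hv, hv1, hvA⟩ := exists_condProb (P := P) A hz
  have hy : Measurable y := funext hyz ▸ hφ.comp hz
  have inner_eq : ∫⁻ ω, v (z ω) * v (g (y ω)) ∂P = ∫⁻ ω, v (z ω) * v (z ω) ∂P := by
    calc ∫⁻ ω, v (z ω) * v (g (y ω)) ∂P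
        = ∫⁻ ω in A, v (g (y ω)) ∂P := by
          simpa only [Function.comp_apply, hyz] using (hvA _ (hv.comp (hg.comp hφ))).symm
      _ = ∫⁻ ω in θ ⁻¹' A, v (z (θ ω)) ∂P := by simp only [hθA, hzθ]
      _ = ∫⁻ ω in A, v (z ω) ∂P := hθ.setLIntegral_comp_preimage hA (hv.comp hz)
      _ = ∫⁻ ω, v (z ω) * v (z ω) ∂P := hvA v hv
  have norm_eq : ∫⁻ ω, v (g (y ω)) * v (g (y ω)) ∂P = ∫⁻ ω, v (z ω) * v (z ω) ∂P := by
    simpa only [hzθ] using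
      hθ.lintegral_comp (f := fun ω => v (z ω) * v (z ω)) ((hv.comp hz).mul (hv.comp hz))
  have norm_ne_top : ∫⁻ ω, v (z ω) * v (z ω) ∂P ≠ ∞ :=
    ((lintegral_mono fun ω => mul_le_one' (hv1 (z ω)) (hv1 (z ω))).trans_lt (by simp)).ne
  refine ⟨fun x => v (g x), hv.comp hg, fun x => hv1 _, fun h hh => ?_⟩
  rw [hvA h hh]
  refine lintegral_congr_ae ?_
  filter_upwards [ae_eq_of_lintegral_mul_eq (hv.comp hz) (hv.comp (hg.comp hy)) inner_eq norm_eq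
    norm_ne_top] with ω hω
  exact congrArg (· * h (z ω)) hω

end condProb

/-! ### Exchangeable arrays -/

/-- Zero-one arrays indexed by two copies of `ℕ`; the first copy is used as a reference set. -/
abbrev BoolArray : Type := ℕ ⊕ ℕ → ℕ ⊕ ℕ → Bool

namespace BoolArray

/-- The arrays of entries between reference points. -/
abbrev Base : Type := ℕ → ℕ → Bool

/-- The type of a point: its entries with each reference point, in both directions. -/
abbrev PointType : Type := ℕ → Bool × Bool

/-- The array pulled back along a map of the index set. -/
def reindex (τ : ℕ ⊕ ℕ → ℕ ⊕ ℕ) (R : BoolArray) : BoolArray := fun a b => R (τ a) (τ b)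

/-- Joint exchangeability of a random array, for all injections of the index set. -/
def IsExchangeable (P : Measure BoolArray) : Prop :=
  ∀ τ, Function.Injective τ → MeasurePreserving (reindex τ) P P

/-- The array with its non-reference points relabelled. -/
def permute (s : Equiv.Perm ℕ) : BoolArray → BoolArray := reindex (Sum.map id s)

/-- The entries between reference points. -/
def base (R : BoolArray) : Base := fun k l => R (.inl k) (.inl l)

/-- The type of the point `i`. -/
def type (i : ℕ) (R : BoolArray) : PointType :=
  fun k => (R (.inl k) (.inr i), R (.inr i) (.inl k))

/-- The array with given base and types, in which all entries between non-reference points are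
zero. -/
def ofTypes (y : Base) (x : ℕ → PointType) : BoolArray
  | .inl k, .inl l => y k l
  | .inl k, .inr i => (x i k).1
  | .inr i, .inl k => (x i k).2
  | .inr _, .inr _ => false

/-- Delete the entries between points of `I`. -/
def erasePairs (I : Finset ℕ) (R : BoolArray) : BoolArray
  | .inr i, .inr j => if i ∈ I ∧ j ∈ I then false else R (.inr i) (.inr j)
  | a, b => R a b

/-- Delete all entries that involve the point `i`. -/
def erasePoint (i : ℕ) (R : BoolArray) : BoolArray := fun a b =>
  if a = .inr i ∨ b = .inr i then false else R a b

/-- The event that the entry at `(i, j)` is one. -/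
def entryEvent (i j : ℕ) : Set BoolArray := {R | R (.inr i) (.inr j) = true}

/-- The event that all pairs of `D` have entry one. -/
def pairsOne {n : ℕ} (D : Finset (Fin n × Fin n)) : Set BoolArray :=
  {R | ∀ p ∈ D, R (.inr p.1) (.inr p.2) = true}

theorem measurable_of_entries {Ω : Type*} [MeasurableSpace Ω] {f : Ω → BoolArray}
    (h : ∀ a b, Measurable fun ω => f ω a b) : Measurable f :=
  measurable_pi_lambda _ fun a => measurable_pi_lambda _ fun b => h a b

@[fun_prop]
theorem measurable_reindex (τ : ℕ ⊕ ℕ → ℕ ⊕ ℕ) : Measurable (reindex τ) := by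
  unfold reindex
  fun_prop

@[fun_prop]
theorem measurable_permute (s : Equiv.Perm ℕ) : Measurable (permute s) :=
  measurable_reindex _

@[fun_prop]
theorem measurable_base : Measurable base := by
  unfold base
  fun_prop

@[fun_prop]
theorem measurable_type (i : ℕ) : Measurable (type i) := by
  unfold type
  fun_prop

theorem measurable_ofTypes {Ω : Type*} [MeasurableSpace Ω] {y : Ω → Base} {x : ℕ → Ω → PointType}
    (hy : Measurable y) (hx : ∀ i, Measurable (x i)) :
    Measurable fun ω => ofTypes (y ω) fun i => x i ω := by
  refine measurable_of_entries ?_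
  rintro (k | i) (l | j) <;> simp only [ofTypes] <;> fun_prop

@[fun_prop]
theorem measurable_erasePairs (I : Finset ℕ) : Measurable (erasePairs I) := by
  refine measurable_of_entries ?_
  rintro (k | i) (l | j) <;> simp only [erasePairs]
  case inr.inr => split_ifs <;> fun_prop
  all_goals fun_prop

@[fun_prop]
theorem measurable_erasePoint (i : ℕ) : Measurable (erasePoint i) := by
  refine measurable_of_entries fun a b => ?_
  simp only [erasePoint]
  split_ifs <;> fun_prop

theorem measurableSet_entryEvent (i j : ℕ) : MeasurableSet (entryEvent i j) :=
  measurableSet_eq_fun (by fun_prop) measurable_const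

theorem pairsOne_insert {n : ℕ} (p : Fin n × Fin n) (D : Finset (Fin n × Fin n)) :
    pairsOne (insert p D) = pairsOne D ∩ entryEvent p.1 p.2 := by
  ext R
  simp [pairsOne, entryEvent, and_comm]

theorem measurableSet_pairsOne {n : ℕ} (D : Finset (Fin n × Fin n)) :
    MeasurableSet (pairsOne D) := by
  induction D using Finset.induction_on with
  | empty => simp [pairsOne]
  | insert p D _ ih =>
    rw [pairsOne_insert]
    exact ih.inter (measurableSet_entryEvent _ _)

theorem base_erasePoint (i : ℕ) (R : BoolArray) : base (erasePoint i R) = base R := by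
  ext k l
  simp [base, erasePoint]

theorem type_erasePoint {i j : ℕ} (h : j ≠ i) (R : BoolArray) :
    type j (erasePoint i R) = type j R := by
  ext k <;> simp [type, erasePoint, h]

theorem permute_erasePairs (s : Equiv.Perm ℕ) (I : Finset ℕ) (R : BoolArray) :
    permute s (erasePairs (I.map s.toEmbedding) R) = erasePairs I (permute s R) := by
  ext a b
  rcases a with a | a <;> rcases b with b | b <;> simp [permute, reindex, erasePairs]

theorem permute_inv_permute (s : Equiv.Perm ℕ) (R : BoolArray) :
    permute s⁻¹ (permute s R) = R := by
  ext a b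
  rcases a with a | a <;> rcases b with b | b <;> simp [permute, reindex]

theorem IsExchangeable.permute {P : Measure BoolArray} (hP : IsExchangeable P)
    (s : Equiv.Perm ℕ) : MeasurePreserving (permute s) P P :=
  hP _ (Sum.map_injective.2 ⟨Function.injective_id, s.injective⟩)

/-- Move the points outside `I` into the reference set, without moving the first `N` reference
points. -/
def intoBase (N : ℕ) (I : Finset ℕ) : ℕ ⊕ ℕ → ℕ ⊕ ℕ
  | .inl k => if k < N then .inl k else .inl (N + 2 * k)
  | .inr j => if j ∈ I then .inr j else .inl (N + (2 * j + 1))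

theorem intoBase_injective (N : ℕ) (I : Finset ℕ) : Function.Injective (intoBase N I) := by
  rintro (k | k) (l | l) h <;> simp only [intoBase] at h <;> split_ifs at h <;>
    simp only [Sum.inl.injEq, Sum.inr.injEq, reduceCtorEq] at h ⊢ <;> omega

/-- `w`, evaluated at the base and at the types of `i` and `j`, is the conditional probability
that the entry at `(i, j)` is one, given all entries other than those at `(i, j)` and `(j, i)`. -/
def IsEntryProb (P : Measure BoolArray) (w : Base × PointType × PointType → ℝ≥0∞) (i j : ℕ) :
    Prop :=
  ∀ h : BoolArray → ℝ≥0∞, Measurable h → (∀ R, h (erasePairs {i, j} R) = h R) →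
    ∫⁻ R in entryEvent i j, h R ∂P = ∫⁻ R, w (base R, type i R, type j R) * h R ∂P

section pairProb

variable {P : Measure BoolArray}

theorem IsExchangeable.isEntryProb_permute (hP : IsExchangeable P) (s : Equiv.Perm ℕ)
    {w : Base × PointType × PointType → ℝ≥0∞} (hw : Measurable w) {i j : ℕ}
    (hwij : IsEntryProb P w i j) : IsEntryProb P w (s i) (s j) := by
  intro h hm hi
  let h' : BoolArray → ℝ≥0∞ := fun R => h (BoolArray.permute s⁻¹ R)
  have hm' : Measurable h' := by fun_prop
  have hi' (R : BoolArray) : h' (erasePairs {i, j} R) = h' R := by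
    have key := permute_erasePairs s⁻¹ {s i, s j} R
    have hmap : Finset.map (s⁻¹).toEmbedding {s i, s j} = {i, j} := by simp
    rw [hmap] at key
    simp only [h', key, hi]
  have hh' (R : BoolArray) : h' (BoolArray.permute s R) = h R := by
    simp only [h', permute_inv_permute]
  calc ∫⁻ R in entryEvent (s i) (s j), h R ∂P
      = ∫⁻ R in BoolArray.permute s ⁻¹' entryEvent i j, h' (BoolArray.permute s R) ∂P := by
        simp only [hh']
        rfl
    _ = ∫⁻ R in entryEvent i j, h' R ∂P :=
        (hP.permute s).setLIntegral_comp_preimage (measurableSet_entryEvent i j) hm'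
    _ = ∫⁻ R, w (base R, type i R, type j R) * h' R ∂P := hwij h' hm' hi'
    _ = ∫⁻ R, w (base R, type (s i) R, type (s j) R) * h' (BoolArray.permute s R) ∂P :=
        ((hP.permute s).lintegral_comp (f := fun R => w (base R, type i R, type j R) * h' R)
          (by fun_prop)).symm
    _ = ∫⁻ R, w (base R, type (s i) R, type (s j) R) * h R ∂P := by simp only [hh']

variable [IsProbabilityMeasure P]

theorem IsExchangeable.exists_isEntryProb_zero_one (hP : IsExchangeable P) :
    ∃ w, Measurable w ∧ (∀ y, w y ≤ 1) ∧ IsEntryProb P w 0 1 := by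
  let z : Base × PointType × PointType → BoolArray := fun y =>
    ofTypes y.1 fun j => if j = 0 then y.2.1 else y.2.2
  have hz : Measurable z :=
    measurable_ofTypes measurable_fst fun j => by split_ifs <;> fun_prop
  obtain ⟨w, hw, hw1, h⟩ := exists_condProb_of_measurePreserving
    (hP (intoBase 0 {0, 1}) (intoBase_injective _ _))
    (measurableSet_entryEvent 0 1) (by ext R; simp [reindex, intoBase, entryEvent])
    (measurable_erasePairs {0, 1}) (y := fun R => (base R, type 0 R, type 1 R))
    (φ := fun R => (base R, type 0 R, type 1 R)) (by fun_prop) (fun R => rfl)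
    (g := fun y => erasePairs {0, 1} (reindex (intoBase 0 {0, 1}) (z y))) (by fun_prop) (by
      intro R
      ext a b
      rcases a with a | a <;> rcases b with b | b <;>
        simp only [erasePairs, reindex, intoBase, z, ofTypes, base, Finset.mem_insert,
          Finset.mem_singleton, not_lt_zero, if_false] <;> grind [type])
  exact ⟨w, hw, hw1, fun k hk hk1 => by simpa only [hk1] using h k hk⟩

theorem IsExchangeable.exists_isEntryProb (hP : IsExchangeable P) :
    ∃ w, Measurable w ∧ (∀ y, w y ≤ 1) ∧ ∀ i j, i ≠ j → IsEntryProb P w i j := by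
  obtain ⟨w, hw, hw1, hw01⟩ := hP.exists_isEntryProb_zero_one
  refine ⟨w, hw, hw1, fun i j hij => ?_⟩
  obtain ⟨s, rfl, rfl⟩ : ∃ s : Equiv.Perm ℕ, s 0 = i ∧ s 1 = j :=
    MulAction.is_two_pretransitive_iff.1 (Equiv.Perm.isMultiplyPretransitive ℕ 2) zero_ne_one hij
  exact hP.isEntryProb_permute s hw hw01

end pairProb

section types

variable {P : Measure BoolArray} [IsProbabilityMeasure P]

/-- The conditional law of the type of a point given the base. -/
def typeKernel (P : Measure BoolArray) [IsFiniteMeasure P] : Kernel Base PointType :=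
  condDistrib (type 0) base P

instance : IsMarkovKernel (typeKernel P) := by
  unfold typeKernel
  infer_instance

theorem IsExchangeable.setLIntegral_typeKernel (hP : IsExchangeable P) (i : ℕ)
    {B : Set PointType} (hB : MeasurableSet B) {C : Set Base} (hC : MeasurableSet C) :
    ∫⁻ R in base ⁻¹' C, typeKernel P (base R) B ∂P = P (base ⁻¹' C ∩ type i ⁻¹' B) := by
  have hCB : MeasurableSet (base ⁻¹' C ∩ type 0 ⁻¹' B) :=
    (measurable_base hC).inter (measurable_type 0 hB)
  rw [typeKernel, setLIntegral_condDistrib_of_measurableSet measurable_base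
    (measurable_type 0).aemeasurable hB ⟨C, hC, rfl⟩,
    ← (hP.permute (Equiv.swap 0 i)).measure_preimage hCB.nullMeasurableSet]
  congr 1

theorem IsExchangeable.exists_condProb_type (hP : IsExchangeable P) (i N : ℕ) {B : Set PointType}
    (hB : MeasurableSet B)
    (hBN : ∀ x x' : PointType, (∀ k < N, x k = x' k) → (x ∈ B ↔ x' ∈ B)) :
    ∃ w : Base → ℝ≥0∞, Measurable w ∧ ∀ h : BoolArray → ℝ≥0∞, Measurable h →
      (∀ R, h (erasePoint i R) = h R) →
      ∫⁻ R in type i ⁻¹' B, h R ∂P = ∫⁻ R, w (base R) * h R ∂P := by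
  let z : Base → BoolArray := fun y => ofTypes y fun _ _ => (false, false)
  have hz : Measurable z := measurable_ofTypes measurable_id fun _ => measurable_const
  have hBθ : reindex (intoBase N {i}) ⁻¹' (type i ⁻¹' B) = type i ⁻¹' B := by
    ext R
    exact hBN _ _ fun k hk => by simp [type, reindex, intoBase, hk]
  obtain ⟨w, hw, -, h⟩ := exists_condProb_of_measurePreserving
    (hP (intoBase N {i}) (intoBase_injective _ _)) (measurable_type i hB) hBθ
    (measurable_erasePoint i) measurable_base (base_erasePoint i)
    (g := fun y => erasePoint i (reindex (intoBase N {i}) (z y))) (by fun_prop) (by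
      intro R
      ext a b
      rcases a with a | a <;> rcases b with b | b <;>
        simp only [erasePoint, reindex, intoBase, z, ofTypes, base, Finset.mem_singleton,
          reduceCtorEq, Sum.inr.injEq, false_or, or_false, if_false] <;>
        split_ifs <;> simp_all)
  exact ⟨w, hw, fun k hk hk1 => by simpa only [hk1] using h k hk⟩

theorem IsExchangeable.setLIntegral_type_cylinder (hP : IsExchangeable P) (i N : ℕ)
    {B : Set PointType} (hB : MeasurableSet B)
    (hBN : ∀ x x' : PointType, (∀ k < N, x k = x' k) → (x ∈ B ↔ x' ∈ B))
    {h : BoolArray → ℝ≥0∞} (hm : Measurable h) (hi : ∀ R, h (erasePoint i R) = h R) :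
    ∫⁻ R in type i ⁻¹' B, h R ∂P = ∫⁻ R, typeKernel P (base R) B * h R ∂P := by
  obtain ⟨w, hw, hwB⟩ := hP.exists_condProb_type i N hB hBN
  have hκ : Measurable fun y => typeKernel P y B := Kernel.measurable_coe _ hB
  have w_ae_eq : w =ᵐ[P.map base] fun y => typeKernel P y B := by
    refine ae_eq_of_forall_setLIntegral_eq_of_sigmaFinite hw hκ fun C hC _ => ?_
    have hind : Measurable ((base ⁻¹' C).indicator (1 : BoolArray → ℝ≥0∞)) :=
      measurable_one.indicator (measurable_base hC)
    rw [setLIntegral_map hC hw measurable_base, setLIntegral_map hC hκ measurable_base,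
      hP.setLIntegral_typeKernel i hB hC, ← Measure.restrict_apply (measurable_base hC),
      ← lintegral_indicator_one (measurable_base hC), hwB _ hind fun R =>
        Set.indicator_eq_indicator (by rw [Set.mem_preimage, base_erasePoint]; rfl) rfl,
      lintegral_mul_indicator (measurable_base hC)]
    simp only [Pi.one_apply, mul_one]
  rw [hwB h hm hi]
  refine lintegral_congr_ae ?_
  filter_upwards [ae_of_ae_map measurable_base.aemeasurable w_ae_eq] with R hR
  rw [hR]

/-- The type of the point `i` is independent of all entries that do not involve `i`, given the
reference entries. -/
theorem IsExchangeable.setLIntegral_type (hP : IsExchangeable P) (i : ℕ) {B : Set PointType}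
    (hB : MeasurableSet B) {h : BoolArray → ℝ≥0∞} (hm : Measurable h) (hh1 : ∀ R, h R ≤ 1)
    (hi : ∀ R, h (erasePoint i R) = h R) :
    ∫⁻ R in type i ⁻¹' B, h R ∂P = ∫⁻ R, typeKernel P (base R) B * h R ∂P := by
  have hκ : Measurable fun R => typeKernel P (base R) := by fun_prop
  have hfin : IsFiniteMeasure (P.withDensity h) := isFiniteMeasure_withDensity
    ((lintegral_mono hh1).trans_lt (by simp)).ne
  have map_apply (B) (hB : MeasurableSet B) :
      (P.withDensity h).map (type i) B = ∫⁻ R in type i ⁻¹' B, h R ∂P := by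
    rw [Measure.map_apply (measurable_type i) hB, withDensity_apply _ (measurable_type i hB)]
  have bind_apply (B) (hB : MeasurableSet B) :
      (P.withDensity h).bind (fun R => typeKernel P (base R)) B =
        ∫⁻ R, typeKernel P (base R) B * h R ∂P := by
    rw [Measure.bind_apply hB hκ.aemeasurable, lintegral_withDensity_eq_lintegral_mul _ hm
      (g := fun R => typeKernel P (base R) B) ((Measure.measurable_coe hB).comp hκ)]
    simp only [Pi.mul_apply, mul_comm]
  rw [← map_apply B hB, ← bind_apply B hB]
  congr 1
  refine ext_of_generate_finite _ (generateFrom_measurableCylinders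
    (α := fun _ : ℕ => Bool × Bool)).symm isPiSystem_measurableCylinders (fun C hC => ?_) ?_
  · have hCm : MeasurableSet C := MeasurableSet.of_mem_measurableCylinders hC
    obtain ⟨s, S, -, rfl⟩ := (mem_measurableCylinders _).1 hC
    rw [map_apply _ hCm, bind_apply _ hCm]
    refine hP.setLIntegral_type_cylinder i (s.sup id + 1) hCm (fun x x' hx => ?_) hm hi
    have : s.restrict x = s.restrict x' :=
      funext fun k => hx k (Nat.lt_succ_of_le (Finset.le_sup (f := id) k.2))
    rw [mem_cylinder, mem_cylinder, this]
  · simp [map_apply _ MeasurableSet.univ, bind_apply _ MeasurableSet.univ]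

theorem IsExchangeable.setLIntegral_types (hP : IsExchangeable P) {n : ℕ} (s : Finset (Fin n))
    {B : Fin n → Set PointType} (hB : ∀ i, MeasurableSet (B i)) {h : Base → ℝ≥0∞}
    (hm : Measurable h) (hh1 : ∀ y, h y ≤ 1) :
    ∫⁻ R in ⋂ i ∈ s, type i ⁻¹' B i, h (base R) ∂P =
      ∫⁻ R, (∏ i ∈ s, typeKernel P (base R) (B i)) * h (base R) ∂P := by
  induction s using Finset.induction_on generalizing h with
  | empty => simp
  | insert i s hi ih =>
    have hκ : Measurable fun y => typeKernel P y (B i) := Kernel.measurable_coe _ (hB i)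
    let A : Set BoolArray := ⋂ j ∈ s, type j ⁻¹' B j
    have hA : MeasurableSet A :=
      Finset.measurableSet_biInter _ fun j _ => measurable_type j (hB j)
    have mem_A (R : BoolArray) : erasePoint i R ∈ A ↔ R ∈ A := by
      simp only [A, Set.mem_iInter, Set.mem_preimage]
      refine forall₂_congr fun j hj => ?_
      rw [type_erasePoint (Fin.val_ne_of_ne (ne_of_mem_of_not_mem hj hi))]
    calc ∫⁻ R in ⋂ j ∈ insert i s, type j ⁻¹' B j, h (base R) ∂P
        = ∫⁻ R in type i ⁻¹' B i, A.indicator (fun R => h (base R)) R ∂P := by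
          rw [setLIntegral_indicator hA, Finset.set_biInter_insert, Set.inter_comm]
      _ = ∫⁻ R, typeKernel P (base R) (B i) * A.indicator (fun R => h (base R)) R ∂P := by
          refine hP.setLIntegral_type i (hB i) ((hm.comp measurable_base).indicator hA)
            (fun R => (Set.indicator_le_self _ _ R).trans (hh1 _)) fun R =>
              Set.indicator_eq_indicator (mem_A R) (by rw [base_erasePoint])
      _ = ∫⁻ R in A, typeKernel P (base R) (B i) * h (base R) ∂P :=
          lintegral_mul_indicator hA _ _
      _ = ∫⁻ R, (∏ j ∈ insert i s, typeKernel P (base R) (B j)) * h (base R) ∂P := by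
          rw [ih (h := fun y => typeKernel P y (B i) * h y) (hκ.mul hm)
            fun y => mul_le_one' prob_le_one (hh1 y)]
          refine lintegral_congr fun R => ?_
          rw [Finset.prod_insert hi]
          ring

/-- The law of `n` independent types with the conditional law of one type. -/
def typesKernel (P : Measure BoolArray) [IsProbabilityMeasure P] (n : ℕ) :
    Kernel Base (Fin n → PointType) where
  toFun y := Measure.pi fun _ => typeKernel P y
  measurable' := by
    refine Measurable.measure_of_isPiSystem_of_isProbabilityMeasure generateFrom_pi.symm
      isPiSystem_pi ?_
    rintro _ ⟨B, hB, rfl⟩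
    simp only [Measure.pi_pi]
    exact Finset.measurable_prod _ fun i _ => Kernel.measurable_coe _ (hB i (Set.mem_univ i))

theorem typesKernel_apply (n : ℕ) (y : Base) :
    typesKernel P n y = Measure.pi fun _ => typeKernel P y := rfl

instance (n : ℕ) : IsMarkovKernel (typesKernel P n) :=
  ⟨fun y => by rw [typesKernel_apply]; infer_instance⟩

instance : IsProbabilityMeasure (P.map base) :=
  Measure.isProbabilityMeasure_map measurable_base.aemeasurable

/-- The types are conditionally i.i.d. given the reference entries. -/
theorem IsExchangeable.map_types (hP : IsExchangeable P) (n : ℕ) :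
    P.map (fun R => (base R, fun i : Fin n => type i R)) =
      (P.map base).compProd (typesKernel P n) := by
  have hX : Measurable fun R => (base R, fun i : Fin n => type i R) := by fun_prop
  have : IsProbabilityMeasure (P.map fun R => (base R, fun i : Fin n => type i R)) :=
    Measure.isProbabilityMeasure_map hX.aemeasurable
  refine ext_of_generate_finite _ (generateFrom_eq_prod MeasurableSpace.generateFrom_measurableSet
    generateFrom_pi isCountablySpanning_measurableSet
    (IsCountablySpanning.pi fun _ => isCountablySpanning_measurableSet)).symm
    (MeasurableSpace.isPiSystem_measurableSet.prod isPiSystem_pi) ?_ (by simp)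
  rintro _ ⟨C, hC, _, ⟨B, hB, rfl⟩, rfl⟩
  have hC : MeasurableSet C := hC
  have hB (i) : MeasurableSet (B i) := hB i (Set.mem_univ i)
  have hpi : MeasurableSet (Set.univ.pi B) := MeasurableSet.univ_pi hB
  calc P.map (fun R => (base R, fun i : Fin n => type i R)) (C ×ˢ Set.univ.pi B)
      = P (base ⁻¹' C ∩ ⋂ i ∈ (Finset.univ : Finset (Fin n)), type i ⁻¹' B i) := by
        rw [Measure.map_apply hX (hC.prod hpi)]
        congr 1
        ext R
        simp
    _ = ∫⁻ R in ⋂ i ∈ (Finset.univ : Finset (Fin n)), type i ⁻¹' B i,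
          (base ⁻¹' C).indicator 1 R ∂P := by
        rw [← Measure.restrict_apply (measurable_base hC),
          lintegral_indicator_one (measurable_base hC)]
    _ = ∫⁻ R, (∏ i, typeKernel P (base R) (B i)) * (base ⁻¹' C).indicator 1 R ∂P :=
        hP.setLIntegral_types Finset.univ hB (measurable_one.indicator hC)
          fun y => Set.indicator_le_self _ _ y
    _ = ∫⁻ R in base ⁻¹' C, typesKernel P n (base R) (Set.univ.pi B) ∂P := by
        rw [lintegral_mul_indicator (measurable_base hC)]
        simp only [Pi.one_apply, mul_one, typesKernel_apply, Measure.pi_pi]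
    _ = (P.map base).compProd (typesKernel P n) (C ×ˢ Set.univ.pi B) := by
        rw [Measure.compProd_apply_prod hC hpi,
          setLIntegral_map hC (Kernel.measurable_coe _ hpi) measurable_base]

end types

/-- A set of pairs that contains no loop and no pair in both directions. -/
def IsOriented {V : Type*} (D : Finset (V × V)) : Prop :=
  ∀ p ∈ D, p.1 ≠ p.2 ∧ p.swap ∉ D

theorem IsOriented.mono {V : Type*} {D D' : Finset (V × V)} (h : IsOriented D) (hD : D' ⊆ D) :
    IsOriented D' := fun p hp => ⟨(h p (hD hp)).1, fun hs => (h p (hD hp)).2 (hD hs)⟩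

theorem erasePairs_mem_pairsOne {n : ℕ} {p : Fin n × Fin n} {D : Finset (Fin n × Fin n)}
    (hD : IsOriented (insert p D)) (hp : p ∉ D) (R : BoolArray) :
    erasePairs {p.1.val, p.2.val} R ∈ pairsOne D ↔ R ∈ pairsOne D := by
  refine forall₂_congr fun q hq => ?_
  have hq1 : q.1 ≠ q.2 := (hD q (Finset.mem_insert_of_mem hq)).1
  have hqp : q ≠ p := ne_of_mem_of_not_mem hq hp
  have hqs : q ≠ p.swap := fun h =>
    (hD p (Finset.mem_insert_self p D)).2 (Finset.mem_insert_of_mem (h ▸ hq))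
  simp only [erasePairs, Finset.mem_insert, Finset.mem_singleton]
  rw [if_neg]
  simp only [ne_eq, Prod.ext_iff, Prod.fst_swap, Prod.snd_swap, Fin.ext_iff] at hq1 hqp hqs
  omega

section kernel

variable {P : Measure BoolArray}

theorem setLIntegral_pairsOne {w : Base × PointType × PointType → ℝ≥0∞} (hw : Measurable w)
    (hwP : ∀ i j, i ≠ j → IsEntryProb P w i j) {n : ℕ} {D : Finset (Fin n × Fin n)}
    (hD : IsOriented D) {h : BoolArray → ℝ≥0∞} (hm : Measurable h)
    (hh : ∀ I R, h (erasePairs I R) = h R) :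
    ∫⁻ R in pairsOne D, h R ∂P =
      ∫⁻ R, (∏ p ∈ D, w (base R, type p.1 R, type p.2 R)) * h R ∂P := by
  induction D using Finset.induction_on generalizing h with
  | empty => simp [pairsOne]
  | insert p D hp ih =>
    have hD' : IsOriented D := hD.mono (Finset.subset_insert p D)
    have hmem := erasePairs_mem_pairsOne hD hp
    calc ∫⁻ R in pairsOne (insert p D), h R ∂P
        = ∫⁻ R in entryEvent p.1 p.2, (pairsOne D).indicator h R ∂P := by
          rw [setLIntegral_indicator (measurableSet_pairsOne D), pairsOne_insert]
      _ = ∫⁻ R, w (base R, type p.1 R, type p.2 R) * (pairsOne D).indicator h R ∂P := by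
          refine hwP p.1 p.2 (Fin.val_ne_of_ne (hD p (Finset.mem_insert_self p D)).1) _
            (hm.indicator (measurableSet_pairsOne D)) fun R =>
              Set.indicator_eq_indicator (hmem R) (hh _ R)
      _ = ∫⁻ R in pairsOne D, w (base R, type p.1 R, type p.2 R) * h R ∂P :=
          lintegral_mul_indicator (measurableSet_pairsOne D) _ _
      _ = ∫⁻ R, (∏ q ∈ insert p D, w (base R, type q.1 R, type q.2 R)) * h R ∂P := by
          rw [ih hD' (h := fun R => w (base R, type p.1 R, type p.2 R) * h R) (by fun_prop)
            fun I R => congrArg (w (base R, type p.1 R, type p.2 R) * ·) (hh I R)]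
          refine lintegral_congr fun R => ?_
          rw [Finset.prod_insert hp]
          ring

theorem measurable_prod_entryProb {w : Base × PointType × PointType → ℝ≥0∞} (hw : Measurable w)
    {n : ℕ} (D : Finset (Fin n × Fin n)) :
    Measurable fun q : Base × (Fin n → PointType) => ∏ p ∈ D, w (q.1, q.2 p.1, q.2 p.2) := by
  fun_prop

variable [IsProbabilityMeasure P]

theorem IsExchangeable.exists_measure_base_inter_pairsOne (hP : IsExchangeable P) :
    ∃ w : Base × PointType × PointType → ℝ≥0∞, Measurable w ∧ (∀ y, w y ≤ 1) ∧
      ∀ (n : ℕ) (D : Finset (Fin n × Fin n)), IsOriented D → ∀ C, MeasurableSet C →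
        P (base ⁻¹' C ∩ pairsOne D) =
          ∫⁻ y in C, ∫⁻ x, ∏ p ∈ D, w (y, x p.1, x p.2) ∂(Measure.pi fun _ => typeKernel P y)
            ∂(P.map base) := by
  obtain ⟨w, hw, hw1, hwP⟩ := hP.exists_isEntryProb
  refine ⟨w, hw, hw1, fun n D hD C hC => ?_⟩
  have hF := measurable_prod_entryProb hw D
  calc P (base ⁻¹' C ∩ pairsOne D)
      = ∫⁻ R in pairsOne D, (base ⁻¹' C).indicator 1 R ∂P := by
        rw [lintegral_indicator_one (measurable_base hC),
          Measure.restrict_apply (measurable_base hC)]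
    _ = ∫⁻ R, (∏ p ∈ D, w (base R, type p.1 R, type p.2 R)) * (base ⁻¹' C).indicator 1 R ∂P :=
        setLIntegral_pairsOne hw hwP hD (measurable_one.indicator (measurable_base hC))
          fun I R => rfl
    _ = ∫⁻ R in (fun R => (base R, fun i : Fin n => type i R)) ⁻¹' (C ×ˢ Set.univ),
          ∏ p ∈ D, w (base R, type p.1 R, type p.2 R) ∂P := by
        rw [Set.mk_preimage_prod, Set.preimage_univ, Set.inter_univ,
          lintegral_mul_indicator (measurable_base hC)]
        simp only [Pi.one_apply, mul_one]
    _ = ∫⁻ q in C ×ˢ Set.univ, ∏ p ∈ D, w (q.1, q.2 p.1, q.2 p.2)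
          ∂(P.map base).compProd (typesKernel P n) := by
        rw [← hP.map_types, setLIntegral_map (hC.prod MeasurableSet.univ) hF (by fun_prop)]
    _ = _ := by
        simp_rw [Measure.setLIntegral_compProd hF hC MeasurableSet.univ, Measure.restrict_univ]
        rfl

/-- Dissociation makes the base independent of the entries, so that the base can be fixed. -/
theorem IsExchangeable.exists_kernel (hP : IsExchangeable P)
    (hdis : ∀ (n : ℕ) (D : Finset (Fin n × Fin n)) (C : Set Base), MeasurableSet C →
      P (base ⁻¹' C ∩ pairsOne D) = P (base ⁻¹' C) * P (pairsOne D)) :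
    ∃ (μ : Measure PointType) (_ : IsProbabilityMeasure μ) (w : PointType × PointType → ℝ≥0∞),
      Measurable w ∧ (∀ y, w y ≤ 1) ∧
      ∀ (n : ℕ) (D : Finset (Fin n × Fin n)), IsOriented D →
        ∫⁻ x, ∏ p ∈ D, w (x p.1, x p.2) ∂(Measure.pi fun _ => μ) = P (pairsOne D) := by
  obtain ⟨w, hw, hw1, hwP⟩ := hP.exists_measure_base_inter_pairsOne
  have ae_integral_eq : ∀ᵐ y ∂(P.map base), ∀ (n : ℕ) (D : Finset (Fin n × Fin n)),
      IsOriented D → ∫⁻ x, ∏ p ∈ D, w (y, x p.1, x p.2) ∂(Measure.pi fun _ => typeKernel P y) =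
        P (pairsOne D) := by
    simp only [ae_all_iff]
    intro n D hD
    have hF : Measurable fun y => ∫⁻ x, ∏ p ∈ D, w (y, x p.1, x p.2)
        ∂(Measure.pi fun _ => typeKernel P y) :=
      Measurable.lintegral_kernel_prod_right' (κ := typesKernel P n)
        (measurable_prod_entryProb hw D)
    refine ae_eq_of_forall_setLIntegral_eq_of_sigmaFinite hF measurable_const fun C hC _ => ?_
    rw [← hwP n D hD C hC, hdis n D C hC, setLIntegral_const,
      Measure.map_apply measurable_base hC, mul_comm]
  obtain ⟨y, hy⟩ := ae_integral_eq.exists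
  exact ⟨typeKernel P y, inferInstance, fun q => w (y, q.1, q.2), by fun_prop, fun q => hw1 _, hy⟩

end kernel

end BoolArray

/-! ### Density points and exact versions of almost everywhere poset kernels -/

section DensityPoints

variable {X : Type*} [MetricSpace X] [MeasurableSpace X]

/-- The relative measure of `A` in the closed ball of radius `1 / (n + 1)` around `p`; it is `0` if
the ball is null. -/
def ballRatio (ν : Measure X) (A : Set X) (n : ℕ) (p : X) : ℝ :=
  ν.real (A ∩ Metric.closedBall p (1 / ((n : ℝ) + 1))) /
    ν.real (Metric.closedBall p (1 / ((n : ℝ) + 1)))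

/-- The density points of `A`, whether or not they belong to `A`. The radii run through a sequence,
which keeps the set measurable. -/
def densityPoints (ν : Measure X) (A : Set X) : Set X :=
  {p | Tendsto (fun n => ballRatio ν A n p) atTop (𝓝 1)}

variable {ν : Measure X} [IsFiniteMeasure ν] {A B : Set X}

theorem ballRatio_le_one (ν : Measure X) [IsFiniteMeasure ν] (A : Set X) (n : ℕ) (p : X) :
    ballRatio ν A n p ≤ 1 :=
  div_le_one_of_le₀ (measureReal_mono Set.inter_subset_right) measureReal_nonneg

theorem densityPoints_mono (hAB : A ⊆ B) : densityPoints ν A ⊆ densityPoints ν B := fun p hp =>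
  tendsto_of_tendsto_of_tendsto_of_le_of_le hp tendsto_const_nhds
    (fun _ => div_le_div_of_nonneg_right (measureReal_mono (Set.inter_subset_inter_left _ hAB))
      measureReal_nonneg) (fun n => ballRatio_le_one ν B n p)

theorem measurable_ballRatio [OpensMeasurableSpace X] [SecondCountableTopology X]
    (hA : MeasurableSet A) (n : ℕ) : Measurable (ballRatio ν A n) := by
  have measurable_measure_inter_ball : ∀ B : Set X, MeasurableSet B → Measurable fun p : X =>
      ν (B ∩ Metric.closedBall p (1 / ((n : ℝ) + 1))) := by
    intro B hB
    have hm : MeasurableSet {q : X × X | q.2 ∈ B ∧ dist q.2 q.1 ≤ 1 / ((n : ℝ) + 1)} :=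
      (measurable_snd hB).inter (measurableSet_le (measurable_snd.dist measurable_fst)
        measurable_const)
    exact measurable_measure_prodMk_left hm
  have hball := measurable_measure_inter_ball Set.univ MeasurableSet.univ
  simp only [Set.univ_inter] at hball
  exact (measurable_measure_inter_ball A hA).ennreal_toReal.div hball.ennreal_toReal

theorem measurableSet_densityPoints [OpensMeasurableSpace X] [SecondCountableTopology X]
    (hA : MeasurableSet A) : MeasurableSet (densityPoints ν A) :=
  measurableSet_tendsto _ fun n => measurable_ballRatio hA n

theorem ae_mem_densityPoints_iff [BorelSpace X] [SecondCountableTopology X]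
    [HasBesicovitchCovering X] (hA : MeasurableSet A) :
    ∀ᵐ p ∂ν, p ∈ densityPoints ν A ↔ p ∈ A := by
  have hr : Tendsto (fun n : ℕ => 1 / ((n : ℝ) + 1)) atTop (𝓝[>] 0) :=
    tendsto_nhdsWithin_iff.2 ⟨tendsto_one_div_add_atTop_nhds_zero_nat,
      Eventually.of_forall fun n => Set.mem_Ioi.2 (by positivity)⟩
  filter_upwards [Besicovitch.ae_tendsto_measure_inter_div_of_measurableSet ν hA] with p hp
  have hne : A.indicator (1 : X → ℝ≥0∞) p ≠ ∞ := by
    by_cases h : p ∈ A <;> simp [h]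
  have hlim : Tendsto (fun n => ballRatio ν A n p) atTop
      (𝓝 (A.indicator (1 : X → ℝ≥0∞) p).toReal) := by
    refine ((ENNReal.tendsto_toReal hne).comp (hp.comp hr)).congr fun n => ?_
    simp [ballRatio, measureReal_def, ENNReal.toReal_div]
  constructor
  · intro h
    by_contra hn
    have := tendsto_nhds_unique h hlim
    simp [hn] at this
  · intro h
    simpa [densityPoints, h] using hlim

theorem disjoint_densityPoints (hB : MeasurableSet B) [OpensMeasurableSpace X]
    (hAB : Disjoint A B) : Disjoint (densityPoints ν A) (densityPoints ν B) := by
  refine Set.disjoint_left.2 fun p hpA hpB => ?_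
  refine absurd (le_of_tendsto (hpA.add hpB) (Eventually.of_forall fun n => ?_))
    (by norm_num : ¬ (1 : ℝ) + 1 ≤ 1)
  rw [ballRatio, ballRatio, ← add_div, ← measureReal_union
    (hAB.mono Set.inter_subset_left Set.inter_subset_left)
    (hB.inter Metric.isClosed_closedBall.measurableSet)]
  exact div_le_one_of_le₀
    (measureReal_mono (Set.union_subset Set.inter_subset_right Set.inter_subset_right))
    measureReal_nonneg

end DensityPoints

section ProductDensityPoints

variable {S : Type*} [MeasurableSpace S] {μ : Measure S} [IsFiniteMeasure μ]

/-- Inclusion–exclusion in `I × J × K`: the triples with `(x, y) ∈ A` and those with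
`(y, z) ∈ A'` overlap, up to a null set, only where `(x, z) ∈ B`. -/
theorem measureReal_box_inequality {A A' B : Set (S × S)} (hA' : MeasurableSet A')
    (hB : MeasurableSet B)
    (h : ∀ᵐ t ∂((μ.prod μ).prod μ), t.1 ∈ A → (t.1.2, t.2) ∈ A' → (t.1.1, t.2) ∈ B)
    {I J K : Set S} (hI : MeasurableSet I) (hJ : MeasurableSet J) (hK : MeasurableSet K) :
    (μ.prod μ).real (A ∩ I ×ˢ J) * μ.real K + μ.real I * (μ.prod μ).real (A' ∩ J ×ˢ K) ≤
      μ.real J * (μ.prod μ).real (B ∩ I ×ˢ K) + μ.real I * μ.real J * μ.real K := by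
  set M := (μ.prod μ).prod μ
  let toMiddleFirst : (S × S) × S → S × (S × S) :=
    MeasurableEquiv.prodAssoc ∘ Prod.map Prod.swap id
  have hmiddle : MeasurePreserving toMiddleFirst M (μ.prod (μ.prod μ)) :=
    (measurePreserving_prodAssoc μ μ μ).comp
      (Measure.measurePreserving_swap.prod (MeasurePreserving.id μ))
  let T₁ : Set ((S × S) × S) := (A ∩ I ×ˢ J) ×ˢ K
  let T₂ : Set ((S × S) × S) := MeasurableEquiv.prodAssoc ⁻¹' (I ×ˢ (A' ∩ J ×ˢ K))
  let T₃ : Set ((S × S) × S) := toMiddleFirst ⁻¹' (J ×ˢ (B ∩ I ×ˢ K))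
  have hT₂m : MeasurableSet T₂ :=
    MeasurableEquiv.prodAssoc.measurable (hI.prod (hA'.inter (hJ.prod hK)))
  have real_T₁ : M.real T₁ = (μ.prod μ).real (A ∩ I ×ˢ J) * μ.real K := measureReal_prod_prod _ _
  have real_T₂ : M.real T₂ = μ.real I * (μ.prod μ).real (A' ∩ J ×ˢ K) := by
    rw [← measureReal_prod_prod, (measurePreserving_prodAssoc μ μ μ).measureReal_preimage
      (hI.prod (hA'.inter (hJ.prod hK))).nullMeasurableSet]
  have real_T₃ : M.real T₃ = μ.real J * (μ.prod μ).real (B ∩ I ×ˢ K) := by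
    rw [← measureReal_prod_prod, hmiddle.measureReal_preimage
      (hJ.prod (hB.inter (hI.prod hK))).nullMeasurableSet]
  have real_inter_le : M.real (T₁ ∩ T₂) ≤ M.real T₃ := by
    refine ENNReal.toReal_mono (measure_ne_top _ _) (measure_mono_ae ?_)
    filter_upwards [h] with t ht htT
    exact ⟨htT.1.1.2.2, ht htT.1.1.1 htT.2.2.1, htT.1.1.2.1, htT.1.2⟩
  have real_union_le : M.real (T₁ ∪ T₂) ≤ μ.real I * μ.real J * μ.real K := by
    rw [← measureReal_prod_prod, ← measureReal_prod_prod]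
    refine measureReal_mono (Set.union_subset (fun t ht => ⟨ht.1.2, ht.2⟩) fun t ht => ?_)
    exact ⟨⟨ht.1, ht.2.2.1⟩, ht.2.2.2⟩
  have := measureReal_union_add_inter (μ := M) (s := T₁) hT₂m
  rw [← real_T₁, ← real_T₂, ← real_T₃]
  linarith

variable [MetricSpace S]

theorem measureReal_closedBall_pos_of_ballRatio_pos {A : Set (S × S)} {n : ℕ} {x y : S}
    (h : 0 < ballRatio (μ.prod μ) A n (x, y)) :
    0 < μ.real (Metric.closedBall x (1 / ((n : ℝ) + 1))) ∧
      0 < μ.real (Metric.closedBall y (1 / ((n : ℝ) + 1))) := by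
  rw [ballRatio, ← closedBall_prod_same, measureReal_prod_prod] at h
  constructor <;> refine lt_of_le_of_ne measureReal_nonneg fun hzero => ?_ <;>
    simp only [← hzero, zero_mul, mul_zero, div_zero, lt_self_iff_false] at h

theorem ballRatio_add_sub_one_le [OpensMeasurableSpace S] {A A' B : Set (S × S)}
    (hA' : MeasurableSet A') (hB : MeasurableSet B)
    (h : ∀ᵐ t ∂((μ.prod μ).prod μ), t.1 ∈ A → (t.1.2, t.2) ∈ A' → (t.1.1, t.2) ∈ B)
    {x y z : S} {n : ℕ} (hxy : 0 < ballRatio (μ.prod μ) A n (x, y))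
    (hyz : 0 < ballRatio (μ.prod μ) A' n (y, z)) :
    ballRatio (μ.prod μ) A n (x, y) + ballRatio (μ.prod μ) A' n (y, z) - 1 ≤
      ballRatio (μ.prod μ) B n (x, z) := by
  obtain ⟨ha, hb⟩ := measureReal_closedBall_pos_of_ballRatio_pos hxy
  obtain ⟨-, hc⟩ := measureReal_closedBall_pos_of_ballRatio_pos hyz
  have hbox := measureReal_box_inequality hA' hB h
    (Metric.isClosed_closedBall (x := x) (ε := 1 / ((n : ℝ) + 1))).measurableSet
    (Metric.isClosed_closedBall (x := y) (ε := 1 / ((n : ℝ) + 1))).measurableSet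
    (Metric.isClosed_closedBall (x := z) (ε := 1 / ((n : ℝ) + 1))).measurableSet
  simp only [ballRatio, ← closedBall_prod_same, measureReal_prod_prod]
  generalize μ.real (Metric.closedBall x (1 / ((n : ℝ) + 1))) = a at *
  generalize μ.real (Metric.closedBall y (1 / ((n : ℝ) + 1))) = b at *
  generalize μ.real (Metric.closedBall z (1 / ((n : ℝ) + 1))) = c at *
  rw [← mul_le_mul_iff_right₀ (show 0 < a * b * c by positivity)]
  field_simp
  linarith

theorem mem_densityPoints_trans [OpensMeasurableSpace S] {A A' B : Set (S × S)}
    (hA' : MeasurableSet A') (hB : MeasurableSet B)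
    (h : ∀ᵐ t ∂((μ.prod μ).prod μ), t.1 ∈ A → (t.1.2, t.2) ∈ A' → (t.1.1, t.2) ∈ B)
    {x y z : S} (hxy : (x, y) ∈ densityPoints (μ.prod μ) A)
    (hyz : (y, z) ∈ densityPoints (μ.prod μ) A') :
    (x, z) ∈ densityPoints (μ.prod μ) B := by
  have hlim : Tendsto
      (fun n => ballRatio (μ.prod μ) A n (x, y) + ballRatio (μ.prod μ) A' n (y, z) - 1) atTop
      (𝓝 1) := by
    simpa using (Tendsto.add hxy hyz).sub_const 1
  refine tendsto_of_tendsto_of_tendsto_of_le_of_le' hlim tendsto_const_nhds ?_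
    (Eventually.of_forall fun n => ballRatio_le_one _ B n _)
  filter_upwards [Tendsto.eventually_const_lt zero_lt_one hxy,
    Tendsto.eventually_const_lt zero_lt_one hyz] with n hn hn'
  exact ballRatio_add_sub_one_le hA' hB h hn hn'

theorem ballRatio_swap [OpensMeasurableSpace S] [SecondCountableTopology S] {A : Set (S × S)}
    (hA : MeasurableSet A) (n : ℕ) (p : S × S) :
    ballRatio (μ.prod μ) (Prod.swap ⁻¹' A) n p.swap = ballRatio (μ.prod μ) A n p := by
  have preimage_ball : Metric.closedBall p.swap (1 / ((n : ℝ) + 1)) =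
      Prod.swap ⁻¹' Metric.closedBall p (1 / ((n : ℝ) + 1)) := by
    rw [← closedBall_prod_same, ← closedBall_prod_same, Set.preimage_swap_prod]
    rfl
  have hball : MeasurableSet (Metric.closedBall p (1 / ((n : ℝ) + 1))) :=
    Metric.isClosed_closedBall.measurableSet
  have hswap : MeasurePreserving Prod.swap (μ.prod μ) (μ.prod μ) := Measure.measurePreserving_swap
  rw [ballRatio, ballRatio, preimage_ball, ← Set.preimage_inter,
    hswap.measureReal_preimage (hA.inter hball).nullMeasurableSet,
    hswap.measureReal_preimage hball.nullMeasurableSet]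

variable {w : S × S → unitInterval}

/-- The version of a kernel given by the density points of `{w = 1}` and `{0 < w}`. It inherits
everywhere the implications that `w` satisfies only almost everywhere. -/
def regularVersion (μ : Measure S) (w : S × S → unitInterval) (p : S × S) : unitInterval :=
  open Classical in
  if p ∈ densityPoints (μ.prod μ) {p | w p = 1} then 1
  else if p ∈ densityPoints (μ.prod μ) {p | 0 < w p} then w p else 0

theorem mem_densityPoints_of_regularVersion_pos {p : S × S} (hp : 0 < regularVersion μ w p) :
    p ∈ densityPoints (μ.prod μ) {p | 0 < w p} := by
  by_contra hpos
  have hone : p ∉ densityPoints (μ.prod μ) {p | w p = 1} := fun hone =>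
    hpos (densityPoints_mono (fun q (hq : w q = 1) => zero_lt_one.trans_eq hq.symm) hone)
  simp [regularVersion, hone, hpos] at hp

theorem measurable_regularVersion [OpensMeasurableSpace S] [SecondCountableTopology S]
    (hw : Measurable w) : Measurable (regularVersion μ w) :=
  Measurable.ite (measurableSet_densityPoints (hw (measurableSet_singleton 1))) measurable_const
    (Measurable.ite (measurableSet_densityPoints (measurableSet_lt measurable_const hw)) hw
      measurable_const)

theorem regularVersion_trans [OpensMeasurableSpace S] (hw : Measurable w)
    (htr : ∀ᵐ t ∂((μ.prod μ).prod μ), 0 < w t.1 → 0 < w (t.1.2, t.2) → w (t.1.1, t.2) = 1)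
    {x y z : S} (hxy : 0 < regularVersion μ w (x, y)) (hyz : 0 < regularVersion μ w (y, z)) :
    regularVersion μ w (x, z) = 1 :=
  if_pos (mem_densityPoints_trans (measurableSet_lt measurable_const hw)
    (hw (measurableSet_singleton 1)) htr (mem_densityPoints_of_regularVersion_pos hxy)
    (mem_densityPoints_of_regularVersion_pos hyz))

theorem regularVersion_self [OpensMeasurableSpace S] [SecondCountableTopology S]
    (hw : Measurable w)
    (hcy : ∀ᵐ t ∂((μ.prod μ).prod μ), 0 < w t.1 → 0 < w (t.1.2, t.2) → w (t.2, t.1.1) = 0)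
    (x : S) : regularVersion μ w (x, x) = 0 := by
  have hpos : MeasurableSet {p | 0 < w p} := measurableSet_lt measurable_const hw
  have hzero : MeasurableSet {p | w p = 0} := hw (measurableSet_singleton 0)
  by_contra hne
  have hx := mem_densityPoints_of_regularVersion_pos (unitInterval.pos_iff_ne_zero.2 hne)
  have hx_swap_zero : (x, x) ∈ densityPoints (μ.prod μ) (Prod.swap ⁻¹' {p | w p = 0}) :=
    mem_densityPoints_trans hpos (measurable_swap hzero) hcy hx hx
  have hx_zero : (x, x) ∈ densityPoints (μ.prod μ) {p | w p = 0} :=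
    hx_swap_zero.congr fun n => ballRatio_swap hzero n (x, x)
  refine Set.disjoint_left.1 (disjoint_densityPoints hzero ?_) hx hx_zero
  exact Set.disjoint_left.2 fun p (hp : 0 < w p) hp0 => hp.ne' hp0

theorem regularVersion_ae_eq [BorelSpace S] [SecondCountableTopology S]
    [HasBesicovitchCovering (S × S)] (hw : Measurable w) :
    regularVersion μ w =ᵐ[μ.prod μ] w := by
  filter_upwards [ae_mem_densityPoints_iff (ν := μ.prod μ) (measurableSet_lt measurable_const hw),
    ae_mem_densityPoints_iff (ν := μ.prod μ) (hw (measurableSet_singleton 1))] with p hpos hone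
  simp only [regularVersion]
  split_ifs with hp_one hp_pos
  · exact (hone.1 hp_one).symm
  · rfl
  · by_contra hne
    exact hp_pos (hpos.2 (unitInterval.pos_iff_ne_zero.2 fun h => hne h.symm))

end ProductDensityPoints

/-! ### The random poset of a kernel -/

section LtPairs

variable {U V : Type*} [Fintype V]

open Classical in
/-- The set of related pairs of a poset: the index set of the products that define `t(Q, ·)`. -/
def PosetOn.ltPairs (Q : PosetOn V) : Finset (V × V) := {p | Q.lt p.1 p.2}

theorem PosetOn.mem_ltPairs {Q : PosetOn V} {p : V × V} : p ∈ Q.ltPairs ↔ Q.lt p.1 p.2 := by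
  simp [PosetOn.ltPairs]

open Classical in
theorem PosetOn.prod_ite_lt (Q : PosetOn V) {M : Type*} [CommMonoid M] (f : V → V → M) :
    ∏ i, ∏ j, (if Q.lt i j then f i j else 1) = ∏ p ∈ Q.ltPairs, f p.1 p.2 := by
  rw [PosetOn.ltPairs, Finset.prod_filter, Fintype.prod_prod_type]

theorem embEvent_eq_preimage_pairsEvent (Q : PosetOn V) (ι : V → U) :
    embEvent Q ι = (fun R => R.comap ι) ⁻¹' pairsEvent Q.ltPairs := by
  ext R
  simp only [embEvent, pairsEvent, Set.mem_preimage, Set.mem_ofPred_eq, PosetOn.mem_ltPairs,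
    Prod.forall]
  rfl

theorem PosetOn.isOriented_ltPairs (Q : PosetOn V) : BoolArray.IsOriented Q.ltPairs := by
  have irrefl : ∀ i, ¬ Q.lt i i := fun i hi => Bool.false_ne_true ((Q.2.1 i).symm.trans hi)
  refine fun p hp => ⟨fun h => irrefl p.2 ?_, fun hs => irrefl p.1 ?_⟩
  · simpa [h] using PosetOn.mem_ltPairs.1 hp
  · exact Q.2.2 _ _ _ (PosetOn.mem_ltPairs.1 hp) (PosetOn.mem_ltPairs.1 hs)

end LtPairs

theorem integral_prod_ofReal {Ω ι : Type*} [MeasurableSpace Ω] (P : Measure Ω) (D : Finset ι)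
    {f : ι → Ω → unitInterval} (hf : ∀ i ∈ D, Measurable (f i)) :
    ∫ ω, ∏ i ∈ D, (f i ω : ℝ) ∂P = (∫⁻ ω, ∏ i ∈ D, ENNReal.ofReal (f i ω) ∂P).toReal := by
  rw [integral_eq_lintegral_of_nonneg_ae
    (ae_of_all _ fun ω => Finset.prod_nonneg fun i _ => (f i ω).2.1)
    (Finset.measurable_fun_prod _ fun i hi =>
      measurable_subtype_coe.comp (hf i hi)).aestronglyMeasurable]
  simp_rw [ENNReal.ofReal_prod_of_nonneg fun i _ => (f i _).2.1]

theorem pi_map_pair {V S : Type*} [Fintype V] [MeasurableSpace S] (μ : Measure S)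
    [IsProbabilityMeasure μ] {i j : V} (hij : i ≠ j) :
    (Measure.pi fun _ : V => μ).map (fun x => (x i, x j)) = μ.prod μ := by
  have hindep : iIndepFun (fun (i : V) (x : V → S) => x i) (Measure.pi fun _ : V => μ) :=
    iIndepFun_pi (μ := fun _ : V => μ) (X := fun _ => id) fun _ => aemeasurable_id
  have hmap : ∀ i : V, (Measure.pi fun _ : V => μ).map (fun x => x i) = μ := fun i =>
    (measurePreserving_eval (fun _ : V => μ) i).map_eq
  rw [(indepFun_iff_map_prod_eq_prod_map_map (measurable_pi_apply i).aemeasurable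
    (measurable_pi_apply j).aemeasurable).1 (hindep.indepFun hij), hmap, hmap]

theorem pi_map_triple {S : Type*} [MeasurableSpace S] (μ : Measure S) [IsProbabilityMeasure μ] :
    (Measure.pi fun _ : Fin 3 => μ).map (fun x => ((x 0, x 1), x 2)) = (μ.prod μ).prod μ := by
  have hm : Measurable fun x : Fin 3 → S => ((x 0, x 1), x 2) := by fun_prop
  have := Measure.isProbabilityMeasure_map (μ := Measure.pi fun _ : Fin 3 => μ) hm.aemeasurable
  refine Measure.ext_prod₃' fun {s t u} hs ht hu => ?_
  have preimage_box : (fun x : Fin 3 → S => ((x 0, x 1), x 2)) ⁻¹' (s ×ˢ t) ×ˢ u =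
      Set.univ.pi ![s, t, u] := by
    ext x
    simp [Set.mem_pi, Fin.forall_fin_succ, and_assoc]
  rw [Measure.map_apply hm ((hs.prod ht).prod hu), preimage_box, Measure.pi_pi,
    Measure.prod_prod, Measure.prod_prod]
  simp [Fin.prod_univ_three]

theorem infinitePi_map_comp {ι V S : Type*} [Fintype V] [MeasurableSpace S] (μ : Measure S)
    [IsProbabilityMeasure μ] {g : V → ι} (hg : Function.Injective g) :
    (Measure.infinitePi fun _ : ι => μ).map (fun x v => x (g v)) = Measure.pi fun _ => μ := by
  have hindep : iIndepFun (fun (i : ι) (x : ι → S) => x i) (Measure.infinitePi fun _ : ι => μ) :=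
    iIndepFun_infinitePi (P := fun _ : ι => μ) (X := fun _ => id) fun _ => measurable_id
  rw [(iIndepFun_iff_map_fun_eq_pi_map fun v => (measurable_pi_apply (g v)).aemeasurable).1
    (hindep.precomp hg)]
  congr 1
  exact funext fun v => Measure.infinitePi_map_eval (fun _ : ι => μ) (g v)

theorem uniform01_lt {a : ℝ} (ha : a ≤ 1) :
    uniform01 {x | (x : ℝ) < a} = ENNReal.ofReal a := by
  have image_eq : Subtype.val '' {x : Set.Ioo (0 : ℝ) 1 | (x : ℝ) < a} = Set.Ioo 0 a := by
    ext x
    simp only [Set.mem_image, Set.mem_ofPred_eq, Subtype.exists, exists_and_left, exists_prop,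
      exists_eq_right_right, Set.mem_Ioo]
    exact ⟨fun h => ⟨h.2.1, h.1⟩, fun h => ⟨h.2, h.1, h.2.trans_le ha⟩⟩
  rw [uniform01, comap_subtype_coe_apply measurableSet_Ioo, image_eq, Real.volume_Ioo, sub_zero]

namespace PosetKernel

variable {S : OrderedProbabilitySpace.{u}}

theorem sample_lt (K : PosetKernel S) (ω : (ℕ → S.carrier) × (ℕ × ℕ → Set.Ioo (0 : ℝ) 1))
    (i j : ℕ) : (K.sample ω).lt i j ↔ (ω.2 (i, j) : ℝ) < K.W (ω.1 i) (ω.1 j) := by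
  simp [PosetOn.lt, sample]

theorem measurable_W_comp (K : PosetKernel S) {Ω : Type*} [MeasurableSpace Ω]
    {f g : Ω → S.carrier} (hf : Measurable f) (hg : Measurable g) :
    Measurable fun ω => K.W (f ω) (g ω) :=
  K.measurable_W.comp (f := fun ω => (f ω, g ω)) (hf.prodMk hg)

theorem measurable_sample (K : PosetKernel S) : Measurable K.sample := by
  refine Measurable.subtype_mk (measurable_pi_lambda _ fun i => measurable_pi_lambda _ fun j =>
    measurable_to_bool ?_)
  have hlt : MeasurableSet {ω : (ℕ → S.carrier) × (ℕ × ℕ → Set.Ioo (0 : ℝ) 1) |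
      (ω.2 (i, j) : ℝ) < K.W (ω.1 i) (ω.1 j)} :=
    measurableSet_lt (by fun_prop)
      (measurable_subtype_coe.comp (K.measurable_W_comp (by fun_prop) (by fun_prop)))
  convert hlt using 1
  ext ω
  simp

instance (K : PosetKernel S) : IsProbabilityMeasure K.law :=
  Measure.isProbabilityMeasure_map K.measurable_sample.aemeasurable

variable {V : Type*} [Fintype V]

theorem infinitePi_uniform01_sample (K : PosetKernel S) (Q : PosetOn V) {ι : V → ℕ}
    (hι : Function.Injective ι) (x : ℕ → S.carrier) :
    (Measure.infinitePi fun _ : ℕ × ℕ => uniform01) {ξ | K.sample (x, ξ) ∈ embEvent Q ι} =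
      ∏ p ∈ Q.ltPairs, ENNReal.ofReal (K.W (x (ι p.1)) (x (ι p.2))) := by
  have cylinder_eq : {ξ | K.sample (x, ξ) ∈ embEvent Q ι} =
      Set.pi ((Q.ltPairs.map ((⟨ι, hι⟩ : V ↪ ℕ).prodMap ⟨ι, hι⟩) : Finset (ℕ × ℕ)) : Set (ℕ × ℕ))
        fun p => {ξ : Set.Ioo (0 : ℝ) 1 | (ξ : ℝ) < K.W (x p.1) (x p.2)} := by
    ext ξ
    simp only [embEvent, sample_lt, Set.mem_ofPred_eq, Set.mem_pi, Finset.coe_map, Set.mem_image,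
      SetLike.mem_coe, PosetOn.mem_ltPairs]
    refine ⟨?_, fun h i j hij => h (ι i, ι j) ⟨(i, j), hij, rfl⟩⟩
    rintro h _ ⟨p, hp, rfl⟩
    exact h _ _ hp
  rw [cylinder_eq, Measure.infinitePi_pi _ fun p _ =>
    measurableSet_lt measurable_subtype_coe measurable_const, Finset.prod_map]
  exact Finset.prod_congr rfl fun p _ => uniform01_lt (K.W _ _).2.2

theorem law_embEvent (K : PosetKernel S) (Q : PosetOn V) {ι : V → ℕ}
    (hι : Function.Injective ι) :
    K.law (embEvent Q ι) = ∫⁻ x : V → S.carrier,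
      ∏ p ∈ Q.ltPairs, ENNReal.ofReal (K.W (x p.1) (x p.2)) ∂(Measure.pi fun _ => S.μ) := by
  have hE := measurableSet_embEvent Q ι
  have hF : Measurable fun x : V → S.carrier =>
      ∏ p ∈ Q.ltPairs, ENNReal.ofReal (K.W (x p.1) (x p.2)) :=
    Finset.measurable_fun_prod _ fun p _ => (measurable_subtype_coe.comp
      (K.measurable_W_comp (by fun_prop) (by fun_prop))).ennreal_ofReal
  rw [law, Measure.map_apply K.measurable_sample hE, Measure.prod_apply (K.measurable_sample hE),
    ← infinitePi_map_comp S.μ hι, lintegral_map hF (by fun_prop)]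
  exact lintegral_congr fun x => K.infinitePi_uniform01_sample Q hι x

theorem represents_iff {K : PosetKernel S} {Γ : ProperPosetLimit} :
    K.Represents Γ ↔ ∀ (n : ℕ) (Q : PosetOn (Fin (n + 1))), PosetLimit.t Q.unlabelled Γ.1 =
      (∫⁻ x : Fin (n + 1) → S.carrier, ∏ p ∈ Q.ltPairs, ENNReal.ofReal (K.W (x p.1) (x p.2))
        ∂(Measure.pi fun _ => S.μ)).toReal := by
  refine forall₂_congr fun n Q => ?_
  rw [← integral_prod_ofReal _ _ fun p _ => K.measurable_W_comp (by fun_prop) (by fun_prop)]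
  simp_rw [Q.prod_ite_lt]

theorem Represents.hasDensities {K : PosetKernel S} {Γ : ProperPosetLimit}
    (h : K.Represents Γ) : HasDensities K.law Γ.1 := by
  intro A _ Q
  obtain ⟨n, hn⟩ : ∃ n, Fintype.card A = n + 1 :=
    ⟨Fintype.card A - 1, (Nat.sub_add_cancel Fintype.card_pos).symm⟩
  let e : Fin (n + 1) ≃ A := (Fintype.equivFinOfCardEq hn).symm
  rw [← PosetOn.unlabelled_eq_of_iso (Q.iso_comap e), represents_iff.1 h n (Q.comap e),
    ← K.law_embEvent (Q.comap e) (ι := fun i => (e i : ℕ))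
      (Subtype.val_injective.comp e.injective), measureReal_def]
  congr 2
  ext R
  refine ⟨fun hR x y hxy => hR (e x) (e y) hxy, fun hR x y hxy => ?_⟩
  simpa using hR (e.symm x) (e.symm y) (by simpa [PosetOn.lt, PosetOn.comap] using hxy)

end PosetKernel

/-! ### Independence of disjoint parts -/

theorem comap_eq_generateFrom {Ω U : Type*} [Countable U] (X : Ω → PosetOn U) :
    MeasurableSpace.comap X inferInstance =
      MeasurableSpace.generateFrom {s | ∃ t ∈ Set.range pairsEvent, X ⁻¹' t = s} := by
  rw [generateFrom_pairsEvent, MeasurableSpace.comap_generateFrom]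
  rfl

theorem indepFun_of_pairsEvent {Ω U V : Type*} [MeasurableSpace Ω] [Countable U] [Countable V]
    {P : Measure Ω} [IsZeroOrProbabilityMeasure P] {X : Ω → PosetOn U} {Y : Ω → PosetOn V}
    (hX : Measurable X) (hY : Measurable Y)
    (h : ∀ D D', P (X ⁻¹' pairsEvent D ∩ Y ⁻¹' pairsEvent D') =
      P (X ⁻¹' pairsEvent D) * P (Y ⁻¹' pairsEvent D')) : IndepFun X Y P := by
  refine IndepSets.indep hX.comap_le hY.comap_le (isPiSystem_pairsEvent.comap X)
    (isPiSystem_pairsEvent.comap Y) (comap_eq_generateFrom X)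
    (comap_eq_generateFrom Y) ?_
  rw [IndepSets_iff]
  rintro _ _ ⟨_, ⟨D, rfl⟩, rfl⟩ ⟨_, ⟨D', rfl⟩, rfl⟩
  exact h D D'

theorem embEvent_sum {U V V' : Type*} (Q : PosetOn V) (Q' : PosetOn V') (ι : V ⊕ V' → U) :
    embEvent (Q.sum Q') ι = embEvent Q (ι ∘ .inl) ∩ embEvent Q' (ι ∘ .inr) :=
  Set.ext fun _ => PosetOn.sum_hom_iff

theorem HasDensities.measure_embEvent_inter {ν : Measure (PosetOn ℕ)} [IsFiniteMeasure ν]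
    {Γ : PosetLimit} (h : HasDensities ν Γ) {V V' : Type*} [Finite V] [Finite V'] [Nonempty V]
    [Nonempty V'] (Q : PosetOn V) (Q' : PosetOn V') {ι : V ⊕ V' → ℕ}
    (hι : Function.Injective ι) :
    ν (embEvent Q (ι ∘ .inl) ∩ embEvent Q' (ι ∘ .inr)) =
      ν (embEvent Q (ι ∘ .inl)) * ν (embEvent Q' (ι ∘ .inr)) := by
  have := Fintype.ofFinite V
  have := Fintype.ofFinite V'
  rw [← embEvent_sum, ← ENNReal.toReal_eq_toReal_iff' (measure_ne_top _ _)
    (ENNReal.mul_ne_top (measure_ne_top _ _) (measure_ne_top _ _)), ENNReal.toReal_mul]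
  exact (h.real_embEvent _ hι).trans <| (PosetLimit.t_sum Q Q' Γ).trans <| congrArg₂ _
    (h.real_embEvent Q (hι.comp Sum.inl_injective)).symm
    (h.real_embEvent Q' (hι.comp Sum.inr_injective)).symm

theorem HasDensities.indepFun {ν : Measure (PosetOn ℕ)} [IsProbabilityMeasure ν]
    {Γ : PosetLimit} (h : HasDensities ν Γ) {τ : ℕ ⊕ ℕ → ℕ} (hτ : Function.Injective τ) :
    IndepFun (fun R : PosetOn ℕ => R.comap (τ ∘ .inl)) (fun R => R.comap (τ ∘ .inr)) ν := by
  refine indepFun_of_pairsEvent (PosetOn.measurable_comap _) (PosetOn.measurable_comap _)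
    fun D D' => ?_
  rcases pairsEvent_eq_empty_or_embEvent D with hempty | ⟨A, hA, Q, hQ⟩
  · simp [hempty]
  rcases pairsEvent_eq_empty_or_embEvent D' with hempty | ⟨A', hA', Q', hQ'⟩
  · simp [hempty]
  rw [hQ, hQ']
  exact h.measure_embEvent_inter Q Q'
    (hτ.comp (Sum.map_injective.2 ⟨Subtype.val_injective, Subtype.val_injective⟩))

/-! ### Existence of representing kernels -/

/-- `w` is a kernel, not necessarily transitive, whose random relation on i.i.d. points of law `μ`
gives every oriented set of pairs the probability it has under `ν`. -/
def IsKernelOf {S : Type*} [MeasurableSpace S] (ν : Measure (PosetOn ℕ)) (μ : Measure S)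
    (w : S × S → unitInterval) : Prop :=
  ∀ (n : ℕ) (D : Finset (Fin n × Fin n)), BoolArray.IsOriented D →
    ∫⁻ x : Fin n → S, ∏ p ∈ D, ENNReal.ofReal (w (x p.1, x p.2)) ∂(Measure.pi fun _ => μ) =
      ν ((fun R => R.comap Fin.val) ⁻¹' pairsEvent D)

namespace IsKernelOf

variable {S : Type*} [MeasurableSpace S] {ν : Measure (PosetOn ℕ)} {μ : Measure S}
  {w : S × S → unitInterval}

theorem measurable_prod {n : ℕ} (hw : Measurable w) (D : Finset (Fin n × Fin n)) :
    Measurable fun x : Fin n → S => ∏ p ∈ D, ENNReal.ofReal (w (x p.1, x p.2)) :=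
  Finset.measurable_fun_prod _ fun p _ => (measurable_subtype_coe.comp
    (hw.comp (f := fun x : Fin n → S => (x p.1, x p.2)) (by fun_prop))).ennreal_ofReal

theorem measurableSet_pos_imp_eq (hw : Measurable w) {v : (S × S) × S → unitInterval}
    (hv : Measurable v) (a : unitInterval) :
    MeasurableSet {t : (S × S) × S | 0 < w t.1 → 0 < w (t.1.2, t.2) → v t = a} := by
  have set_eq : {t : (S × S) × S | 0 < w t.1 → 0 < w (t.1.2, t.2) → v t = a} =
      {t | 0 < w t.1}ᶜ ∪ ({t | 0 < w (t.1.2, t.2)}ᶜ ∪ {t | v t = a}) := by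
    ext t
    simp only [Set.mem_union, Set.mem_compl_iff, Set.mem_ofPred_eq]
    tauto
  rw [set_eq]
  exact (measurableSet_lt measurable_const (by fun_prop)).compl.union
    ((measurableSet_lt measurable_const (by fun_prop)).compl.union (hv (measurableSet_singleton a)))

theorem ae_triple [IsProbabilityMeasure μ] {q : (S × S) × S → Prop}
    (hq : MeasurableSet {t | q t})
    (h : ∀ᵐ x ∂(Measure.pi fun _ : Fin 3 => μ), q ((x 0, x 1), x 2)) :
    ∀ᵐ t ∂((μ.prod μ).prod μ), q t := by
  rw [← pi_map_triple, ae_map_iff (by fun_prop) hq]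
  exact h

/-- The events `0 < 1 < 2` and `0 < 1 < 2, 0 < 2` coincide, so the integrals of
`w(x,y) w(y,z)` and `w(x,y) w(y,z) w(x,z)` agree. -/
theorem ae_trans [IsFiniteMeasure ν] [IsProbabilityMeasure μ] (h : IsKernelOf ν μ w)
    (hw : Measurable w) :
    ∀ᵐ t ∂((μ.prod μ).prod μ), 0 < w t.1 → 0 < w (t.1.2, t.2) → w (t.1.1, t.2) = 1 := by
  refine ae_triple (measurableSet_pos_imp_eq hw (by fun_prop) 1) ?_
  have event_eq : pairsEvent ({(0, 2), (0, 1), (1, 2)} : Finset (Fin 3 × Fin 3)) =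
      pairsEvent {(0, 1), (1, 2)} := by
    ext R
    simp only [pairsEvent, Finset.mem_insert, Finset.mem_singleton, Set.mem_ofPred_eq,
      forall_eq_or_imp, forall_eq, and_iff_right_iff_imp]
    exact fun hR => R.2.2 _ _ _ hR.1 hR.2
  have integral_eq := h 3 {(0, 2), (0, 1), (1, 2)} (by unfold BoolArray.IsOriented; decide)
  rw [event_eq, ← h 3 {(0, 1), (1, 2)} (by unfold BoolArray.IsOriented; decide)] at integral_eq
  have prod_le : ∀ x : Fin 3 → S,
      ∏ p ∈ {((0 : Fin 3), (2 : Fin 3)), (0, 1), (1, 2)}, ENNReal.ofReal (w (x p.1, x p.2)) ≤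
        ∏ p ∈ {((0 : Fin 3), (1 : Fin 3)), (1, 2)}, ENNReal.ofReal (w (x p.1, x p.2)) := by
    intro x
    rw [Finset.prod_insert (by decide)]
    exact mul_le_of_le_one_left' (ENNReal.ofReal_le_one.2 (w _).2.2)
  filter_upwards [ae_eq_of_ae_le_of_lintegral_le (ae_of_all _ prod_le)
    (integral_eq.trans_ne ((h 3 _ (by unfold BoolArray.IsOriented; decide)).trans_ne
      (measure_ne_top _ _))) (measurable_prod hw _).aemeasurable integral_eq.ge]
    with x hx h01 h12
  rw [Finset.prod_insert (by decide)] at hx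
  have prod_ne_zero : ∏ p ∈ {((0 : Fin 3), (1 : Fin 3)), (1, 2)},
      ENNReal.ofReal (w (x p.1, x p.2)) ≠ 0 := by
    rw [Finset.prod_pair (by decide)]
    exact mul_ne_zero (ENNReal.ofReal_pos.2 h01).ne' (ENNReal.ofReal_pos.2 h12).ne'
  have prod_ne_top : ∏ p ∈ {((0 : Fin 3), (1 : Fin 3)), (1, 2)},
      ENNReal.ofReal (w (x p.1, x p.2)) ≠ ∞ :=
    ENNReal.prod_ne_top fun p _ => ENNReal.ofReal_ne_top
  exact Subtype.ext (ENNReal.ofReal_eq_one.1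
    ((ENNReal.mul_eq_right prod_ne_zero prod_ne_top).1 hx))

/-- The event `0 < 1 < 2 < 0` is empty, so the integral of `w(x,y) w(y,z) w(z,x)` vanishes. -/
theorem ae_acyclic [IsProbabilityMeasure μ] (h : IsKernelOf ν μ w) (hw : Measurable w) :
    ∀ᵐ t ∂((μ.prod μ).prod μ), 0 < w t.1 → 0 < w (t.1.2, t.2) → w (t.2, t.1.1) = 0 := by
  refine ae_triple (measurableSet_pos_imp_eq hw (by fun_prop) 0) ?_
  have event_eq : pairsEvent ({(0, 1), (1, 2), (2, 0)} : Finset (Fin 3 × Fin 3)) = ∅ := by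
    ext R
    simp only [pairsEvent, Finset.mem_insert, Finset.mem_singleton, Set.mem_ofPred_eq,
      forall_eq_or_imp, forall_eq, Set.mem_empty_iff_false, iff_false]
    rintro ⟨h01, h12, h20⟩
    exact Bool.false_ne_true
      ((R.2.1 0).symm.trans (R.2.2 _ _ _ (R.2.2 _ _ _ h01 h12) h20))
  have integral_eq := h 3 {(0, 1), (1, 2), (2, 0)} (by unfold BoolArray.IsOriented; decide)
  rw [event_eq, Set.preimage_empty, measure_empty,
    lintegral_eq_zero_iff (measurable_prod hw _)] at integral_eq
  filter_upwards [integral_eq] with x hx h01 h12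
  rw [Finset.prod_insert (by decide), Finset.prod_pair (by decide)] at hx
  have h20 : ENNReal.ofReal (w (x 2, x 0)) = 0 := by
    simpa [(ENNReal.ofReal_pos.2 h01).ne', (ENNReal.ofReal_pos.2 h12).ne'] using hx
  exact Subtype.ext (le_antisymm (ENNReal.ofReal_eq_zero.1 h20) (w _).2.1)

theorem congr_ae [IsProbabilityMeasure μ] (h : IsKernelOf ν μ w) {w' : S × S → unitInterval}
    (hw' : w' =ᵐ[μ.prod μ] w) : IsKernelOf ν μ w' := by
  intro n D hD
  rw [← h n D hD]
  refine lintegral_congr_ae ?_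
  have ae_eq_pairs : ∀ᵐ x ∂(Measure.pi fun _ : Fin n => μ), ∀ p ∈ D,
      w' (x p.1, x p.2) = w (x p.1, x p.2) := by
    refine (ae_ball_iff D.countable_toSet).2 fun p hp => ?_
    have measurable_pair : Measurable fun x : Fin n → S => (x p.1, x p.2) := by fun_prop
    refine ae_of_ae_map (p := fun t => w' t = w t) measurable_pair.aemeasurable ?_
    rwa [pi_map_pair μ (hD p hp).1]
  filter_upwards [ae_eq_pairs] with x hx
  exact Finset.prod_congr rfl fun p hp => by rw [hx p hp]

end IsKernelOf

section limitLaw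

/-- An infinite poset as an array indexed by two copies of `ℕ`. -/
def PosetOn.toArray (R : PosetOn ℕ) : BoolArray := (R.comap Equiv.natSumNatEquivNat).1

theorem measurable_toArray : Measurable PosetOn.toArray :=
  measurable_subtype_coe.comp (PosetOn.measurable_comap _)

variable {Γ : PosetLimit}

theorem isExchangeable_toArray :
    BoolArray.IsExchangeable ((limitLaw Γ : Measure (PosetOn ℕ)).map PosetOn.toArray) := by
  intro τ hτ
  refine ⟨BoolArray.measurable_reindex τ, ?_⟩
  let c := Equiv.natSumNatEquivNat
  have hinj : Function.Injective fun n => c (τ (c.symm n)) :=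
    c.injective.comp (hτ.comp c.symm.injective)
  rw [Measure.map_map (BoolArray.measurable_reindex τ) measurable_toArray]
  conv_rhs => rw [← (hasDensities_limitLaw Γ).map_comap hinj]
  rw [Measure.map_map measurable_toArray (PosetOn.measurable_comap _)]
  congr 1
  ext R a b
  change R.1 (c (τ a)) (c (τ b)) = R.1 (c (τ (c.symm (c a)))) (c (τ (c.symm (c b))))
  rw [c.symm_apply_apply, c.symm_apply_apply]

theorem toArray_preimage_base (C : Set BoolArray.Base) :
    PosetOn.toArray ⁻¹' (BoolArray.base ⁻¹' C) =
      (fun R => R.comap (Equiv.natSumNatEquivNat ∘ .inl)) ⁻¹' {R : PosetOn ℕ | R.1 ∈ C} :=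
  rfl

theorem toArray_preimage_pairsOne {n : ℕ} (D : Finset (Fin n × Fin n)) :
    PosetOn.toArray ⁻¹' BoolArray.pairsOne D =
      (fun R => R.comap (Equiv.natSumNatEquivNat ∘ .inr)) ⁻¹'
        ((fun R => R.comap Fin.val) ⁻¹' pairsEvent D) :=
  rfl

theorem measurableSet_comap_pairsEvent {n : ℕ} (D : Finset (Fin n × Fin n)) :
    MeasurableSet ((fun R : PosetOn ℕ => R.comap (Fin.val : Fin n → ℕ)) ⁻¹' pairsEvent D) :=
  PosetOn.measurable_comap _ (measurableSet_pairsEvent D)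

theorem map_toArray_pairsOne {n : ℕ} (D : Finset (Fin n × Fin n)) :
    (limitLaw Γ : Measure (PosetOn ℕ)).map PosetOn.toArray (BoolArray.pairsOne D) =
      (limitLaw Γ : Measure (PosetOn ℕ)) ((fun R => R.comap Fin.val) ⁻¹' pairsEvent D) := by
  rw [Measure.map_apply measurable_toArray (BoolArray.measurableSet_pairsOne D),
    toArray_preimage_pairsOne, ← Measure.map_apply (PosetOn.measurable_comap _)
      (measurableSet_comap_pairsEvent D), (hasDensities_limitLaw Γ).map_comap
      (Equiv.natSumNatEquivNat.injective.comp Sum.inr_injective)]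

theorem map_toArray_base_inter_pairsOne {n : ℕ} (D : Finset (Fin n × Fin n))
    {C : Set BoolArray.Base} (hC : MeasurableSet C) :
    (limitLaw Γ : Measure (PosetOn ℕ)).map PosetOn.toArray
        (BoolArray.base ⁻¹' C ∩ BoolArray.pairsOne D) =
      (limitLaw Γ : Measure (PosetOn ℕ)).map PosetOn.toArray (BoolArray.base ⁻¹' C) *
        (limitLaw Γ : Measure (PosetOn ℕ)).map PosetOn.toArray (BoolArray.pairsOne D) := by
  have hC' := BoolArray.measurable_base hC
  have hD := BoolArray.measurableSet_pairsOne D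
  rw [Measure.map_apply measurable_toArray (hC'.inter hD), Measure.map_apply measurable_toArray hC',
    Measure.map_apply measurable_toArray hD, Set.preimage_inter, toArray_preimage_base,
    toArray_preimage_pairsOne]
  exact ((hasDensities_limitLaw Γ).indepFun
    Equiv.natSumNatEquivNat.injective).measure_inter_preimage_eq_mul _ _
    (measurable_subtype_coe hC) (measurableSet_comap_pairsEvent D)

/-- The points of the kernel are moved to `ℝ`, where Besicovitch's density theorem applies. -/
theorem exists_isKernelOf_limitLaw (Γ : PosetLimit) :
    ∃ (μ : Measure ℝ) (_ : IsProbabilityMeasure μ) (w : ℝ × ℝ → unitInterval),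
      Measurable w ∧ IsKernelOf (limitLaw Γ : Measure (PosetOn ℕ)) μ w := by
  have := Measure.isProbabilityMeasure_map (μ := (limitLaw Γ : Measure (PosetOn ℕ)))
    measurable_toArray.aemeasurable
  obtain ⟨μ, hμ, w, hw, hw1, h⟩ := (isExchangeable_toArray (Γ := Γ)).exists_kernel
    fun n D C hC => map_toArray_base_inter_pairsOne D hC
  let f := embeddingReal BoolArray.PointType
  have hf : MeasurableEmbedding f := measurableEmbedding_embeddingReal _
  obtain ⟨g, hg, hgf⟩ := hf.exists_measurable_extend measurable_id fun _ => inferInstance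
  have leftInverse : ∀ x, g (f x) = x := fun x => congrFun hgf x
  let w' : ℝ × ℝ → unitInterval := fun p => ⟨(w (g p.1, g p.2)).toReal, ENNReal.toReal_nonneg,
    ENNReal.toReal_le_of_le_ofReal zero_le_one (by simpa using hw1 _)⟩
  have hw' : Measurable w' :=
    Measurable.subtype_mk
      (hw.comp (f := fun p : ℝ × ℝ => (g p.1, g p.2)) (by fun_prop)).ennreal_toReal
  refine ⟨μ.map f, Measure.isProbabilityMeasure_map hf.measurable.aemeasurable, w', hw',
    fun n D hD => ?_⟩
  have hfn : Measurable fun (x : Fin n → BoolArray.PointType) i => f (x i) :=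
    measurable_pi_lambda _ fun i => hf.measurable.comp (measurable_pi_apply i)
  rw [← Measure.pi_map_pi (μ := fun _ : Fin n => μ) (f := fun _ => f)
    fun _ => hf.measurable.aemeasurable, lintegral_map (IsKernelOf.measurable_prod hw' D) hfn,
    ← map_toArray_pairsOne, ← h n D hD]
  refine lintegral_congr fun x => Finset.prod_congr rfl fun p _ => ?_
  simp only [w', leftInverse]
  exact ENNReal.ofReal_toReal ((hw1 _).trans_lt ENNReal.one_lt_top).ne

end limitLaw

theorem IsKernelOf.exists_posetKernel {μ : Measure ℝ} [IsProbabilityMeasure μ]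
    {w : ℝ × ℝ → unitInterval} {Γ : ProperPosetLimit}
    (h : IsKernelOf (limitLaw Γ.1 : Measure (PosetOn ℕ)) μ w) (hw : Measurable w)
    (hself : ∀ x, w (x, x) = 0)
    (htrans : ∀ x y z, 0 < w (x, y) → 0 < w (y, z) → w (x, z) = 1) :
    ∃ (S : OrderedProbabilitySpace.{0}) (K : PosetKernel S), K.Represents Γ := by
  let S : OrderedProbabilitySpace.{0} :=
    { carrier := ℝ
      μ := μ
      lt := fun x y => 0 < w (x, y)
      lt_irrefl := fun x hx => hx.ne' (hself x)
      lt_trans := fun x y z hxy hyz => (htrans x y z hxy hyz).symm ▸ zero_lt_one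
      measurableSet_lt := measurableSet_lt measurable_const hw }
  let K : PosetKernel S := ⟨fun x y => w (x, y), hw, fun x y hxy => hxy, htrans⟩
  refine ⟨S, K, PosetKernel.represents_iff.2 fun n Q => ?_⟩
  rw [← (hasDensities_limitLaw Γ.1).real_embEvent Q Fin.val_injective,
    embEvent_eq_preimage_pairsEvent, measureReal_def, ← h (n + 1) _ Q.isOriented_ltPairs]

theorem exists_posetKernel (Γ : ProperPosetLimit) :
    ∃ (S : OrderedProbabilitySpace.{0}) (K : PosetKernel S), K.Represents Γ := by
  obtain ⟨μ, hμ, w, hw, h⟩ := exists_isKernelOf_limitLaw Γ.1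
  exact (h.congr_ae (regularVersion_ae_eq hw)).exists_posetKernel (measurable_regularVersion hw)
    (regularVersion_self hw (h.ae_acyclic hw))
    fun x y z => regularVersion_trans hw (h.ae_trans hw)

theorem pInftyLaw_eq_limitLaw (Γ : ProperPosetLimit) : pInftyLaw Γ = limitLaw Γ.1 := by
  have h := exists_posetKernel Γ
  rw [pInftyLaw, dif_pos h]
  exact h.choose_spec.choose_spec.hasDensities.eq_limitLaw

/-! ### Proper limits and induced densities -/

theorem FinPoset.size_pos (P : FinPoset) : 0 < P.size := by
  obtain ⟨n, p, rfl⟩ := P.exists_rep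
  rw [FinPoset.size_unlabelled]
  exact Fintype.card_pos

theorem FinPoset.finite_size_le (N : ℕ) : {P : FinPoset | P.size ≤ N}.Finite := by
  refine Set.Finite.subset (Set.finite_iUnion fun n : Fin (N + 1) =>
    Set.finite_range fun p : PosetOn (Fin ((n : ℕ) + 1)) => p.unlabelled) fun P hP => ?_
  obtain ⟨n, p, rfl⟩ := P.exists_rep
  have hn : p.unlabelled.size ≤ N := hP
  rw [FinPoset.size_unlabelled, Fintype.card_fin] at hn
  exact Set.mem_iUnion.2 ⟨⟨n, by omega⟩, p, rfl⟩

/-- The continuous extension of `|P|⁻¹` to the space of poset limits; it vanishes exactly at the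
proper limits. -/
def PosetLimit.invSize (Γ : PosetLimit) : ℝ := Γ.1.2

theorem PosetLimit.invSize_mem (Γ : PosetLimit) : Γ.invSize ∈ unitInterval := Γ.1.2.2

theorem PosetLimit.continuous_invSize : Continuous PosetLimit.invSize :=
  continuous_subtype_val.comp (continuous_snd.comp continuous_subtype_val)

theorem FinPoset.invSize_toLimit (P : FinPoset) : P.toLimit.invSize = (P.size : ℝ)⁻¹ := rfl

theorem isOpen_lt_invSize (a : ℝ) : IsOpen {Γ : PosetLimit | a < Γ.invSize} :=
  isOpen_lt continuous_const PosetLimit.continuous_invSize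

theorem finite_range_toLimit_inter {a : ℝ} (ha : 0 < a) :
    (Set.range FinPoset.toLimit ∩ {Γ | a < Γ.invSize}).Finite := by
  refine ((FinPoset.finite_size_le ⌊a⁻¹⌋₊).image FinPoset.toLimit).subset ?_
  rintro _ ⟨⟨P, rfl⟩, hP⟩
  have hsize : a < (P.size : ℝ)⁻¹ := hP
  exact ⟨P, Nat.le_floor ((le_inv_comm₀ ha (Nat.cast_pos.2 P.size_pos)).1 hsize.le), rfl⟩

theorem mem_range_toLimit_iff (Γ : PosetLimit) :
    Γ ∈ Set.range FinPoset.toLimit ↔ Γ.invSize ≠ 0 := by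
  constructor
  · rintro ⟨P, rfl⟩
    exact inv_ne_zero (Nat.cast_ne_zero.2 P.size_pos.ne')
  · intro h
    have hpos : 0 < Γ.invSize := Γ.invSize_mem.1.lt_of_ne' h
    have mem_closure :
        Γ ∈ closure (Set.range FinPoset.toLimit ∩ {Γ' | Γ.invSize / 2 < Γ'.invSize}) := by
      rw [Set.inter_comm]
      exact (isOpen_lt_invSize _).inter_closure ⟨half_lt_self hpos, denseRange_toLimit Γ⟩
    rw [(finite_range_toLimit_inter (half_pos hpos)).isClosed.closure_eq] at mem_closure
    exact mem_closure.1

theorem notMem_range_toLimit_iff (Γ : PosetLimit) :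
    Γ ∉ Set.range FinPoset.toLimit ↔ Γ.invSize = 0 := by
  rw [mem_range_toLimit_iff, not_not]

theorem isClosed_proper : IsClosed {Γ : PosetLimit | Γ ∉ Set.range FinPoset.toLimit} := by
  simp only [notMem_range_toLimit_iff]
  exact isClosed_eq PosetLimit.continuous_invSize continuous_const

theorem comap_toLimit_neBot (Γ : PosetLimit) : (comap FinPoset.toLimit (𝓝 Γ)).NeBot :=
  comap_neBot fun _ ht => denseRange_toLimit.mem_nhds ht

section counting

variable {V U : Type*}

/-- Conditioning on `t` changes the probability of `s` by at most the probability of `tᶜ`. -/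
theorem abs_ncard_inter_div_sub_le {α : Type*} [Finite α] [Nonempty α] (s t : Set α) :
    |((s ∩ t).ncard : ℝ) / t.ncard - s.ncard / Nat.card α| ≤ tᶜ.ncard / Nat.card α := by
  have hα : (0 : ℝ) < Nat.card α := Nat.cast_pos.2 Nat.card_pos
  have card_t : (t.ncard : ℝ) + tᶜ.ncard = Nat.card α := mod_cast t.ncard_add_ncard_compl
  have card_s : ((s ∩ t).ncard : ℝ) + (s \ t).ncard = s.ncard :=
    mod_cast Set.ncard_inter_add_ncard_sdiff_eq_ncard s t
  have inter_le : ((s ∩ t).ncard : ℝ) ≤ t.ncard :=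
    mod_cast Set.ncard_le_ncard Set.inter_subset_right
  have sdiff_le : ((s \ t).ncard : ℝ) ≤ tᶜ.ncard :=
    mod_cast Set.ncard_le_ncard fun x hx => hx.2
  have cond_sub : ((s ∩ t).ncard : ℝ) / t.ncard - (s ∩ t).ncard / Nat.card α =
      (s ∩ t).ncard / t.ncard * (tᶜ.ncard / Nat.card α) := by
    rcases t.eq_empty_or_nonempty with rfl | ht
    · simp
    · have : (t.ncard : ℝ) ≠ 0 := Nat.cast_ne_zero.2 ((Set.ncard_pos t.toFinite).2 ht).ne'
      rw [← card_t] at hα ⊢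
      field_simp
      ring
  have cond_le_one : ((s ∩ t).ncard : ℝ) / t.ncard ≤ 1 := div_le_one_of_le₀ inter_le (by positivity)
  rw [← card_s, add_div, ← sub_sub, cond_sub]
  exact abs_sub_le_of_nonneg_of_le (by positivity)
    (mul_le_of_le_one_left (by positivity) cond_le_one) (by positivity) (by gcongr)

theorem ncard_apply_eq_mul_le [Finite V] [Finite U] {i j : V} (hij : i ≠ j) :
    {f : V → U | f i = f j}.ncard * Nat.card U ≤ Nat.card (V → U) := by
  classical
  rw [← Nat.card_coe_set_eq, ← Nat.card_prod]
  refine Nat.card_le_card_of_injective (fun q => Function.update q.1.1 j q.2) ?_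
  rintro ⟨⟨f, hf⟩, u⟩ ⟨⟨g, hg⟩, v⟩ h
  have apply_eq : ∀ x, x ≠ j → f x = g x := fun x hx => by simpa [hx] using congrFun h x
  have hfg : f = g := by
    ext x
    by_cases hx : x = j
    · exact hx ▸ hf.symm.trans ((apply_eq i hij).trans hg)
    · exact apply_eq x hx
  have huv : u = v := by simpa using congrFun h j
  subst hfg huv
  rfl

theorem ncard_injective_compl_div_le (V U : Type*) [Finite V] [Finite U] [Nonempty U] :
    ({f : V → U | f.Injective}ᶜ.ncard : ℝ) / Nat.card (V → U) ≤
      (Nat.card V : ℝ) ^ 2 / Nat.card U := by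
  classical
  cases nonempty_fintype V
  rw [div_le_div_iff₀ (Nat.cast_pos.2 Nat.card_pos) (Nat.cast_pos.2 Nat.card_pos)]
  norm_cast
  let pairs : Finset (V × V) := {p | p.1 ≠ p.2}
  have compl_subset : {f : V → U | f.Injective}ᶜ ⊆ ⋃ p ∈ pairs, {f : V → U | f p.1 = f p.2} := by
    intro f hf
    simp only [Set.mem_compl_iff, Set.mem_ofPred_eq, Function.Injective, not_forall] at hf
    obtain ⟨i, j, hij, hne⟩ := hf
    exact Set.mem_biUnion (x := (i, j)) (by simp [pairs, hne]) hij
  calc _ ≤ (∑ p ∈ pairs, {f : V → U | f p.1 = f p.2}.ncard) * Nat.card U :=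
        Nat.mul_le_mul_right _ ((Set.ncard_le_ncard compl_subset).trans
          (Finset.set_ncard_biUnion_le _ _))
    _ ≤ ∑ _p ∈ pairs, Nat.card (V → U) := by
      rw [Finset.sum_mul]
      exact Finset.sum_le_sum fun p hp => ncard_apply_eq_mul_le (Finset.mem_filter.1 hp).2
    _ ≤ _ := by
      rw [Finset.sum_const, smul_eq_mul]
      refine Nat.mul_le_mul_right _ ((Finset.card_filter_le _ _).trans ?_)
      rw [Finset.card_univ, Fintype.card_prod, sq, Nat.card_eq_fintype_card]

theorem PosetOn.comap_eq_iff {p : PosetOn U} {q : PosetOn V} {f : V → U} :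
    p.comap f = q ↔ ∀ x y, q.lt x y ↔ p.lt (f x) (f y) := by
  rw [Subtype.ext_iff, funext_iff]
  exact forall_congr' fun x => funext_iff.trans <| forall_congr' fun y =>
    eq_comm.trans Bool.eq_iff_iff

theorem PosetOn.comap_injective {f : V → U} (hf : f.Surjective) :
    Function.Injective fun p : PosetOn U => p.comap f := fun p p' h => by
  refine Subtype.ext (funext fun x => funext fun y => ?_)
  obtain ⟨x, rfl⟩ := hf x
  obtain ⟨y, rfl⟩ := hf y
  exact congrFun (congrFun (congrArg Subtype.val h) x) y

theorem PosetOn.indDensity_eq_ncard_div (q : PosetOn V) (p : PosetOn U) :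
    q.indDensity p = (({f | p.comap f = q} ∩ {f | f.Injective}).ncard : ℝ) /
      {f : V → U | f.Injective}.ncard := by
  rw [PosetOn.indDensity, ← Nat.card_coe_set_eq, ← Nat.card_coe_set_eq]
  congr 2
  · exact Nat.card_congr ⟨fun f => ⟨f.1, PosetOn.comap_eq_iff.2 f.2, f.1.injective⟩,
      fun f => ⟨⟨f.1, f.2.2⟩, PosetOn.comap_eq_iff.1 f.2.1⟩, fun _ => rfl, fun _ => rfl⟩
  · exact Nat.card_congr (Equiv.subtypeInjectiveEquivEmbedding V U).symm

theorem PosetOn.abs_indDensity_sub_le [Finite V] [Finite U] [Nonempty U]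
    (q : PosetOn V) (p : PosetOn U) :
    |q.indDensity p - ({f | p.comap f = q}.ncard : ℝ) / Nat.card (V → U)| ≤
      (Nat.card V : ℝ) ^ 2 / Nat.card U := by
  rw [PosetOn.indDensity_eq_ncard_div]
  exact (abs_ncard_inter_div_sub_le _ _).trans (ncard_injective_compl_div_le V U)

end counting

theorem FinPoset.exists_rep_finset (P : FinPoset) :
    ∃ (A : Finset ℕ) (_ : Nonempty A) (p : PosetOn A), p.unlabelled = P := by
  obtain ⟨n, p, rfl⟩ := P.exists_rep
  let e : Finset.range (n + 1) ≃ Fin (n + 1) := Fintype.equivFinOfCardEq (by simp)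
  have : Nonempty (Finset.range (n + 1)) := e.nonempty
  exact ⟨_, this, p.comap e, PosetOn.unlabelled_eq_of_iso (p.iso_comap e)⟩

theorem isClopen_restrictEvent {A : Finset ℕ} (Q : PosetOn A) : IsClopen (restrictEvent Q) := by
  have eq_iInter : restrictEvent Q = ⋂ p : A × A, {R : PosetOn ℕ | R.1 p.1 p.2 = Q.1 p.1 p.2} := by
    ext R
    simp only [restrictEvent, Set.mem_iInter, Prod.forall, Set.mem_ofPred_eq, Subtype.ext_iff,
      funext_iff]
    rfl
  rw [eq_iInter]
  exact isClopen_iInter_of_finite fun p =>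
    (isClopen_discrete {Q.1 p.1 p.2}).preimage (PosetOn.continuous_apply (p.1 : ℕ) (p.2 : ℕ))

theorem measurableSet_restrictEvent {A : Finset ℕ} (Q : PosetOn A) :
    MeasurableSet (restrictEvent Q) :=
  (isClopen_restrictEvent Q).2.measurableSet

theorem sampleLaw_real_restrictEvent {n : ℕ} (p : PosetOn (Fin (n + 1))) {A : Finset ℕ}
    (q : PosetOn A) : (sampleLaw p).real (restrictEvent q) =
      ({f : A → Fin (n + 1) | p.comap f = q}.ncard : ℝ) / Nat.card (A → Fin (n + 1)) :=
  sampleLaw_real_restrict p A (s := {q}) (measurableSet_restrictEvent q)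

theorem abs_tInd_sub_le {A : Finset ℕ} [Nonempty A] (q : PosetOn A) (P : FinPoset) :
    |FinPoset.tInd q.unlabelled P -
        (limitLaw P.toLimit : Measure (PosetOn ℕ)).real (restrictEvent q)| ≤
      (Nat.card A : ℝ) ^ 2 * P.toLimit.invSize := by
  obtain ⟨n, p, rfl⟩ := P.exists_rep
  have := q.abs_indDensity_sub_le p
  rwa [Nat.card_eq_fintype_card (α := Fin (n + 1)), div_eq_mul_inv (_ ^ 2),
    ← FinPoset.size_unlabelled p, ← FinPoset.invSize_toLimit, ← FinPoset.tInd_unlabelled,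
    ← sampleLaw_real_restrictEvent, (hasDensities_sampleLaw p).eq_limitLaw] at this

theorem tendsto_tInd_of_proper {A : Finset ℕ} [Nonempty A] (q : PosetOn A) {Γ : PosetLimit}
    (hΓ : Γ ∉ Set.range FinPoset.toLimit) :
    Tendsto (FinPoset.tInd q.unlabelled) (comap FinPoset.toLimit (𝓝 Γ))
      (𝓝 ((limitLaw Γ : Measure (PosetOn ℕ)).real (restrictEvent q))) := by
  have tendsto_law : Tendsto (fun P : FinPoset =>
      (limitLaw P.toLimit : Measure (PosetOn ℕ)).real (restrictEvent q))
      (comap FinPoset.toLimit (𝓝 Γ))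
      (𝓝 ((limitLaw Γ : Measure (PosetOn ℕ)).real (restrictEvent q))) :=
    (((continuous_probabilityMeasure_real (isClopen_restrictEvent q)).comp
      continuous_limitLaw).tendsto Γ).comp tendsto_comap
  have tendsto_bound : Tendsto (fun P : FinPoset => (Nat.card A : ℝ) ^ 2 * P.toLimit.invSize)
      (comap FinPoset.toLimit (𝓝 Γ)) (𝓝 0) := by
    have := (((PosetLimit.continuous_invSize.const_mul ((Nat.card A : ℝ) ^ 2)).tendsto Γ).comp
      (tendsto_comap (f := FinPoset.toLimit)))
    rwa [(notMem_range_toLimit_iff Γ).1 hΓ, mul_zero] at this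
  simpa using (squeeze_zero_norm (fun P => abs_tInd_sub_le q P) tendsto_bound).add tendsto_law

theorem ncard_comap_eq_congr {n : ℕ} {p p' : PosetOn (Fin (n + 1))}
    (h : p.unlabelled.toLimit = p'.unlabelled.toLimit) {V : Type*} [Finite V] (q : PosetOn V) :
    {f | p.comap f = q}.ncard = {f | p'.comap f = q}.ncard := by
  cases nonempty_fintype V
  let e : Finset.range (Fintype.card V) ≃ V := Fintype.equivOfCardEq (by simp)
  have transport (p : PosetOn (Fin (n + 1))) :
      {f | p.comap f = q}.ncard = {f | p.comap f = q.comap e}.ncard := by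
    refine Set.ncard_congr' ((e.arrowCongr (Equiv.refl _)).symm.subtypeEquiv fun f => ?_)
    exact (PosetOn.comap_injective e.surjective).eq_iff.symm
  have law_eq : sampleLaw p = sampleLaw p' := by
    rw [(hasDensities_sampleLaw p).eq_limitLaw, (hasDensities_sampleLaw p').eq_limitLaw, h]
  have prob_eq := sampleLaw_real_restrictEvent p (q.comap e)
  rw [law_eq, sampleLaw_real_restrictEvent,
    div_left_inj' (Nat.cast_ne_zero.2 Nat.card_pos.ne')] at prob_eq
  rw [transport p, transport p', Nat.cast_injective prob_eq]

section inducedMaps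

variable {V U : Type*}

/-- The maps that pull `p` back to `q` and identify exactly the points equivalent under `θ`; for
`θ = ⊥` these are the induced embeddings of `q` into `p`. -/
def inducedMaps (q : PosetOn V) (p : PosetOn U) (θ : Setoid V) : Set (V → U) :=
  {f | p.comap f = q ∧ Setoid.ker f = θ}

theorem inducedMaps_bot (q : PosetOn V) (p : PosetOn U) :
    inducedMaps q p ⊥ = {f | p.comap f = q} ∩ {f | f.Injective} := by
  ext f
  simp only [inducedMaps, Setoid.ker_eq_bot_iff, Set.mem_ofPred_eq, Set.mem_inter_iff]

theorem ncard_inducedMaps_comap_mk (θ : Setoid V) (q : PosetOn (Quotient θ)) (p : PosetOn U) :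
    (inducedMaps (q.comap (Quotient.mk θ)) p θ).ncard = (inducedMaps q p ⊥).ncard := by
  have image_eq : inducedMaps (q.comap (Quotient.mk θ)) p θ =
      (· ∘ Quotient.mk θ) '' inducedMaps q p ⊥ := by
    ext f
    constructor
    · rintro ⟨hq, hθ⟩
      let g : Quotient θ → U := Quotient.lift f fun a b hab => by rwa [← Setoid.ker_def, hθ]
      have hg : p.comap g = q := PosetOn.comap_injective Quotient.mk_surjective hq
      refine ⟨g, ⟨hg, ?_⟩, rfl⟩
      refine Setoid.ker_eq_bot_iff.2 (Quotient.ind₂ fun a b hab => Quotient.sound ?_)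
      exact hθ ▸ hab
    · rintro ⟨g, ⟨rfl, hg⟩, rfl⟩
      refine ⟨rfl, Setoid.ext fun a b => ?_⟩
      exact ((Setoid.ker_eq_bot_iff.1 hg).eq_iff).trans Quotient.eq
  rw [image_eq, Set.ncard_image_of_injective _ Quotient.mk_surjective.injective_comp_right]

theorem inducedMaps_eq_empty {q : PosetOn V} {θ : Setoid V}
    (hq : ¬∃ q' : PosetOn (Quotient θ), q'.comap (Quotient.mk θ) = q) (p : PosetOn U) :
    inducedMaps q p θ = ∅ := by
  rw [Set.eq_empty_iff_forall_notMem]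
  rintro f ⟨rfl, rfl⟩
  exact hq ⟨p.comap (Quotient.lift f fun _ _ hab => hab), rfl⟩

theorem ncard_comap_eq_sum_inducedMaps [Finite V] [Finite U] [Fintype (Setoid V)]
    (q : PosetOn V) (p : PosetOn U) :
    {f | p.comap f = q}.ncard = ∑ θ, (inducedMaps q p θ).ncard := by
  simp only [← Nat.card_coe_set_eq]
  rw [← Nat.card_sigma]
  exact Nat.card_congr ⟨fun f => ⟨Setoid.ker f.1, f.1, f.2, rfl⟩, fun f => ⟨f.2.1, f.2.2.1⟩,
    fun _ => rfl, fun ⟨_, _, _, hθ⟩ => by subst hθ; rfl⟩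

theorem card_quotient_lt [Finite V] {θ : Setoid V} (hθ : θ ≠ ⊥) :
    Nat.card (Quotient θ) < Nat.card V := by
  cases nonempty_fintype V
  classical
  rw [Nat.card_eq_fintype_card, Nat.card_eq_fintype_card]
  refine Fintype.card_lt_of_surjective_not_injective (Quotient.mk θ) Quotient.mk_surjective
    fun inj => hθ (le_bot_iff.1 fun a b hab => inj (Quotient.sound hab))

end inducedMaps

/-- Every map is an embedding of a quotient, so the numbers of all maps that pull `p` back to the
various `q` determine the numbers of induced embeddings. -/
theorem ncard_inducedMaps_bot_congr {n : ℕ} {p p' : PosetOn (Fin (n + 1))}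
    (h : p.unlabelled.toLimit = p'.unlabelled.toLimit) {V : Type*} [Finite V] (q : PosetOn V) :
    (inducedMaps q p ⊥).ncard = (inducedMaps q p' ⊥).ncard := by
  classical
  induction hk : Nat.card V using Nat.strong_induction_on generalizing V with
  | _ k ih =>
  have : Finite (Setoid V) := Finite.of_injective (fun θ : Setoid V => θ.r) fun θ θ' hr =>
    Setoid.ext fun a b => iff_of_eq (congrFun (congrFun hr a) b)
  cases nonempty_fintype (Setoid V)
  have noninjective_congr (θ : Setoid V) (hθ : θ ≠ ⊥) :
      (inducedMaps q p θ).ncard = (inducedMaps q p' θ).ncard := by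
    by_cases hq : ∃ q' : PosetOn (Quotient θ), q'.comap (Quotient.mk θ) = q
    · obtain ⟨q', rfl⟩ := hq
      rw [ncard_inducedMaps_comap_mk, ncard_inducedMaps_comap_mk]
      exact ih _ (hk ▸ card_quotient_lt hθ) q' rfl
    · rw [inducedMaps_eq_empty hq, inducedMaps_eq_empty hq]
  have total_congr := ncard_comap_eq_congr h q
  rw [ncard_comap_eq_sum_inducedMaps, ncard_comap_eq_sum_inducedMaps,
    ← Finset.add_sum_erase _ _ (Finset.mem_univ ⊥), ← Finset.add_sum_erase _ _ (Finset.mem_univ ⊥),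
    Finset.sum_congr rfl fun θ hθ => noninjective_congr θ (Finset.ne_of_mem_erase hθ)]
    at total_congr
  exact Nat.add_right_cancel total_congr

theorem FinPoset.tInd_eq_of_toLimit_eq {P P' : FinPoset} (h : P.toLimit = P'.toLimit)
    (Q : FinPoset) : FinPoset.tInd Q P = FinPoset.tInd Q P' := by
  have size_eq := congrArg PosetLimit.invSize h
  rw [FinPoset.invSize_toLimit, FinPoset.invSize_toLimit, inv_inj, Nat.cast_inj] at size_eq
  obtain ⟨n, p, rfl⟩ := P.exists_rep
  obtain ⟨n', p', rfl⟩ := P'.exists_rep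
  obtain ⟨m, q, rfl⟩ := Q.exists_rep
  obtain rfl : n = n' := by simpa [FinPoset.size_unlabelled] using size_eq
  rw [FinPoset.tInd_unlabelled, FinPoset.tInd_unlabelled, PosetOn.indDensity_eq_ncard_div,
    PosetOn.indDensity_eq_ncard_div, ← inducedMaps_bot, ← inducedMaps_bot,
    ncard_inducedMaps_bot_congr h]

theorem tendsto_tInd_toLimit (Q P : FinPoset) :
    Tendsto (FinPoset.tInd Q) (comap FinPoset.toLimit (𝓝 P.toLimit)) (𝓝 (FinPoset.tInd Q P)) := by
  have hpos : 0 < P.toLimit.invSize := by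
    rw [FinPoset.invSize_toLimit]
    exact inv_pos.2 (Nat.cast_pos.2 P.size_pos)
  have finite_ne := (finite_range_toLimit_inter (half_pos hpos)).subset
    (Set.sdiff_subset (t := {P.toLimit}))
  have isolated : ∀ᶠ Γ in 𝓝 P.toLimit, Γ ∈ Set.range FinPoset.toLimit → Γ = P.toLimit := by
    filter_upwards [finite_ne.isClosed.isOpen_compl.mem_nhds (x := P.toLimit) (by simp),
      (isOpen_lt_invSize _).mem_nhds (x := P.toLimit) (half_lt_self hpos)] with Γ notMem lt_size mem
    by_contra hne
    exact notMem ⟨⟨mem, lt_size⟩, hne⟩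
  refine tendsto_const_nhds.congr' ?_
  filter_upwards [isolated.comap FinPoset.toLimit] with P' hP'
  exact FinPoset.tInd_eq_of_toLimit_eq (hP' ⟨P', rfl⟩).symm Q

theorem PosetLimit.continuous_tInd (Q : FinPoset) : Continuous (PosetLimit.tInd Q) := by
  let _ : TopologicalSpace FinPoset := .induced FinPoset.toLimit inferInstance
  have di : IsDenseInducing FinPoset.toLimit := ⟨⟨rfl⟩, denseRange_toLimit⟩
  refine di.continuous_extend fun Γ => ?_
  by_cases hΓ : Γ ∈ Set.range FinPoset.toLimit
  · obtain ⟨P, rfl⟩ := hΓ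
    exact ⟨_, tendsto_tInd_toLimit Q P⟩
  · obtain ⟨A, hA, q, rfl⟩ := Q.exists_rep_finset
    exact ⟨_, tendsto_tInd_of_proper q hΓ⟩

theorem PosetLimit.tInd_toLimit (Q P : FinPoset) :
    PosetLimit.tInd Q P.toLimit = FinPoset.tInd Q P :=
  have := comap_toLimit_neBot P.toLimit
  (tendsto_tInd_toLimit Q P).limUnder_eq

theorem PosetLimit.tInd_eq_of_proper {A : Finset ℕ} [Nonempty A] (q : PosetOn A) {Γ : PosetLimit}
    (hΓ : Γ ∉ Set.range FinPoset.toLimit) :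
    PosetLimit.tInd q.unlabelled Γ =
      (limitLaw Γ : Measure (PosetOn ℕ)).real (restrictEvent q) :=
  have := comap_toLimit_neBot Γ
  (tendsto_tInd_of_proper q hΓ).limUnder_eq

/-! ### Convergence of the initial segments -/

theorem invSize_initialSegment (n : ℕ) (R : PosetOn ℕ) :
    (initialSegment n R).invSize = 1 / ((n : ℝ) + 1) := by
  rw [initialSegment, FinPoset.invSize_toLimit, FinPoset.size_unlabelled, Fintype.card_fin,
    one_div, Nat.cast_succ]

theorem measurable_initialSegment (n : ℕ) : Measurable (initialSegment n) := by
  have : Measurable fun p : PosetOn (Fin (n + 1)) => p.unlabelled.toLimit :=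
    measurable_of_countable _
  exact this.comp (PosetOn.measurable_comap _)

theorem integrable_t (Q : FinPoset) {Ω : Type*} [MeasurableSpace Ω] {P : Measure Ω}
    [IsFiniteMeasure P] {X : Ω → PosetLimit} (hX : Measurable X) :
    Integrable (fun ω => PosetLimit.t Q (X ω)) P := by
  refine Integrable.of_bound ((PosetLimit.continuous_t Q).measurable.comp hX).aestronglyMeasurable 1
    (ae_of_all _ fun ω => ?_)
  rw [Real.norm_of_nonneg (PosetLimit.t_mem Q _).1]
  exact (PosetLimit.t_mem Q _).2

theorem abs_sum_div_card_sub_le {α : Type*} [Fintype α] [Nonempty α] {a : α → ℝ} {c : ℝ}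
    (ha : ∀ x, a x ∈ unitInterval) (hc : c ∈ unitInterval) {s : Set α} (hs : ∀ x ∈ s, a x = c) :
    |(∑ x, a x) / Nat.card α - c| ≤ (sᶜ.ncard : ℝ) / Nat.card α := by
  classical
  have hα : (0 : ℝ) < Nat.card α := Nat.cast_pos.2 Nat.card_pos
  have sub_eq : (∑ x, a x) / Nat.card α - c = (∑ x, (a x - c)) / Nat.card α := by
    rw [Finset.sum_sub_distrib, Finset.sum_const, nsmul_eq_mul, Finset.card_univ,
      ← Nat.card_eq_fintype_card, sub_div, mul_div_cancel_left₀ _ hα.ne']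
  rw [sub_eq, abs_div, abs_of_pos hα]
  gcongr
  calc |∑ x, (a x - c)| ≤ ∑ x, |a x - c| := Finset.abs_sum_le_sum_abs _ _
    _ ≤ ∑ x, if x ∈ sᶜ then (1 : ℝ) else 0 := Finset.sum_le_sum fun x _ => by
      by_cases hx : x ∈ s
      · simp [hs x hx, hx]
      · simpa [hx] using abs_sub_le_of_nonneg_of_le (ha x).1 (ha x).2 hc.1 hc.2
    _ = sᶜ.ncard := by
      rw [Finset.sum_boole, ← Set.ncard_coe_finset, Finset.coe_filter_univ]
      rfl

theorem tendsto_div_pow_of_tendsto_sq {H : ℕ → ℝ} (hH : Monotone H) (hnonneg : ∀ n, 0 ≤ H n)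
    (k : ℕ) {t : ℝ} (ht : Tendsto (fun m : ℕ => H (m ^ 2) / ((m ^ 2 : ℕ) : ℝ) ^ k) atTop (𝓝 t)) :
    Tendsto (fun n : ℕ => H n / (n : ℝ) ^ k) atTop (𝓝 t) := by
  let s : ℕ → ℝ := fun m => ((m ^ 2 : ℕ) : ℝ) ^ k
  have hs {m : ℕ} (hm : m ≠ 0) : s m ≠ 0 := by positivity
  have ratio : Tendsto (fun m => s m / s (m + 1)) atTop (𝓝 1) := by
    have := (tendsto_natCast_div_add_atTop (𝕜 := ℝ) 1).pow (2 * k)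
    simpa [s, div_pow, pow_mul] using this
  have lower : Tendsto (fun m => H (m ^ 2) / s (m + 1)) atTop (𝓝 t) := by
    refine Tendsto.congr' ?_ (by simpa only [mul_one] using ht.mul ratio)
    filter_upwards [eventually_ne_atTop 0] with m hm
    exact div_mul_div_cancel₀ (hs hm)
  have upper : Tendsto (fun m => H ((m + 1) ^ 2) / s m) atTop (𝓝 t) := by
    refine Tendsto.congr (fun m => ?_)
      (by simpa only [div_one] using ((tendsto_add_atTop_iff_nat 1).2 ht).div ratio one_ne_zero)
    exact div_div_div_cancel_right₀ (hs m.succ_ne_zero) _ _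
  have tendsto_sqrt : Tendsto Nat.sqrt atTop atTop := tendsto_atTop.2 fun b => by
    filter_upwards [eventually_ge_atTop (b * b)] with n hn
    exact Nat.le_sqrt.2 hn
  have le_n (n : ℕ) : n.sqrt ^ 2 ≤ n := Nat.sqrt_le' n
  have n_le (n : ℕ) : n ≤ (n.sqrt + 1) ^ 2 := (Nat.lt_succ_sqrt' n).le
  refine tendsto_of_tendsto_of_tendsto_of_le_of_le' (lower.comp tendsto_sqrt)
    (upper.comp tendsto_sqrt) ?_ ?_ <;>
  filter_upwards [eventually_gt_atTop 0] with n hn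
  · exact div_le_div₀ (hnonneg n) (hH (le_n n)) (by positivity)
      (pow_le_pow_left₀ (by positivity) (mod_cast n_le n) k)
  · have : 0 < n.sqrt := Nat.sqrt_pos.2 hn
    exact div_le_div₀ (hnonneg _) (hH (n_le n)) (by positivity)
      (pow_le_pow_left₀ (by positivity) (mod_cast le_n n) k)

theorem tendsto_homDensity_of_tendsto_sq {V : Type*} [Finite V] (q : PosetOn V) (R : PosetOn ℕ)
    {t : ℝ} (ht : Tendsto (fun m : ℕ => q.homDensity (R.comap fun i : Fin (m ^ 2) => (i : ℕ)))
      atTop (𝓝 t)) :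
    Tendsto (fun n : ℕ => q.homDensity (R.comap fun i : Fin n => (i : ℕ))) atTop (𝓝 t) := by
  cases nonempty_fintype V
  let H : ℕ → ℝ := fun n => Nat.card {f : V → Fin n // ∀ x y, q.lt x y → R.lt (f x) (f y)}
  have density_eq (n : ℕ) : q.homDensity (R.comap fun i : Fin n => (i : ℕ)) =
      H n / (n : ℝ) ^ Fintype.card V := by
    rw [← Nat.cast_pow, ← Nat.card_eq_fintype_card, ← Nat.card_fin n, ← Nat.card_fun, Nat.card_fin]
    rfl
  have mono : Monotone H := fun n n' hn => Nat.cast_le.2 <| Nat.card_le_card_of_injective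
    (fun f => ⟨fun x => Fin.castLE hn (f.1 x), fun x y hxy => f.2 x y hxy⟩)
    fun f g hfg => Subtype.ext <| funext fun x =>
      Fin.castLE_injective hn (congrFun (congrArg Subtype.val hfg) x)
  simp only [density_eq] at ht ⊢
  exact tendsto_div_pow_of_tendsto_sq mono (fun n => Nat.cast_nonneg _) _ ht

section

variable {V : Type*} [Fintype V]

theorem homDensity_comap_eq_sum [DecidableEq V] (q : PosetOn V) (n : ℕ) (R : PosetOn ℕ) :
    q.homDensity (R.comap fun i : Fin (n + 1) => (i : ℕ)) =
      (∑ f : V → Fin (n + 1), (embEvent q fun x => (f x : ℕ)).indicator 1 R) /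
        Nat.card (V → Fin (n + 1)) := by
  classical
  rw [PosetOn.homDensity, Nat.card_eq_fintype_card (α := {f : V → Fin (n + 1) // _}),
    Fintype.card_subtype, ← Finset.sum_boole]
  refine congrArg (· / _) (Finset.sum_congr rfl fun f _ => ?_)
  rw [Set.indicator_apply]
  exact if_congr Iff.rfl rfl rfl

variable [Nonempty V]

theorem t_initialSegment (q : PosetOn V) (n : ℕ) (R : PosetOn ℕ) :
    PosetLimit.t q.unlabelled (initialSegment n R) =
      q.homDensity (R.comap fun i : Fin (n + 1) => (i : ℕ)) :=
  FinPoset.t_unlabelled q _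

variable {ν : Measure (PosetOn ℕ)} [IsProbabilityMeasure ν]

theorem integral_t_initialSegment [DecidableEq V] (q : PosetOn V) (n : ℕ) :
    ∫ R, PosetLimit.t q.unlabelled (initialSegment n R) ∂ν =
      (∑ f : V → Fin (n + 1), ν.real (embEvent q fun x => (f x : ℕ))) /
        Nat.card (V → Fin (n + 1)) := by
  simp only [t_initialSegment, homDensity_comap_eq_sum]
  rw [integral_div, integral_finsetSum]
  · simp only [integral_indicator_one (measurableSet_embEvent q _)]
  · exact fun f _ => (integrable_const (1 : ℝ)).indicator (measurableSet_embEvent q _)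

theorem abs_integral_t_initialSegment_sub_le (q : PosetOn V) {c : ℝ}
    (hc : ∀ ι : V → ℕ, Function.Injective ι → ν.real (embEvent q ι) = c) (n : ℕ) :
    |∫ R, PosetLimit.t q.unlabelled (initialSegment n R) ∂ν - c| ≤
      (Nat.card V : ℝ) ^ 2 / ((n : ℝ) + 1) := by
  classical
  have injective_bound := ncard_injective_compl_div_le V (Fin (n + 1))
  rw [Nat.card_fin, Nat.cast_succ] at injective_bound
  have c_mem : c ∈ unitInterval := by
    rw [← hc _ ((Fintype.equivFin V).toEmbedding.trans Fin.valEmbedding).injective]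
    exact ⟨measureReal_nonneg, measureReal_le_one⟩
  rw [integral_t_initialSegment]
  refine (abs_sum_div_card_sub_le (fun f => ⟨measureReal_nonneg, measureReal_le_one⟩)
    c_mem fun f hf => ?_).trans injective_bound
  exact hc _ (Fin.val_injective.comp hf)

variable {Γ : PosetLimit}

theorem HasDensities.abs_integral_t_initialSegment_sub_le (h : HasDensities ν Γ) (q : PosetOn V)
    (n : ℕ) :
    |∫ R, PosetLimit.t q.unlabelled (initialSegment n R) ∂ν - PosetLimit.t q.unlabelled Γ| ≤
      (Nat.card V : ℝ) ^ 2 / ((n : ℝ) + 1) :=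
  PosetLimits.abs_integral_t_initialSegment_sub_le q (fun _ hι => h.real_embEvent q hι) n

theorem HasDensities.integral_sq_sub_le (h : HasDensities ν Γ) (q : PosetOn V) (n : ℕ) :
    ∫ R, (PosetLimit.t q.unlabelled (initialSegment n R) - PosetLimit.t q.unlabelled Γ) ^ 2 ∂ν ≤
      6 * (Nat.card V : ℝ) ^ 2 / ((n : ℝ) + 1) := by
  set t := PosetLimit.t q.unlabelled Γ
  set mean := ∫ R, PosetLimit.t q.unlabelled (initialSegment n R) ∂ν
  set meanSq := ∫ R, PosetLimit.t (q.sum q).unlabelled (initialSegment n R) ∂ν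
  set ε : ℝ := (Nat.card V : ℝ) ^ 2 / ((n : ℝ) + 1) with hε
  have expand : ∫ R, (PosetLimit.t q.unlabelled (initialSegment n R) - t) ^ 2 ∂ν =
      meanSq - 2 * t * mean + t ^ 2 := by
    have integrable_sum := integrable_t (P := ν) (q.sum q).unlabelled (measurable_initialSegment n)
    have integrable_mul :=
      (integrable_t (P := ν) q.unlabelled (measurable_initialSegment n)).const_mul (2 * t)
    have integrable_sub : Integrable (fun R =>
        PosetLimit.t (q.sum q).unlabelled (initialSegment n R) -
          2 * t * PosetLimit.t q.unlabelled (initialSegment n R)) ν :=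
      integrable_sum.sub integrable_mul
    rw [← integral_const_mul, ← integral_sub integrable_sum integrable_mul,
      ← one_smul ℝ (t ^ 2), ← probReal_univ (μ := ν), ← integral_const,
      ← integral_add integrable_sub (integrable_const _)]
    congr with R
    rw [PosetLimit.t_sum]
    ring
  have mean_ge : t - ε ≤ mean := by
    have := (abs_le.1 (h.abs_integral_t_initialSegment_sub_le q n)).1
    linarith
  have meanSq_le : meanSq ≤ t ^ 2 + 4 * ε := by
    have := (abs_le.1 (h.abs_integral_t_initialSegment_sub_le (q.sum q) n)).2
    rw [PosetLimit.t_sum, Nat.card_sum, Nat.cast_add, ← two_mul, mul_pow, mul_div_assoc, ← hε]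
      at this
    linarith
  have ht : t ∈ unitInterval := PosetLimit.t_mem _ _
  have hε0 : 0 ≤ ε := by positivity
  rw [expand, mul_div_assoc, ← hε]
  nlinarith [mul_le_mul_of_nonneg_left mean_ge ht.1, mul_le_mul_of_nonneg_right ht.2 hε0]

end

theorem ae_tendsto_of_summable_integral_sq_sub {Ω : Type*} [MeasurableSpace Ω] {μ : Measure Ω}
    {X : ℕ → Ω → ℝ} {c : ℝ} (hX : ∀ m, AEMeasurable (X m) μ)
    (hint : ∀ m, Integrable (fun ω => (X m ω - c) ^ 2) μ)
    (hsum : Summable fun m => ∫ ω, (X m ω - c) ^ 2 ∂μ) :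
    ∀ᵐ ω ∂μ, Tendsto (fun m => X m ω) atTop (𝓝 c) := by
  have hmeas (m : ℕ) : AEMeasurable (fun ω => ENNReal.ofReal ((X m ω - c) ^ 2)) μ :=
    (((hX m).sub_const c).pow_const 2).ennreal_ofReal
  have tsum_ne_top : ∫⁻ ω, ∑' m, ENNReal.ofReal ((X m ω - c) ^ 2) ∂μ ≠ ∞ := by
    rw [lintegral_tsum hmeas]
    simp only [← ofReal_integral_eq_lintegral_ofReal (hint _) (ae_of_all _ fun _ => sq_nonneg _)]
    exact hsum.tsum_ofReal_ne_top
  filter_upwards [ae_lt_top' (AEMeasurable.tsum hmeas) tsum_ne_top] with ω hω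
  have sq_tendsto := (ENNReal.tendsto_toReal ENNReal.zero_ne_top).comp
    (ENNReal.tendsto_atTop_zero_of_tsum_ne_top hω.ne)
  simp only [Function.comp_def, ENNReal.toReal_ofReal (sq_nonneg _), ENNReal.toReal_zero]
    at sq_tendsto
  have abs_tendsto := sq_tendsto.sqrt
  simp only [Real.sqrt_sq_eq_abs, Real.sqrt_zero] at abs_tendsto
  exact tendsto_sub_nhds_zero_iff.1 ((tendsto_zero_iff_abs_tendsto_zero _).2 abs_tendsto)

/-- Here `initialSegment (m * (m + 2)) R` has `(m + 1) ^ 2` points. -/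
theorem HasDensities.ae_tendsto_t_sq {ν : Measure (PosetOn ℕ)} [IsProbabilityMeasure ν]
    {Γ : PosetLimit} (h : HasDensities ν Γ) {V : Type*} [Fintype V] [Nonempty V] (q : PosetOn V) :
    ∀ᵐ R ∂ν, Tendsto (fun m : ℕ => PosetLimit.t q.unlabelled (initialSegment (m * (m + 2)) R))
      atTop (𝓝 (PosetLimit.t q.unlabelled Γ)) := by
  have hmeas (n : ℕ) : Measurable fun R => PosetLimit.t q.unlabelled (initialSegment n R) :=
    (PosetLimit.continuous_t _).measurable.comp (measurable_initialSegment n)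
  refine ae_tendsto_of_summable_integral_sq_sub (fun m => (hmeas _).aemeasurable) (fun m => ?_) ?_
  · refine Integrable.of_bound ((hmeas _).sub_const _ |>.pow_const 2).aestronglyMeasurable 1
      (ae_of_all _ fun R => ?_)
    rw [Real.norm_of_nonneg (sq_nonneg _), sq_le_one_iff_abs_le_one]
    exact abs_sub_le_of_nonneg_of_le (PosetLimit.t_mem _ _).1 (PosetLimit.t_mem _ _).2
      (PosetLimit.t_mem _ _).1 (PosetLimit.t_mem _ _).2
  · have summable_bound : Summable fun m : ℕ => 6 * (Nat.card V : ℝ) ^ 2 / ((m : ℝ) + 1) ^ 2 := by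
      have := (summable_nat_add_iff 1).2 (Real.summable_nat_pow_inv.2 one_lt_two)
      simpa only [div_eq_mul_inv, Nat.cast_succ] using this.mul_left (6 * (Nat.card V : ℝ) ^ 2)
    refine summable_bound.of_nonneg_of_le (fun m => integral_nonneg fun R => sq_nonneg _)
      fun m => ?_
    refine (h.integral_sq_sub_le q _).trans_eq ?_
    push_cast
    ring

theorem HasDensities.ae_tendsto_initialSegment {ν : Measure (PosetOn ℕ)} [IsProbabilityMeasure ν]
    {Γ : ProperPosetLimit} (h : HasDensities ν Γ.1) :
    ∀ᵐ R ∂ν, Tendsto (fun n => initialSegment n R) atTop (𝓝 Γ.1) := by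
  have density_tendsto : ∀ᵐ R ∂ν, ∀ Q : FinPoset,
      Tendsto (fun n => PosetLimit.t Q (initialSegment n R)) atTop (𝓝 (PosetLimit.t Q Γ.1)) := by
    refine ae_all_iff.2 fun Q => ?_
    obtain ⟨k, q, rfl⟩ := Q.exists_rep
    filter_upwards [h.ae_tendsto_t_sq q] with R hR
    simp only [t_initialSegment] at hR ⊢
    refine (tendsto_add_atTop_iff_nat 1).2 <| tendsto_homDensity_of_tendsto_sq q R <|
      (tendsto_add_atTop_iff_nat 1).1 <| hR.congr fun m => ?_
    rw [show m * (m + 2) + 1 = (m + 1) ^ 2 by ring]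
  have size_tendsto (R : PosetOn ℕ) :
      Tendsto (fun n => (initialSegment n R).invSize) atTop (𝓝 Γ.1.invSize) := by
    simp only [invSize_initialSegment, (notMem_range_toLimit_iff Γ.1).1 Γ.2]
    exact tendsto_one_div_add_atTop_nhds_zero_nat
  filter_upwards [density_tendsto] with R hR
  rw [tendsto_subtype_rng, Prod.tendsto_iff]
  exact ⟨tendsto_pi_nhds.2 fun Q => tendsto_subtype_rng.2 (hR Q),
    tendsto_subtype_rng.2 (size_tendsto R)⟩

/-! ### Mixtures of the laws `P(∞,Γ)` -/

theorem PosetKernel.Represents.law_eq {S : OrderedProbabilitySpace.{u}} {K : PosetKernel S}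
    {Γ : ProperPosetLimit} (hK : K.Represents Γ) : K.law = pInftyLaw Γ := by
  rw [pInftyLaw_eq_limitLaw]
  exact hK.hasDensities.eq_limitLaw

theorem measurable_pInftyLaw : Measurable pInftyLaw := by
  rw [funext pInftyLaw_eq_limitLaw]
  exact measurable_limitLaw.comp measurable_subtype_coe

instance (Γ : ProperPosetLimit) : IsProbabilityMeasure (pInftyLaw Γ) := by
  rw [pInftyLaw_eq_limitLaw]
  infer_instance

theorem hasDensities_pInftyLaw (Γ : ProperPosetLimit) : HasDensities (pInftyLaw Γ) Γ.1 := by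
  rw [pInftyLaw_eq_limitLaw]
  exact hasDensities_limitLaw Γ.1

theorem pInftyLaw_real_restrictEvent (Γ : ProperPosetLimit) {A : Finset ℕ} [Nonempty A]
    (q : PosetOn A) : (pInftyLaw Γ).real (restrictEvent q) = PosetLimit.tInd q.unlabelled Γ.1 := by
  rw [pInftyLaw_eq_limitLaw, PosetLimit.tInd_eq_of_proper q Γ.2]

/-- The laws `pInftyLaw Γ` as a Markov kernel; `pInftyMixture m` is its composition with `m`. -/
def pInftyKernel : Kernel ProperPosetLimit (PosetOn ℕ) := ⟨pInftyLaw, measurable_pInftyLaw⟩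

instance : IsMarkovKernel pInftyKernel :=
  ⟨fun Γ => inferInstanceAs (IsProbabilityMeasure (pInftyLaw Γ))⟩

section

variable (m : Measure ProperPosetLimit)

theorem pInftyMixture_apply {s : Set (PosetOn ℕ)} (hs : MeasurableSet s) :
    pInftyMixture m s = ∫⁻ Γ, pInftyLaw Γ s ∂m :=
  Measure.bind_apply hs measurable_pInftyLaw.aemeasurable

theorem exchangeable_pInftyMixture : Exchangeable (pInftyMixture m) := by
  intro σ
  ext s hs
  have hσ := PosetOn.measurable_comap σ
  rw [Measure.map_apply hσ hs, pInftyMixture_apply m (hσ hs), pInftyMixture_apply m hs]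
  refine lintegral_congr fun Γ => ?_
  rw [← Measure.map_apply hσ hs, (hasDensities_pInftyLaw Γ).exchangeable σ]

theorem pInftyMixture_real {s : Set (PosetOn ℕ)} (hs : MeasurableSet s) :
    (pInftyMixture m).real s = ∫ Γ, (pInftyLaw Γ).real s ∂m := by
  rw [Measure.real, pInftyMixture_apply m hs]
  exact (integral_toReal ((Measure.measurable_coe hs).comp measurable_pInftyLaw).aemeasurable
    (ae_of_all _ fun Γ => measure_lt_top _ _)).symm

instance [IsProbabilityMeasure m] : IsProbabilityMeasure (pInftyMixture m) :=
  inferInstanceAs (IsProbabilityMeasure (m.bind pInftyKernel))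

theorem integral_pInftyMixture {F : PosetOn ℕ → ℝ} (hF : Integrable F (pInftyMixture m)) :
    ∫ R, F R ∂pInftyMixture m = ∫ Γ, ∫ R, F R ∂pInftyLaw Γ ∂m :=
  Kernel.integral_comp (η := pInftyKernel) (κ := Kernel.const Unit m) (a := ()) hF

variable {A : Finset ℕ} [Nonempty A] (Q : PosetOn A)

theorem pInftyMixture_real_containsEvent :
    (pInftyMixture m).real (containsEvent Q) = ∫ Γ, PosetLimit.t Q.unlabelled Γ.1 ∂m := by
  rw [containsEvent_eq_embEvent, pInftyMixture_real m (measurableSet_embEvent Q _)]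
  exact integral_congr_ae (ae_of_all _ fun Γ => hasDensities_pInftyLaw Γ A Q)

theorem pInftyMixture_real_restrictEvent :
    (pInftyMixture m).real (restrictEvent Q) = ∫ Γ, PosetLimit.tInd Q.unlabelled Γ.1 ∂m := by
  rw [pInftyMixture_real m (measurableSet_restrictEvent Q)]
  simp only [pInftyLaw_real_restrictEvent]

end

theorem measureReal_containsEvent_eq_sum (ν : Measure (PosetOn ℕ)) [IsFiniteMeasure ν]
    {A : Finset ℕ} (Q : PosetOn A) :
    ν.real (containsEvent Q) =
      ∑ᶠ Q' ∈ {Q' : PosetOn A | ∀ x y, Q.lt x y → Q'.lt x y}, ν.real (restrictEvent Q') := by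
  classical
  have eq_biUnion : containsEvent Q =
      ⋃ Q' ∈ {Q' : PosetOn A | ∀ x y, Q.lt x y → Q'.lt x y}.toFinset, restrictEvent Q' := by
    ext R
    simp only [Set.mem_toFinset, Set.mem_iUnion, exists_prop]
    constructor
    · exact fun h => ⟨R.comap fun x : A => (x : ℕ), h, rfl⟩
    · rintro ⟨Q', h, rfl⟩
      exact h
  rw [eq_biUnion, measureReal_biUnion_finset, ← finsum_mem_coe_finset, Set.coe_toFinset]
  · exact fun q _ q' _ hne => Set.disjoint_left.2 fun R hR hR' => hne (Eq.trans hR.symm hR')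
  · exact fun q _ => measurableSet_restrictEvent q

section

variable {ν ν' : Measure (PosetOn ℕ)} [IsProbabilityMeasure ν] [IsProbabilityMeasure ν']

theorem measure_ext_of_restrictEvent
    (h : ∀ (A : Finset ℕ) [Nonempty A] (Q : PosetOn A),
      ν.real (restrictEvent Q) = ν'.real (restrictEvent Q)) : ν = ν' :=
  measure_ext_of_containsEvent fun A _ Q => by
    rw [measureReal_containsEvent_eq_sum, measureReal_containsEvent_eq_sum]
    exact finsum_mem_congr rfl fun q _ => h A q

theorem eq_pInftyMixture_iff_containsEvent {m : Measure ProperPosetLimit}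
    [IsProbabilityMeasure m] :
    ν = pInftyMixture m ↔ ∀ (A : Finset ℕ) [Nonempty A] (Q : PosetOn A),
      ∫ Γ, PosetLimit.t Q.unlabelled Γ.1 ∂m = ν.real (containsEvent Q) := by
  simp only [← pInftyMixture_real_containsEvent]
  exact ⟨fun h A _ Q => h ▸ rfl, fun h => (measure_ext_of_containsEvent h).symm⟩

theorem eq_pInftyMixture_iff_restrictEvent {m : Measure ProperPosetLimit}
    [IsProbabilityMeasure m] :
    ν = pInftyMixture m ↔ ∀ (A : Finset ℕ) [Nonempty A] (Q : PosetOn A),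
      ∫ Γ, PosetLimit.tInd Q.unlabelled Γ.1 ∂m = ν.real (restrictEvent Q) := by
  simp only [← pInftyMixture_real_restrictEvent]
  exact ⟨fun h A _ Q => h ▸ rfl, fun h => (measure_ext_of_restrictEvent h).symm⟩

theorem eq_pInftyLaw_iff_containsEvent {Γ : ProperPosetLimit} :
    ν = pInftyLaw Γ ↔ ∀ (A : Finset ℕ) [Nonempty A] (Q : PosetOn A),
      PosetLimit.t Q.unlabelled Γ.1 = ν.real (containsEvent Q) := by
  refine ⟨?_, fun h => measure_ext_of_containsEvent fun A _ Q =>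
    (h A Q).symm.trans (hasDensities_pInftyLaw Γ A Q).symm⟩
  rintro rfl A _ Q
  exact (hasDensities_pInftyLaw Γ A Q).symm

theorem eq_pInftyLaw_iff_restrictEvent {Γ : ProperPosetLimit} :
    ν = pInftyLaw Γ ↔ ∀ (A : Finset ℕ) [Nonempty A] (Q : PosetOn A),
      PosetLimit.tInd Q.unlabelled Γ.1 = ν.real (restrictEvent Q) := by
  simp only [← pInftyLaw_real_restrictEvent]
  exact ⟨fun h A _ Q => h ▸ rfl, fun h => (measure_ext_of_restrictEvent h).symm⟩

end

theorem tendsto_integral_initialSegment_pInftyLaw (Γ : ProperPosetLimit)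
    (F : BoundedContinuousFunction PosetLimit ℝ) :
    Tendsto (fun n => ∫ R, F (initialSegment n R) ∂pInftyLaw Γ) atTop (𝓝 (F Γ.1)) := by
  have : Tendsto (fun n => ∫ R, F (initialSegment n R) ∂pInftyLaw Γ) atTop
      (𝓝 (∫ _, F Γ.1 ∂pInftyLaw Γ)) := by
    refine tendsto_integral_of_dominated_convergence (fun _ => ‖F‖)
      (fun n => (F.continuous.measurable.comp (measurable_initialSegment n)).aestronglyMeasurable)
      (integrable_const _) (fun n => ae_of_all _ fun R => F.norm_coe_le_norm _) ?_
    filter_upwards [(hasDensities_pInftyLaw Γ).ae_tendsto_initialSegment] with R hR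
    exact (F.continuous.tendsto _).comp hR
  simpa using this

theorem tendsto_integral_initialSegment (m : Measure ProperPosetLimit) [IsProbabilityMeasure m]
    (F : BoundedContinuousFunction PosetLimit ℝ) :
    Tendsto (fun n => ∫ R, F (initialSegment n R) ∂pInftyMixture m) atTop
      (𝓝 (∫ Γ, F Γ.1 ∂m)) := by
  have hmeas (n : ℕ) : Measurable fun R => F (initialSegment n R) :=
    F.continuous.measurable.comp (measurable_initialSegment n)
  have hbound (n : ℕ) (R : PosetOn ℕ) : ‖F (initialSegment n R)‖ ≤ ‖F‖ := F.norm_coe_le_norm _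
  have hint (n : ℕ) : Integrable (fun R => F (initialSegment n R)) (pInftyMixture m) :=
    Integrable.of_bound (hmeas n).aestronglyMeasurable ‖F‖ (ae_of_all _ (hbound n))
  simp only [integral_pInftyMixture m (hint _)]
  refine tendsto_integral_of_dominated_convergence (fun _ => ‖F‖) (fun n => ?_)
    (integrable_const _) (fun n => ae_of_all _ fun Γ => ?_)
    (ae_of_all _ fun Γ => tendsto_integral_initialSegment_pInftyLaw Γ F)
  · have hmeas_snd : StronglyMeasurable fun p : ProperPosetLimit × PosetOn ℕ =>
        F (initialSegment n p.2) := ((hmeas n).comp measurable_snd).stronglyMeasurable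
    exact (hmeas_snd.integral_kernel_prod_right' (κ := pInftyKernel)).aestronglyMeasurable
  · simpa using norm_integral_le_of_norm_le_const (μ := pInftyLaw Γ) (ae_of_all _ (hbound n))

theorem tendstoInDistribution_initialSegment (m : Measure ProperPosetLimit)
    [IsProbabilityMeasure m] :
    TendstoInDistribution initialSegment atTop (fun Γ : ProperPosetLimit => Γ.1)
      (fun _ => pInftyMixture m) m where
  forall_aemeasurable n := (measurable_initialSegment n).aemeasurable
  aemeasurable_limit := measurable_subtype_coe.aemeasurable
  tendsto := by
    refine ProbabilityMeasure.tendsto_iff_forall_integral_tendsto.2 fun F => ?_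
    have hF := F.continuous.measurable.aestronglyMeasurable (μ := m.map Subtype.val)
    have hF' (n : ℕ) := F.continuous.measurable.aestronglyMeasurable
      (μ := (pInftyMixture m).map (initialSegment n))
    simp only [ProbabilityMeasure.coe_mk,
      integral_map (measurable_initialSegment _).aemeasurable (hF' _),
      integral_map measurable_subtype_coe.aemeasurable hF]
    exact tendsto_integral_initialSegment m F

theorem measurableEmbedding_properPosetLimit_val :
    MeasurableEmbedding (Subtype.val : ProperPosetLimit → PosetLimit) :=
  .subtype_coe isClosed_proper.measurableSet

theorem pInftyMixture_injective {m m' : Measure ProperPosetLimit} [IsProbabilityMeasure m]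
    [IsProbabilityMeasure m'] (h : pInftyMixture m = pInftyMixture m') : m = m' := by
  have tendsto_m := (tendstoInDistribution_initialSegment m).tendsto
  simp only [h] at tendsto_m
  have map_eq : m.map Subtype.val = m'.map Subtype.val :=
    congrArg (fun M : ProbabilityMeasure PosetLimit => (M : Measure PosetLimit))
      (tendsto_nhds_unique tendsto_m (tendstoInDistribution_initialSegment m').tendsto)
  have hval := measurableEmbedding_properPosetLimit_val
  rw [← hval.comap_map m, map_eq, hval.comap_map]

theorem pInftyMixture_dirac (Γ : ProperPosetLimit) :
    pInftyMixture (Measure.dirac Γ) = pInftyLaw Γ :=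
  Measure.dirac_bind measurable_pInftyLaw Γ

theorem pInftyLaw_injective : Function.Injective pInftyLaw := by
  intro Γ Γ' h
  rw [← pInftyMixture_dirac, ← pInftyMixture_dirac] at h
  exact injective_dirac (pInftyMixture_injective h)

/-! ### Exchangeable laws are mixtures -/

theorem Exchangeable.real_embEvent {ν : Measure (PosetOn ℕ)} (h : Exchangeable ν) {V : Type*}
    [Finite V] (q : PosetOn V) {ι ι' : V → ℕ} (hι : Function.Injective ι)
    (hι' : Function.Injective ι') : ν.real (embEvent q ι) = ν.real (embEvent q ι') := by
  obtain ⟨σ, hσ⟩ : ∃ σ : Equiv.Perm ℕ, ∀ x, σ (ι x) = ι' x :=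
    Equiv.Perm.exists_extending_pair ι ι' hι hι'
  have preimage_eq : (fun R : PosetOn ℕ => R.comap σ) ⁻¹' embEvent q ι = embEvent q ι' := by
    rw [← funext hσ]
    rfl
  rw [← preimage_eq, ← map_measureReal_apply (PosetOn.measurable_comap σ)
    (measurableSet_embEvent q ι), h σ]

theorem Exchangeable.tendsto_integral_t_initialSegment {ν : Measure (PosetOn ℕ)}
    [IsProbabilityMeasure ν] (h : Exchangeable ν) {A : Finset ℕ} [Nonempty A] (Q : PosetOn A) :
    Tendsto (fun n => ∫ R, PosetLimit.t Q.unlabelled (initialSegment n R) ∂ν) atTop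
      (𝓝 (ν.real (containsEvent Q))) := by
  refine tendsto_iff_norm_sub_tendsto_zero.2 <| squeeze_zero (fun n => norm_nonneg _)
    (abs_integral_t_initialSegment_sub_le Q
      fun ι hι => h.real_embEvent Q hι Subtype.val_injective) ?_
  simpa [div_eq_mul_inv] using
    (tendsto_one_div_add_atTop_nhds_zero_nat (𝕜 := ℝ)).const_mul ((Nat.card A : ℝ) ^ 2)

instance : CompactSpace PosetLimit :=
  isCompact_iff_compactSpace.1 isClosed_closure.isCompact

theorem exists_forall_integral_eq_of_tendsto {Ω X : Type*} [MeasurableSpace Ω] {μ : Measure Ω}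
    [IsProbabilityMeasure μ] [TopologicalSpace X] [CompactSpace X] [T2Space X] [MeasurableSpace X]
    [BorelSpace X] [HasOuterApproxClosed X] [SecondCountableTopology X]
    {f : ℕ → Ω → X} (hf : ∀ n, Measurable (f n)) :
    ∃ M : ProbabilityMeasure X, ∀ (F : C(X, ℝ)) (c : ℝ),
      Tendsto (fun n => ∫ ω, F (f n ω) ∂μ) atTop (𝓝 c) → ∫ x, F x ∂(M : Measure X) = c := by
  let law (n : ℕ) : ProbabilityMeasure X :=
    ⟨μ.map (f n), Measure.isProbabilityMeasure_map (hf n).aemeasurable⟩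
  have integral_law (n : ℕ) (F : C(X, ℝ)) :
      ∫ x, F x ∂(law n : Measure X) = ∫ ω, F (f n ω) ∂μ :=
    integral_map (hf n).aemeasurable
      F.continuous.measurable.stronglyMeasurable.aestronglyMeasurable
  obtain ⟨M, -, hM⟩ := isCompact_univ (X := ProbabilityMeasure X) (f := map law atTop) (by simp)
  refine ⟨M, fun F c hc => ?_⟩
  have clusterPt : MapClusterPt (∫ x, F x ∂(M : Measure X)) atTop
      (fun n => ∫ x, F x ∂(law n : Measure X)) :=
    MapClusterPt.continuousAt_comp
      (ProbabilityMeasure.continuous_integral_continuousMap F).continuousAt hM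
  simp only [integral_law] at clusterPt
  exact eq_of_nhds_neBot (clusterPt.neBot.mono (inf_le_inf_left _ hc))

theorem ae_proper_of_integral_invSize_eq_zero {M : Measure PosetLimit} [IsFiniteMeasure M]
    (h : ∫ Γ, PosetLimit.invSize Γ ∂M = 0) : ∀ᵐ Γ ∂M, Γ ∉ Set.range FinPoset.toLimit := by
  have integrable_invSize : Integrable PosetLimit.invSize M := by
    refine Integrable.of_bound PosetLimit.continuous_invSize.measurable.aestronglyMeasurable 1
      (ae_of_all _ fun Γ => ?_)
    rw [Real.norm_of_nonneg Γ.invSize_mem.1]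
    exact Γ.invSize_mem.2
  filter_upwards [(integral_eq_zero_iff_of_nonneg (fun Γ => Γ.invSize_mem.1)
    integrable_invSize).1 h] with Γ hΓ
  exact (notMem_range_toLimit_iff Γ).2 hΓ

theorem exists_map_val_eq {M : Measure PosetLimit} [IsProbabilityMeasure M]
    (h : ∀ᵐ Γ ∂M, Γ ∉ Set.range FinPoset.toLimit) :
    ∃ m : Measure ProperPosetLimit, IsProbabilityMeasure m ∧ m.map Subtype.val = M := by
  have map_comap : (M.comap Subtype.val).map (Subtype.val : ProperPosetLimit → PosetLimit) = M := by
    rw [measurableEmbedding_properPosetLimit_val.map_comap, Subtype.range_coe_subtype]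
    exact Measure.restrict_eq_self_of_ae_mem h
  refine ⟨M.comap Subtype.val, ⟨?_⟩, map_comap⟩
  rw [← Set.preimage_univ (f := (Subtype.val : ProperPosetLimit → PosetLimit)),
    ← Measure.map_apply measurable_subtype_coe MeasurableSet.univ, map_comap, measure_univ]

theorem Exchangeable.exists_mixture {ν : Measure (PosetOn ℕ)} [IsProbabilityMeasure ν]
    (h : Exchangeable ν) :
    ∃ m : Measure ProperPosetLimit, IsProbabilityMeasure m ∧ pInftyMixture m = ν := by
  obtain ⟨M, hM⟩ := exists_forall_integral_eq_of_tendsto (μ := ν) measurable_initialSegment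
  have integral_invSize : ∫ Γ, PosetLimit.invSize Γ ∂(M : Measure PosetLimit) = 0 := by
    refine hM ⟨PosetLimit.invSize, PosetLimit.continuous_invSize⟩ 0 ?_
    simpa [invSize_initialSegment] using tendsto_one_div_add_atTop_nhds_zero_nat (𝕜 := ℝ)
  obtain ⟨m, hm, map_val⟩ :=
    exists_map_val_eq (ae_proper_of_integral_invSize_eq_zero integral_invSize)
  refine ⟨m, hm, measure_ext_of_containsEvent fun A _ Q => ?_⟩
  rw [pInftyMixture_real_containsEvent,
    ← measurableEmbedding_properPosetLimit_val.integral_map (PosetLimit.t Q.unlabelled), map_val]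
  exact hM ⟨PosetLimit.t Q.unlabelled, PosetLimit.continuous_t _⟩ _
    (h.tendsto_integral_t_initialSegment Q)

theorem bijOn_pInftyMixture :
    Set.BijOn pInftyMixture {m : Measure ProperPosetLimit | IsProbabilityMeasure m}
      exchangeableLaws := by
  refine ⟨fun m (_ : IsProbabilityMeasure m) => ⟨inferInstance, exchangeable_pInftyMixture m⟩,
    fun m (_ : IsProbabilityMeasure m) m' (_ : IsProbabilityMeasure m') h =>
      pInftyMixture_injective h, ?_⟩
  rintro ν ⟨_, hex⟩
  exact hex.exists_mixture

/-! ### Extreme points -/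

theorem pInftyMixture_combo (a b : NNReal) (m m' : Measure ProperPosetLimit) :
    pInftyMixture (a • m + b • m') = a • pInftyMixture m + b • pInftyMixture m' := by
  ext s hs
  simp only [pInftyMixture_apply _ hs, Measure.add_apply, Measure.smul_apply,
    lintegral_add_measure, lintegral_smul_measure]

section

variable {Ω : Type*} [MeasurableSpace Ω]

theorem isProbabilityMeasure_combo (m m' : Measure Ω) [IsProbabilityMeasure m]
    [IsProbabilityMeasure m'] {a b : NNReal} (hab : a + b = 1) :
    IsProbabilityMeasure (a • m + b • m') := by
  constructor
  simp only [Measure.add_apply, Measure.smul_apply, measure_univ, ENNReal.smul_def, smul_eq_mul,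
    mul_one]
  exact_mod_cast hab

theorem eq_dirac_of_ae_eq {m : Measure Ω} [IsProbabilityMeasure m] {a : Ω}
    (h : ∀ᵐ x ∂m, x = a) : m = Measure.dirac a := by
  have map_eq : m.map id = m.map fun _ => a := Measure.map_congr h
  rwa [Measure.map_id, Measure.map_const, measure_univ, one_smul] at map_eq

theorem eq_dirac_of_combo_eq_dirac [MeasurableSingletonClass Ω] {m m' : Measure Ω}
    [IsProbabilityMeasure m] {a b : NNReal} (ha : 0 < a) {x : Ω}
    (h : a • m + b • m' = Measure.dirac x) : m = Measure.dirac x := by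
  have null : (a • m + b • m') {x}ᶜ = 0 := by
    rw [h]
    simp
  rw [Measure.add_apply, add_eq_zero, Measure.smul_apply, ENNReal.smul_def, smul_eq_mul,
    mul_eq_zero] at null
  exact eq_dirac_of_ae_eq (null.1.resolve_left (by simpa using ha.ne'))

theorem combo_cond_compl (m : Measure Ω) [IsFiniteMeasure m] {s : Set Ω} (hs : MeasurableSet s)
    (h : m s ≠ 0) (h' : m sᶜ ≠ 0) :
    (m s).toNNReal • cond m s + (m sᶜ).toNNReal • cond m sᶜ = m := by
  ext u _
  simp only [Measure.add_apply, Measure.smul_apply, ENNReal.smul_def, smul_eq_mul,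
    ENNReal.coe_toNNReal (measure_ne_top _ _), cond_apply hs, cond_apply hs.compl]
  rw [ENNReal.mul_inv_cancel_left h (measure_ne_top _ _),
    ENNReal.mul_inv_cancel_left h' (measure_ne_top _ _), Set.inter_comm, Set.inter_comm sᶜ]
  exact measure_inter_add_sdiff u hs

theorem exists_eq_dirac_of_zero_one [MeasurableSpace.CountablySeparated Ω] {m : Measure Ω}
    [IsProbabilityMeasure m] (h : ∀ s, MeasurableSet s → m s = 0 ∨ m sᶜ = 0) :
    ∃ x, m = Measure.dirac x := by
  have : Nonempty Ω := m.nonempty_of_neZero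
  obtain ⟨x, hx⟩ := Filter.exists_eventuallyEq_const_of_forall_separating (l := ae m)
    (f := (id : Ω → Ω)) MeasurableSet fun U hU =>
      (h U hU).symm.imp id fun hU₀ => measure_eq_zero_iff_ae_notMem.1 hU₀
  exact ⟨x, eq_dirac_of_ae_eq hx⟩

end

theorem pInftyLaw_mem_extremePoints (Γ : ProperPosetLimit) :
    pInftyLaw Γ ∈ Set.extremePoints NNReal exchangeableLaws := by
  refine ⟨⟨inferInstance, (hasDensities_pInftyLaw Γ).exchangeable⟩, ?_⟩
  rintro ν₁ ⟨_, hex₁⟩ ν₂ ⟨_, hex₂⟩ ⟨a, b, ha, _, hab, combo_eq⟩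
  obtain ⟨m₁, _, rfl⟩ := hex₁.exists_mixture
  obtain ⟨m₂, _, rfl⟩ := hex₂.exists_mixture
  have := isProbabilityMeasure_combo m₁ m₂ hab
  rw [← pInftyMixture_combo, ← pInftyMixture_dirac] at combo_eq
  rw [eq_dirac_of_combo_eq_dirac ha (pInftyMixture_injective combo_eq), pInftyMixture_dirac]

/-- If `0 < m s < 1`, the decomposition of `m` into its conditionings on `s` and `sᶜ` is a proper
convex decomposition of the mixture. -/
theorem measure_eq_zero_or_compl_of_mem_extremePoints {m : Measure ProperPosetLimit}
    [IsProbabilityMeasure m]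
    (hm : pInftyMixture m ∈ Set.extremePoints NNReal exchangeableLaws)
    {s : Set ProperPosetLimit} (hs : MeasurableSet s) : m s = 0 ∨ m sᶜ = 0 := by
  by_contra! hpos
  obtain ⟨hs₀, hsc₀⟩ := hpos
  have : IsProbabilityMeasure (cond m s) := cond_isProbabilityMeasure hs₀
  have : IsProbabilityMeasure (cond m sᶜ) := cond_isProbabilityMeasure hsc₀
  have weights_add : (m s).toNNReal + (m sᶜ).toNNReal = 1 := by
    rw [← ENNReal.toNNReal_add (measure_ne_top _ _) (measure_ne_top _ _),
      measure_add_measure_compl hs, measure_univ, ENNReal.toNNReal_one]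
  have mixture_cond_eq : pInftyMixture (cond m s) = pInftyMixture m :=
    hm.2 ⟨inferInstance, exchangeable_pInftyMixture _⟩
      ⟨inferInstance, exchangeable_pInftyMixture (cond m sᶜ)⟩
      ⟨(m s).toNNReal, (m sᶜ).toNNReal, ENNReal.toNNReal_pos hs₀ (measure_ne_top _ _),
        ENNReal.toNNReal_pos hsc₀ (measure_ne_top _ _), weights_add,
        by rw [← pInftyMixture_combo, combo_cond_compl m hs hs₀ hsc₀]⟩
  refine hsc₀ ?_
  rw [← pInftyMixture_injective mixture_cond_eq, cond_apply hs, Set.inter_compl_self,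
    measure_empty, mul_zero]

theorem bijOn_pInftyLaw :
    Set.BijOn pInftyLaw Set.univ (Set.extremePoints NNReal exchangeableLaws) := by
  refine ⟨fun Γ _ => pInftyLaw_mem_extremePoints Γ, pInftyLaw_injective.injOn, fun ν hν => ?_⟩
  obtain ⟨_, hex⟩ := hν.1
  obtain ⟨m, _, rfl⟩ := hex.exists_mixture
  obtain ⟨Γ, rfl⟩ := exists_eq_dirac_of_zero_one fun s hs =>
    measure_eq_zero_or_compl_of_mem_extremePoints hν hs
  exact ⟨Γ, Set.mem_univ Γ, (pInftyMixture_dirac Γ).symm⟩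

end PosetLimits

end

theorem theorem1p5 :
    -- The functionals `t_ind(Q,·)` extend continuously to the space of poset limits.
    (∀ Q : FinPoset, Continuous (PosetLimit.tInd Q) ∧
      ∀ P : FinPoset, PosetLimit.tInd Q P.toLimit = FinPoset.tInd Q P) ∧
    -- `P(∞,Γ)` is well defined: a representing kernel exists, and any two give the same law.
    (∀ Γ : ProperPosetLimit,
      (∃ (S : OrderedProbabilitySpace.{0}) (K : PosetKernel S), K.Represents Γ) ∧
      ∀ (S : OrderedProbabilitySpace.{u}) (K : PosetKernel S),
        K.Represents Γ → K.law = pInftyLaw Γ) ∧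
    -- (i)
    (Set.BijOn pInftyMixture {m : Measure ProperPosetLimit | IsProbabilityMeasure m}
        exchangeableLaws ∧
      ∀ (m : Measure ProperPosetLimit) (ν : Measure (PosetOn ℕ))
        [IsProbabilityMeasure m] [IsProbabilityMeasure ν], Exchangeable ν →
        (ν = pInftyMixture m ↔
          ∀ (A : Finset ℕ) [Nonempty A] (Q : PosetOn A),
            ∫ Γ, PosetLimit.t Q.unlabelled Γ.1 ∂m = ν.real (containsEvent Q)) ∧
        (ν = pInftyMixture m ↔
          ∀ (A : Finset ℕ) [Nonempty A] (Q : PosetOn A),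
            ∫ Γ, PosetLimit.tInd Q.unlabelled Γ.1 ∂m = ν.real (restrictEvent Q)) ∧
        (ν = pInftyMixture m →
          TendstoInDistribution initialSegment atTop
            (fun Γ : ProperPosetLimit => Γ.1) (fun _ => ν) m)) ∧
    -- (ii)
    (Set.BijOn pInftyLaw Set.univ (Set.extremePoints NNReal exchangeableLaws) ∧
      ∀ (Γ : ProperPosetLimit) (ν : Measure (PosetOn ℕ))
        [IsProbabilityMeasure ν], Exchangeable ν →
        (ν = pInftyLaw Γ ↔
          ∀ (A : Finset ℕ) [Nonempty A] (Q : PosetOn A),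
            PosetLimit.t Q.unlabelled Γ.1 = ν.real (containsEvent Q)) ∧
        (ν = pInftyLaw Γ ↔
          ∀ (A : Finset ℕ) [Nonempty A] (Q : PosetOn A),
            PosetLimit.tInd Q.unlabelled Γ.1 = ν.real (restrictEvent Q)) ∧
        (ν = pInftyLaw Γ →
          ∀ᵐ R ∂ν, Tendsto (fun n => initialSegment n R) atTop (𝓝 Γ.1))) := by
  refine ⟨fun Q => ⟨PosetLimit.continuous_tInd Q, PosetLimit.tInd_toLimit Q⟩,
    fun Γ => ⟨exists_posetKernel Γ, fun S K hK => hK.law_eq⟩,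
    ⟨bijOn_pInftyMixture, fun m ν _ _ _ =>
      ⟨eq_pInftyMixture_iff_containsEvent, eq_pInftyMixture_iff_restrictEvent, ?_⟩⟩,
    bijOn_pInftyLaw, fun Γ ν _ _ =>
      ⟨eq_pInftyLaw_iff_containsEvent, eq_pInftyLaw_iff_restrictEvent, ?_⟩⟩
  · rintro rfl
    exact tendstoInDistribution_initialSegment m
  · rintro rfl
    exact (hasDensities_pInftyLaw Γ).ae_tendsto_initialSegment
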